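/- Let $K$ be a planar convex body (compact, convex, with nonempty interior), of area $|K|$, and let $\vec u(\theta)=(\cos\theta,\sin\theta)$. For $0<\alpha<1$ and $\theta\in\mathbb R/2\pi\mathbb Z$, let $\Delta(\alpha,\theta)$ be the unique line oriented by $\vec u(\theta)$ such that the part of $K$ on its right has area $\alpha|K|$, let $\Delta^+(\alpha,\theta)$ be the closed half-plane on its left, and let $m(\alpha,\theta)$ be the midpoint of the chord $\Delta(\alpha,\theta)\cap K$. Let $m^*_\alpha=\{m(\alpha,\theta):\theta\in\mathbb R/2\pi\mathbb Z\}$ (the envelope of the $\alpha$-sections) and let $K_\alpha=\bigcap_\theta\Delta^+(\alpha,\theta)$ (the $\alpha$-core). The curve $m(\alpha,\cdot)$ has left and right derivatives $v_l(\alpha,\theta)\,\vec u(\theta)$ and $v_r(\alpha,\theta)\,\vec u(\theta)$ with respect to $\theta$; let $V(\alpha,\theta)$ be the segment with endpoints $v_l(\alpha,\theta)$ and $v_r(\alpha,\theta)$. Let $\alpha_Z$ (resp. $\alpha_B$) be the infimum of the $\alpha\in(0,1)$ for which some $V(\alpha,\theta)$ contains $0$ (resp. a negative number), and let $\alpha_K$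 be the supremum of the $\alpha\in(0,1)$ with $K_\alpha\neq\emptyset$. (a) If $\alpha_Z<\alpha<1-\alpha_Z$, then $m^*_\alpha$ is not a $C^1$ curve, i.e. not a one-dimensional $C^1$ submanifold of the plane. (b) The number $\alpha_K$ is the critical value of the $\alpha$-core: $K_\alpha$ is strictly convex with nonempty interior for $0<\alpha<\alpha_K$, $K_{\alpha_K}$ is a single point, and $K_\alpha=\emptyset$ for $\alpha_K<\alpha<1$. Moreover $\frac49\le\alpha_K\le\frac12$, with $\alpha_K=\frac49$ if and only if $K$ is a triangle, and $\alpha_K=\frac12$ if and only if $K$ is centrally symmetric. (c) If $K$ is not centrally symmetric, then $\alpha_B<\alpha_K$; if $K$ is centrally symmetric, then $\alpha_B=\alpha_K=\frac12$. -/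

import Mathlib

open MeasureTheory

noncomputable section

namespace AlphaCore

/-- The Euclidean plane. -/
abbrev Plane : Type := EuclideanSpace ℝ (Fin 2)

/-- The unit vector `u(θ) = (cos θ, sin θ)`. Angles are real numbers; everything below is
`2π`-periodic in the angle. -/
def dir (θ : ℝ) : Plane := !₂[Real.cos θ, Real.sin θ]

/-- The unit vector `u'(θ) = (-sin θ, cos θ)`, the counterclockwise normal of `u(θ)`. -/
def nor (θ : ℝ) : Plane := !₂[-Real.sin θ, Real.cos θ]

/-- The closed half-plane on the left of the line oriented by `u(θ)` at signed distance `t`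
from the origin. -/
def leftHalfPlane (θ t : ℝ) : Set Plane := {x | t ≤ inner ℝ x (nor θ)}

/-- The closed half-plane on the right of the line oriented by `u(θ)` at signed distance `t`
from the origin. -/
def rightHalfPlane (θ t : ℝ) : Set Plane := {x | inner ℝ x (nor θ) ≤ t}

/-- The oriented line `(θ, t)` is an `α`-section of `K`: the part of `K` on its right has area
`α |K|`. -/
def IsAlphaSection (K : Set Plane) (α θ t : ℝ) : Prop :=
  volume.real (K ∩ rightHalfPlane θ t) = α * volume.real K

/-- The `α`-core of `K`: the intersection of the left half-planes of all `α`-sections of `K`. -/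
def core (K : Set Plane) (α : ℝ) : Set Plane :=
  {x | ∀ θ t : ℝ, IsAlphaSection K α θ t → x ∈ leftHalfPlane θ t}

/-- The signed distance to the origin of the `α`-section of `K` of direction `u(θ)`
(which exists and is unique when `K` is a convex body and `0 < α < 1`). -/
def offset (K : Set Plane) (α θ : ℝ) : ℝ :=
  Classical.epsilon fun t => IsAlphaSection K α θ t

/-- The abscissae, along `u(θ)`, of the points of the chord cut in `K` by the `α`-section of
direction `u(θ)`. -/
def chordParams (K : Set Plane) (α θ : ℝ) : Set ℝ :=
  {s | offset K α θ • nor θ + s • dir θ ∈ K}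

/-- The initial endpoint `b(α, θ)` of the chord. -/
def chordStart (K : Set Plane) (α θ : ℝ) : Plane :=
  offset K α θ • nor θ + sInf (chordParams K α θ) • dir θ

/-- The final endpoint `c(α, θ)` of the chord. -/
def chordEnd (K : Set Plane) (α θ : ℝ) : Plane :=
  offset K α θ • nor θ + sSup (chordParams K α θ) • dir θ

/-- The midpoint `m(α, θ)` of the chord; `θ ↦ m(α, θ)` parametrizes the envelope of the
`α`-sections. -/
def mid (K : Set Plane) (α θ : ℝ) : Plane :=
  midpoint ℝ (chordStart K α θ) (chordEnd K α θ)

/-- The envelope `m*_α` as a subset of the plane: the image of `θ ↦ m(α, θ)`. -/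
def envelope (K : Set Plane) (α : ℝ) : Set Plane := Set.range (mid K α)

/-- `v_l(α, θ)`: the component along `u(θ)` of the left derivative of `m(α, ·)` at `θ`. -/
def velLeft (K : Set Plane) (α θ : ℝ) : ℝ :=
  inner ℝ (derivWithin (mid K α) (Set.Iic θ) θ) (dir θ)

/-- `v_r(α, θ)`: the component along `u(θ)` of the right derivative of `m(α, ·)` at `θ`. -/
def velRight (K : Set Plane) (α θ : ℝ) : ℝ :=
  inner ℝ (derivWithin (mid K α) (Set.Ici θ) θ) (dir θ)

/-- `V(α, θ)`: the segment of endpoints `v_l(α, θ)` and `v_r(α, θ)`. -/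
def velSegment (K : Set Plane) (α θ : ℝ) : Set ℝ :=
  Set.uIcc (velLeft K α θ) (velRight K α θ)

/-- The zero set `Z(α)`. -/
def zeroSet (K : Set Plane) (α : ℝ) : Set ℝ := {θ | (0 : ℝ) ∈ velSegment K α θ}

/-- The backwards set `B(α)`. -/
def backwardsSet (K : Set Plane) (α : ℝ) : Set ℝ :=
  {θ | (velSegment K α θ ∩ Set.Iio 0).Nonempty}

/-- `α_Z`, the infimum of the `α ∈ ]0,1[` with `Z(α) ≠ ∅`. -/
def alphaZ (K : Set Plane) : ℝ := sInf {α | α ∈ Set.Ioo (0 : ℝ) 1 ∧ (zeroSet K α).Nonempty}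

/-- `α_B`, the infimum of the `α ∈ ]0,1[` with `B(α) ≠ ∅`. -/
def alphaB (K : Set Plane) : ℝ :=
  sInf {α | α ∈ Set.Ioo (0 : ℝ) 1 ∧ (backwardsSet K α).Nonempty}

/-- `α_K`, the supremum of the `α ∈ ]0,1[` for which the `α`-core is nonempty. -/
def alphaK (K : Set Plane) : ℝ := sSup {α | α ∈ Set.Ioo (0 : ℝ) 1 ∧ (core K α).Nonempty}

/-- The property characterizing the critical value of the `α`-core: before it the core is
strictly convex with nonempty interior, at it the core is a single point, after it the core
is empty. -/
def IsCoreCriticalValue (K : Set Plane) (a : ℝ) : Prop :=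
  a ∈ Set.Ioo (0 : ℝ) 1 ∧
  (∀ α, 0 < α → α < a → StrictConvex ℝ (core K α) ∧ (interior (core K α)).Nonempty) ∧
  (∃ T : Plane, core K a = {T}) ∧
  (∀ α, a < α → α < 1 → core K α = ∅)

/-- `S` is a `C¹` curve, i.e. a one-dimensional `C¹` submanifold of the plane: near each of its
points it is, in a suitable orthonormal frame, the graph of a `C¹` function. -/
def IsC1Curve (S : Set Plane) : Prop :=
  ∀ p ∈ S, ∃ (φ : ℝ) (f : ℝ → ℝ) (U : Set Plane),
    ContDiff ℝ 1 f ∧ IsOpen U ∧ p ∈ U ∧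
      S ∩ U = {x | inner ℝ x (nor φ) = f (inner ℝ x (dir φ))} ∩ U

/-- `K` is centrally symmetric. -/
def IsCentrallySymmetric (K : Set Plane) : Prop :=
  ∃ c : Plane, ∀ x ∈ K, Equiv.pointReflection c x ∈ K

/-- `K` is a (nondegenerate, solid) triangle. -/
def IsTriangle (K : Set Plane) : Prop :=
  ∃ T : Affine.Triangle ℝ Plane, K = convexHull ℝ (Set.range T.points)

end AlphaCore

end

open MeasureTheory

noncomputable section

namespace AlphaCore

open Filter Topology Set

variable {K : Set Plane}

/-! Write u, n for `dir`, `nor`, and p, m for `offset K α`, `mid K α`. Everything rests on two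
derivatives. Among lines meeting the interior of `K`, the area cut off is differentiable, its
derivative being the first-order displacement integrated along the chord. Keeping the area fixed
gives p' = -⟨m, u⟩ (`IsBody.hasDerivAt_offset`): an `α`-section turns about the midpoint of its
chord. Seen in a fixed frame, the left boundary of `K` is the graph of a convex function `lam`, and
the one-sided velocities of m are a positive multiple of the difference of the boundary slopes at
the two ends of the chord (`IsBody.velRight_eq`, `IsBody.velLeft_eq`). Reversing orientations
exchanges `α` with `1 - α` and changes the sign of the velocity.

Core. If x is in the core and lies on the section of angle θ, then ⟨x, n⟩ - p is minimal at θ, so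
its derivative vanishes and x = m(θ) (`IsBody.eq_mid_of_mem_core`). Two distinct core points
therefore never touch the same section, so points strictly between them clear all sections. This
gives strict convexity, and it shows that the core at `alphaK` is a single point, since otherwise
`α` could still be increased. The bound 4/9 comes from the centroid and Winternitz's inequality
(`winternitz`), proved by comparing the concave chord length with a linear density. Equality makes
the chord length linear, hence `K` a triangle; in a triangle, a suitable line through any point cuts
off at a vertex at most a homothetic copy of ratio 2/3.

Backward motion. An envelope that never moves backwards lies in the core (`IsBody.mid_mem_core`).
Were `alphaB` at least `alphaK`, letting `α` increase to `alphaK` would put the whole envelope at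
the single core point; all sections would pass through it and `K` would be symmetric
(`IsBody.symmetric_of_offset_eq`). In a symmetric body, convexity of `lam` gives nonnegative
velocities for `α < 1 / 2`.

Smoothness. Suppose the envelope is a `C¹` curve. Then m is constant on no interval, and the tangent
at m(θ) is parallel to u(θ), so the extrema of the height ⟨·, n(θ)⟩ occur at the parameters θ and θ
+ π. By connectedness the envelope lies always on the left of its sections or always on the right
(`IsBody.envelope_one_sided`), so velocities are nonnegative for `α` or for `1 - α`. But a zero
velocity at a smaller parameter then forces parallel boundary segments at the two ends of a chord,
and m is stationary on an interval (`IsBody.velRight_eq_zero_of_zeroSet`), a contradiction. -/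

/-! ### The rotating orthonormal frame -/

/-- The point with coordinates `(s, t)` in the frame `(u(θ), u'(θ))`. -/
def pt (θ t s : ℝ) : Plane := t • nor θ + s • dir θ

lemma inner_eq (x y : Plane) : inner ℝ x y = x 0 * y 0 + x 1 * y 1 := by
  simp [PiLp.inner_apply, Fin.sum_univ_two, mul_comm]

@[simp] lemma dir_zero_apply (θ : ℝ) : dir θ 0 = Real.cos θ := rfl
@[simp] lemma dir_one_apply (θ : ℝ) : dir θ 1 = Real.sin θ := rfl
@[simp] lemma nor_zero_apply (θ : ℝ) : nor θ 0 = -Real.sin θ := rfl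
@[simp] lemma nor_one_apply (θ : ℝ) : nor θ 1 = Real.cos θ := rfl

lemma plane_ext {x y : Plane} (h0 : x 0 = y 0) (h1 : x 1 = y 1) : x = y := by
  ext i; fin_cases i <;> assumption

lemma inner_dir_dir (θ φ : ℝ) : inner ℝ (dir θ) (dir φ) = Real.cos (θ - φ) := by
  rw [inner_eq, Real.cos_sub]; simp
lemma inner_nor_nor (θ φ : ℝ) : inner ℝ (nor θ) (nor φ) = Real.cos (θ - φ) := by
  rw [inner_eq, Real.cos_sub]; simp; ring
lemma inner_dir_nor (θ φ : ℝ) : inner ℝ (dir θ) (nor φ) = Real.sin (θ - φ) := by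
  rw [inner_eq, Real.sin_sub]; simp; ring
lemma inner_nor_dir (θ φ : ℝ) : inner ℝ (nor θ) (dir φ) = -Real.sin (θ - φ) := by
  rw [inner_eq, Real.sin_sub]; simp; ring

lemma dir_add_pi (θ : ℝ) : dir (θ + Real.pi) = -dir θ := by
  apply plane_ext <;> simp
lemma nor_add_pi (θ : ℝ) : nor (θ + Real.pi) = -nor θ := by
  apply plane_ext <;> simp
lemma dir_add (θ δ : ℝ) : dir (θ + δ) = Real.cos δ • dir θ + Real.sin δ • nor θ := by
  apply plane_ext <;> simp [Real.cos_add, Real.sin_add] <;> ring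
lemma nor_add (θ δ : ℝ) : nor (θ + δ) = Real.cos δ • nor θ - Real.sin δ • dir θ := by
  apply plane_ext <;> simp [Real.cos_add, Real.sin_add] <;> ring
lemma nor_eq_dir (θ : ℝ) : nor θ = dir (θ + Real.pi / 2) := by
  apply plane_ext <;> simp [Real.cos_add_pi_div_two, Real.sin_add_pi_div_two]

lemma norm_dir (θ : ℝ) : ‖dir θ‖ = 1 := by
  have := real_inner_self_eq_norm_sq (dir θ)
  rw [inner_dir_dir] at this
  simp at this
  nlinarith [norm_nonneg (dir θ)]
lemma norm_nor (θ : ℝ) : ‖nor θ‖ = 1 := by rw [nor_eq_dir, norm_dir]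

@[simp] lemma inner_pt_nor (θ t s : ℝ) : inner ℝ (pt θ t s) (nor θ) = t := by
  simp [pt, inner_add_left, inner_smul_left, norm_nor, inner_dir_nor]
@[simp] lemma inner_pt_dir (θ t s : ℝ) : inner ℝ (pt θ t s) (dir θ) = s := by
  simp [pt, inner_add_left, inner_smul_left, inner_nor_dir, norm_dir]

lemma pt_inner (θ : ℝ) (x : Plane) : pt θ (inner ℝ x (nor θ)) (inner ℝ x (dir θ)) = x := by
  have h := Real.sin_sq_add_cos_sq θ
  apply plane_ext <;> simp [pt, inner_eq]
  · linear_combination (x 0) * h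
  · linear_combination (x 1) * h

lemma eq_of_inner_eq (θ : ℝ) {x y : Plane} (h1 : inner ℝ x (nor θ) = inner ℝ y (nor θ))
    (h2 : inner ℝ x (dir θ) = inner ℝ y (dir θ)) : x = y := by
  rw [← pt_inner θ x, ← pt_inner θ y, h1, h2]

lemma pt_add_pi (θ t s : ℝ) : pt (θ + Real.pi) t s = pt θ (-t) (-s) := by
  simp [pt, dir_add_pi, nor_add_pi]

lemma inner_nor_add (x : Plane) (θ δ : ℝ) : inner ℝ x (nor (θ + δ)) =
    Real.cos δ * inner ℝ x (nor θ) - Real.sin δ * inner ℝ x (dir θ) := by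
  rw [nor_add, inner_sub_right, inner_smul_right, inner_smul_right]

lemma exists_eq_smul_dir (x : Plane) : ∃ θ, x = ‖x‖ • dir θ := by
  have hsq : x 0 ^ 2 + x 1 ^ 2 = ‖x‖ ^ 2 := by
    rw [← real_inner_self_eq_norm_sq, inner_eq]; ring
  refine ⟨Complex.arg ⟨x 0, x 1⟩, ?_⟩
  have hn : ‖(⟨x 0, x 1⟩ : ℂ)‖ = ‖x‖ := by
    rw [← sq_eq_sq₀ (norm_nonneg _) (norm_nonneg _), ← hsq, Complex.sq_norm, Complex.normSq_apply]
    ring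
  apply plane_ext
  · have := Complex.norm_mul_cos_arg ⟨x 0, x 1⟩
    rw [hn] at this; simpa using this.symm
  · have := Complex.norm_mul_sin_arg ⟨x 0, x 1⟩
    rw [hn] at this; simpa using this.symm

lemma exists_eq_smul_nor (x : Plane) : ∃ θ, x = ‖x‖ • nor θ := by
  obtain ⟨θ, h⟩ := exists_eq_smul_dir x
  exact ⟨θ - Real.pi / 2, by rw [nor_eq_dir]; simpa using h⟩

lemma continuous_dir : Continuous dir := by
  have : dir = fun θ => !₂[Real.cos θ, Real.sin θ] := rfl
  rw [this]; fun_prop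
lemma continuous_nor : Continuous nor := by
  have : nor = fun θ => !₂[-Real.sin θ, Real.cos θ] := rfl
  rw [this]; fun_prop

lemma continuous_pt : Continuous fun q : ℝ × ℝ × ℝ => pt q.1 q.2.1 q.2.2 := by
  have := continuous_dir
  have := continuous_nor
  unfold pt; fun_prop

lemma hasDerivAt_nor (θ : ℝ) : HasDerivAt nor (-dir θ) θ := by
  have h1 : nor = fun φ => Real.cos φ • nor 0 - Real.sin φ • dir 0 := by
    funext φ; simpa using nor_add 0 φ
  have h2 : dir θ = Real.cos θ • dir 0 + Real.sin θ • nor 0 := by simpa using dir_add 0 θ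
  rw [h1, h2]
  refine (((Real.hasDerivAt_cos θ).smul_const (nor 0)).sub
    ((Real.hasDerivAt_sin θ).smul_const (dir 0))).congr_deriv ?_
  rw [neg_smul]; abel

/-- The orthonormal basis `(u(θ), u'(θ))`. -/
def frame (θ : ℝ) : OrthonormalBasis (Fin 2) ℝ Plane :=
  OrthonormalBasis.mk (v := ![dir θ, nor θ])
    (by
      rw [orthonormal_iff_ite]
      intro i j
      fin_cases i <;> fin_cases j <;>
        simp [norm_dir, norm_nor, inner_dir_nor, inner_nor_dir])
    (by
      intro x _
      rw [← pt_inner θ x]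
      refine Submodule.add_mem _ (Submodule.smul_mem _ _ (Submodule.subset_span ⟨1, rfl⟩))
        (Submodule.smul_mem _ _ (Submodule.subset_span ⟨0, rfl⟩)))

/-- An orthonormal change of frame is an isometry. The pair lists the abscissa first and the height
second, the opposite of the argument order of `pt`. -/
lemma measurePreserving_pt (θ : ℝ) :
    MeasurePreserving (fun q : ℝ × ℝ => pt θ q.2 q.1) volume volume := by
  have h1 := (frame θ).measurePreserving_repr_symm
  have h2 := PiLp.volume_preserving_toLp (Fin 2)
  have h3 := (volume_preserving_finTwoArrow ℝ).symm
  have := h1.comp (h2.comp h3)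
  convert this using 1
  funext q
  simp only [Function.comp]
  rw [← OrthonormalBasis.sum_repr_symm]
  simp [Fin.sum_univ_two, frame, pt, add_comm, MeasurableEquiv.finTwoArrow]

/-! ### Areas cut off by lines, and the `α`-sections -/

/-- A planar convex body. -/
structure IsBody (K : Set Plane) : Prop where
  convex : Convex ℝ K
  compact : IsCompact K
  nonempty_interior : (interior K).Nonempty

/-- The area of the part of `K` on the right of the line `(θ, t)`. -/
def area (K : Set Plane) (θ t : ℝ) : ℝ := volume.real (K ∩ rightHalfPlane θ t)

lemma isClosed_rightHalfPlane (θ t : ℝ) : IsClosed (rightHalfPlane θ t) :=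
  isClosed_le (by fun_prop) continuous_const

lemma volume_line (θ t : ℝ) : volume {x : Plane | inner ℝ x (nor θ) = t} = 0 := by
  have hm : MeasurableSet {x : Plane | inner ℝ x (nor θ) = t} :=
    (isClosed_eq (by fun_prop) continuous_const).measurableSet
  rw [← (measurePreserving_pt θ).measure_preimage hm.nullMeasurableSet]
  have : (fun q : ℝ × ℝ => pt θ q.2 q.1) ⁻¹' {x : Plane | inner ℝ x (nor θ) = t}
      = univ ×ˢ {t} := by
    ext q; simp
  rw [this, Measure.volume_eq_prod, Measure.prod_prod]; simp

lemma IsBody.volume_ne_top (hK : IsBody K) : volume K ≠ ⊤ := hK.compact.measure_lt_top.ne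

lemma IsBody.volume_pos (hK : IsBody K) : 0 < volume.real K := by
  rw [measureReal_def]
  refine ENNReal.toReal_pos ?_ hK.volume_ne_top
  exact (Measure.measure_pos_of_nonempty_interior _ hK.nonempty_interior).ne'

/-- Off the limiting line, which is a null set, membership of a fixed point in the half-plane is
locally constant in the parameters; since `K` has finite area, the measures converge. -/
lemma IsBody.continuous_area (hK : IsBody K) :
    Continuous fun q : ℝ × ℝ => area K q.1 q.2 := by
  rw [continuous_iff_continuousAt]
  rintro ⟨θ, t⟩
  have h1 : Tendsto (fun q : ℝ × ℝ => volume (K ∩ rightHalfPlane q.1 q.2)) (𝓝 (θ, t))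
      (𝓝 (volume (K ∩ rightHalfPlane θ t))) := by
    refine tendsto_measure_of_ae_tendsto_indicator (B := K) _
      (hK.compact.measurableSet.inter (isClosed_rightHalfPlane _ _).measurableSet)
      (fun q => hK.compact.measurableSet.inter (isClosed_rightHalfPlane _ _).measurableSet)
      hK.compact.measurableSet hK.volume_ne_top (Eventually.of_forall fun q => inter_subset_left) ?_
    have h0 : ∀ᵐ x : Plane, inner ℝ x (nor θ) ≠ t := by
      rw [ae_iff]; simpa using volume_line θ t
    filter_upwards [h0] with x hx
    have hc : Continuous fun q : ℝ × ℝ => (inner ℝ x (nor q.1) : ℝ) - q.2 := by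
      have := continuous_nor
      fun_prop
    rcases lt_or_gt_of_ne hx with h | h
    · have : ∀ᶠ q : ℝ × ℝ in 𝓝 (θ, t), (inner ℝ x (nor q.1) : ℝ) - q.2 < 0 :=
        hc.continuousAt.eventually_lt continuousAt_const (by simpa using h)
      filter_upwards [this] with q hq
      have h1 : x ∈ rightHalfPlane q.1 q.2 := (sub_neg.1 hq).le
      have h2 : x ∈ rightHalfPlane θ t := h.le
      simp [h1, h2]
    · have : ∀ᶠ q : ℝ × ℝ in 𝓝 (θ, t), 0 < (inner ℝ x (nor q.1) : ℝ) - q.2 :=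
        continuousAt_const.eventually_lt hc.continuousAt (by simpa using h)
      filter_upwards [this] with q hq
      have h1 : x ∉ rightHalfPlane q.1 q.2 := not_le.2 (sub_pos.1 hq)
      have h2 : x ∉ rightHalfPlane θ t := not_le.2 h
      simp [h1, h2]
  exact (ENNReal.tendsto_toReal (measure_ne_top_of_subset inter_subset_left hK.volume_ne_top)).comp h1

lemma IsBody.area_mono (hK : IsBody K) (θ : ℝ) : Monotone (area K θ) := fun _ _ h =>
  measureReal_mono (inter_subset_inter_right _ fun _ hx => le_trans hx h)
    (measure_ne_top_of_subset inter_subset_left hK.volume_ne_top)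

lemma volume_real_diff_line (S : Set Plane) (θ t : ℝ) :
    volume (S \ {x | inner ℝ x (nor θ) = t}) = volume S :=
  measure_sdiff_null (volume_line θ t)

/-- The two sides of a line share the area of `K`. -/
lemma IsBody.area_add_pi (hK : IsBody K) (θ t : ℝ) :
    area K (θ + Real.pi) (-t) = volume.real K - area K θ t := by
  have h1 : area K (θ + Real.pi) (-t) = volume.real (K \ rightHalfPlane θ t) := by
    unfold area
    rw [measureReal_def, measureReal_def, ← volume_real_diff_line _ θ t]
    congr 2
    ext x
    simp only [rightHalfPlane, nor_add_pi, inner_neg_right, Set.mem_sdiff, mem_inter_iff,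
      mem_ofPred_eq, neg_le_neg_iff, not_le, and_assoc]
    refine and_congr_right fun _ => ?_
    rw [lt_iff_le_and_ne, ne_comm]
  rw [h1, area, eq_sub_iff_add_eq, add_comm]
  exact measureReal_inter_add_sdiff (isClosed_rightHalfPlane _ _).measurableSet
    (h := hK.volume_ne_top)

/-- The frontier of a convex set and a line are both null, so they cannot carry a positive area. -/
lemma IsBody.exists_interior_lt (hK : IsBody K) {θ t : ℝ} (h : 0 < area K θ t) :
    ∃ x ∈ interior K, inner ℝ x (nor θ) < t := by
  by_contra! hcon
  have hsub : K ∩ rightHalfPlane θ t ⊆ frontier K ∪ {x | inner ℝ x (nor θ) = t} := by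
    rintro x ⟨hx, hxt⟩
    by_cases hi : x ∈ interior K
    · exact Or.inr (le_antisymm hxt (hcon x hi))
    · exact Or.inl ⟨subset_closure hx, hi⟩
  have : volume (K ∩ rightHalfPlane θ t) = 0 :=
    measure_mono_null hsub (measure_union_null (hK.convex.addHaar_frontier _) (volume_line θ t))
  rw [area, measureReal_def, this] at h
  simp at h

lemma IsBody.exists_interior_gt (hK : IsBody K) {θ t : ℝ} (h : area K θ t < volume.real K) :
    ∃ x ∈ interior K, t < inner ℝ x (nor θ) := by
  obtain ⟨x, hx, hxt⟩ := hK.exists_interior_lt (θ := θ + Real.pi) (t := -t)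
    (by rw [hK.area_add_pi]; linarith)
  exact ⟨x, hx, by simpa [nor_add_pi] using hxt⟩

/-- The heights of the lines of direction `u(θ)` that meet the interior of `K`. -/
def heights (K : Set Plane) (θ : ℝ) : Set ℝ := {t | ∃ s, pt θ t s ∈ interior K}

lemma mem_heights {θ : ℝ} {x : Plane} (hx : x ∈ interior K) :
    inner ℝ x (nor θ) ∈ heights K θ := ⟨inner ℝ x (dir θ), by rwa [pt_inner]⟩

lemma pt_lineMap (θ t₁ s₁ t₂ s₂ a b : ℝ) :
    a • pt θ t₁ s₁ + b • pt θ t₂ s₂ = pt θ (a * t₁ + b * t₂) (a * s₁ + b * s₂) := by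
  simp only [pt, smul_add, smul_smul, add_smul]; abel

lemma IsBody.convex_heights (hK : IsBody K) (θ : ℝ) : Convex ℝ (heights K θ) := by
  rintro t₁ ⟨s₁, h₁⟩ t₂ ⟨s₂, h₂⟩ a b ha hb hab
  exact ⟨a * s₁ + b * s₂, by
    have := hK.convex.interior h₁ h₂ ha hb hab
    rwa [pt_lineMap] at this⟩

lemma isOpen_heights (θ : ℝ) : IsOpen (heights K θ) := by
  have : heights K θ = ⋃ s, (fun t => pt θ t s) ⁻¹' interior K := by
    ext t; simp [heights]
  rw [this]
  refine isOpen_iUnion fun s => isOpen_interior.preimage ?_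
  exact continuous_pt.comp (g := fun q : ℝ × ℝ × ℝ => pt q.1 q.2.1 q.2.2)
    (f := fun t => (θ, t, s)) (by fun_prop)

lemma IsBody.mem_heights_of_area (hK : IsBody K) {θ t : ℝ} (h0 : 0 < area K θ t)
    (h1 : area K θ t < volume.real K) : t ∈ heights K θ := by
  obtain ⟨x, hx, hxt⟩ := hK.exists_interior_lt h0
  obtain ⟨y, hy, hyt⟩ := hK.exists_interior_gt h1
  exact (hK.convex_heights θ).ordConnected.out (mem_heights hx) (mem_heights hy) ⟨hxt.le, hyt.le⟩

lemma IsBody.area_lt_area (hK : IsBody K) {θ t₁ t₂ : ℝ} (h : t₁ < t₂) (h0 : 0 < area K θ t₂)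
    (h1 : area K θ t₁ < volume.real K) : area K θ t₁ < area K θ t₂ := by
  obtain ⟨x, hx, hxt⟩ := hK.exists_interior_lt h0
  obtain ⟨y, hy, hyt⟩ := hK.exists_interior_gt h1
  -- Some line strictly between the two meets the interior; a nonempty open piece of the strip then
  -- lies in `K` and accounts for the strict increase.
  obtain ⟨t, ht1, ht2, ht⟩ : ∃ t, t₁ < t ∧ t < t₂ ∧ t ∈ heights K θ := by
    by_cases hx1 : t₁ < inner ℝ x (nor θ)
    · exact ⟨_, hx1, hxt, mem_heights hx⟩
    by_cases hy1 : inner ℝ y (nor θ) < t₂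
    · exact ⟨_, hyt, hy1, mem_heights hy⟩
    refine ⟨(t₁ + t₂) / 2, by linarith, by linarith, (hK.convex_heights θ).ordConnected.out
      (mem_heights hx) (mem_heights hy) ⟨by linarith, by linarith⟩⟩
  obtain ⟨s, hs⟩ := ht
  set U : Set Plane := interior K ∩ {z | t₁ < inner ℝ z (nor θ) ∧ inner ℝ z (nor θ) < t₂} with hU
  have hUo : IsOpen U := isOpen_interior.inter (by
    have hc : Continuous fun z : Plane => (inner ℝ z (nor θ) : ℝ) := by fun_prop
    exact (isOpen_lt continuous_const hc).inter (isOpen_lt hc continuous_const))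
  have hfin : ∀ S ⊆ K, volume S ≠ ⊤ := fun S hS => measure_ne_top_of_subset hS hK.volume_ne_top
  have hUK : U ⊆ K := inter_subset_left.trans interior_subset
  have hpos : 0 < volume.real U :=
    ENNReal.toReal_pos (hUo.measure_pos _ ⟨pt θ t s, hs, by simp [ht1, ht2]⟩).ne' (hfin U hUK)
  have hdis : Disjoint (K ∩ rightHalfPlane θ t₁) U := by
    rw [Set.disjoint_left]
    rintro z ⟨_, hz⟩ ⟨_, hz', _⟩
    exact absurd hz (not_le.2 hz')
  have := measureReal_union (μ := volume) hdis hUo.measurableSet (hfin _ inter_subset_left)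
    (hfin U hUK)
  have hle : volume.real (K ∩ rightHalfPlane θ t₁ ∪ U) ≤ area K θ t₂ := by
    refine measureReal_mono ?_ (hfin _ inter_subset_left)
    rintro z (⟨hz, hz'⟩ | ⟨hz, _, hz'⟩)
    · exact ⟨hz, le_trans hz' h.le⟩
    · exact ⟨interior_subset hz, hz'.le⟩
  unfold area at *
  linarith

lemma IsBody.exists_bound (hK : IsBody K) : ∃ M > 0, ∀ x ∈ K, ‖x‖ < M := by
  obtain ⟨M, hM, h⟩ := hK.compact.isBounded.exists_pos_norm_lt
  exact ⟨M, hM, h⟩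

lemma abs_inner_nor_le (x : Plane) (θ : ℝ) : |(inner ℝ x (nor θ) : ℝ)| ≤ ‖x‖ := by
  simpa [norm_nor] using abs_real_inner_le_norm x (nor θ)
lemma abs_inner_dir_le (x : Plane) (θ : ℝ) : |(inner ℝ x (dir θ) : ℝ)| ≤ ‖x‖ := by
  simpa [norm_dir] using abs_real_inner_le_norm x (dir θ)

lemma IsBody.exists_isAlphaSection (hK : IsBody K) {α : ℝ} (h0 : 0 < α) (h1 : α < 1) (θ : ℝ) :
    ∃ t, IsAlphaSection K α θ t := by
  obtain ⟨M, hM, hb⟩ := hK.exists_bound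
  have hlow : area K θ (-M) = 0 := by
    have : K ∩ rightHalfPlane θ (-M) = ∅ := by
      ext x
      simp only [mem_inter_iff, mem_empty_iff_false, iff_false, not_and]
      intro hx hx'
      have := abs_le.1 (abs_inner_nor_le x θ)
      have h3 := hb x hx
      have : (inner ℝ x (nor θ) : ℝ) ≤ -M := hx'
      linarith
    rw [area, this]; simp
  have hhigh : area K θ M = volume.real K := by
    rw [area, inter_eq_left.2]
    intro x hx
    exact (le_abs_self _).trans ((abs_inner_nor_le x θ).trans (hb x hx).le)
  have hc : Continuous (area K θ) :=
    hK.continuous_area.comp (g := fun q : ℝ × ℝ => area K q.1 q.2) (f := fun t => (θ, t))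
      (by fun_prop)
  have hv := hK.volume_pos
  obtain ⟨t, _, ht⟩ := intermediate_value_Icc (by linarith : -M ≤ M) hc.continuousOn
    (show α * volume.real K ∈ Icc (area K θ (-M)) (area K θ M) by
      rw [hlow, hhigh]; constructor <;> nlinarith)
  exact ⟨t, ht⟩

lemma IsBody.area_offset (hK : IsBody K) {α : ℝ} (h0 : 0 < α) (h1 : α < 1) (θ : ℝ) :
    area K θ (offset K α θ) = α * volume.real K :=
  Classical.epsilon_spec (hK.exists_isAlphaSection h0 h1 θ)

lemma IsBody.area_offset_pos (hK : IsBody K) {α : ℝ} (h0 : 0 < α) (h1 : α < 1) (θ : ℝ) :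
    0 < area K θ (offset K α θ) := by
  rw [hK.area_offset h0 h1]; exact mul_pos h0 hK.volume_pos

lemma IsBody.area_offset_lt (hK : IsBody K) {α : ℝ} (h0 : 0 < α) (h1 : α < 1) (θ : ℝ) :
    area K θ (offset K α θ) < volume.real K := by
  rw [hK.area_offset h0 h1]; nlinarith [hK.volume_pos]

lemma IsBody.offset_mem_heights (hK : IsBody K) {α : ℝ} (h0 : 0 < α) (h1 : α < 1) (θ : ℝ) :
    offset K α θ ∈ heights K θ :=
  hK.mem_heights_of_area (hK.area_offset_pos h0 h1 θ) (hK.area_offset_lt h0 h1 θ)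

lemma IsBody.offset_le_iff (hK : IsBody K) {α : ℝ} (h0 : 0 < α) (h1 : α < 1) {θ t : ℝ} :
    offset K α θ ≤ t ↔ α * volume.real K ≤ area K θ t := by
  rw [← hK.area_offset h0 h1 θ]
  refine ⟨fun h => hK.area_mono θ h, fun h => ?_⟩
  by_contra! hlt
  exact (hK.area_lt_area hlt (hK.area_offset_pos h0 h1 θ)
    (lt_of_le_of_lt (hK.area_mono θ hlt.le) (hK.area_offset_lt h0 h1 θ))).not_ge h

lemma IsBody.le_offset_iff (hK : IsBody K) {α : ℝ} (h0 : 0 < α) (h1 : α < 1) {θ t : ℝ} :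
    t ≤ offset K α θ ↔ area K θ t ≤ α * volume.real K := by
  rw [← hK.area_offset h0 h1 θ]
  refine ⟨fun h => hK.area_mono θ h, fun h => ?_⟩
  by_contra! hlt
  exact (hK.area_lt_area hlt (lt_of_lt_of_le (hK.area_offset_pos h0 h1 θ) (hK.area_mono θ hlt.le))
    (hK.area_offset_lt h0 h1 θ)).not_ge h

lemma IsBody.offset_eq_iff (hK : IsBody K) {α : ℝ} (h0 : 0 < α) (h1 : α < 1) {θ t : ℝ} :
    offset K α θ = t ↔ area K θ t = α * volume.real K := by
  rw [le_antisymm_iff, le_antisymm_iff, hK.offset_le_iff h0 h1, hK.le_offset_iff h0 h1, and_comm]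

lemma IsBody.offset_lt_offset (hK : IsBody K) {α β : ℝ} (h0 : 0 < α) (h1 : β < 1) (h : α < β)
    (θ : ℝ) : offset K α θ < offset K β θ := by
  rw [← not_le, hK.offset_le_iff (h0.trans h) h1, hK.area_offset h0 (h.trans h1), not_le]
  exact mul_lt_mul_of_pos_right h hK.volume_pos

/-- It is the same line with its two sides exchanged. Through this symmetry, facts about initial
endpoints transfer to final endpoints. -/
lemma IsBody.offset_add_pi (hK : IsBody K) {α : ℝ} (h0 : 0 < α) (h1 : α < 1) (θ : ℝ) :
    offset K (1 - α) (θ + Real.pi) = -offset K α θ := by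
  rw [hK.offset_eq_iff (by linarith) (by linarith), hK.area_add_pi, hK.area_offset h0 h1]
  ring

/-- Strict comparison of the offset with a fixed `t` is a strict inequality between continuous
areas, hence an open condition on the pair `(α, θ)`. -/
lemma IsBody.continuousAt_offset (hK : IsBody K) {α : ℝ} (h0 : 0 < α) (h1 : α < 1) (θ : ℝ) :
    ContinuousAt (fun q : ℝ × ℝ => offset K q.1 q.2) (α, θ) := by
  have hv := hK.volume_pos
  have hI : ∀ᶠ q : ℝ × ℝ in 𝓝 (α, θ), 0 < q.1 ∧ q.1 < 1 :=
    (continuousAt_fst.eventually (Ioo_mem_nhds h0 h1))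
  have hc : ∀ t, Continuous fun q : ℝ × ℝ => area K q.2 t := fun t =>
    hK.continuous_area.comp (g := fun q : ℝ × ℝ => area K q.1 q.2)
      (f := fun q : ℝ × ℝ => (q.2, t)) (by fun_prop)
  have hm : Continuous fun q : ℝ × ℝ => q.1 * volume.real K := by fun_prop
  rw [ContinuousAt, tendsto_order]
  constructor
  · intro t ht
    have h : area K θ t < α * volume.real K := by
      rwa [← not_le, ← hK.offset_le_iff h0 h1, not_le]
    filter_upwards [hI, (hc t).continuousAt.eventually_lt hm.continuousAt h] with q hq hq'
    rwa [← not_le, hK.offset_le_iff hq.1 hq.2, not_le]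
  · intro t ht
    have h : α * volume.real K < area K θ t := by
      rwa [← not_le, ← hK.le_offset_iff h0 h1, not_le]
    filter_upwards [hI, hm.continuousAt.eventually_lt (hc t).continuousAt h] with q hq hq'
    rwa [← not_le, hK.le_offset_iff hq.1 hq.2, not_le]

lemma IsBody.continuous_offset (hK : IsBody K) {α : ℝ} (h0 : 0 < α) (h1 : α < 1) :
    Continuous (offset K α) :=
  continuous_iff_continuousAt.2 fun θ => (hK.continuousAt_offset h0 h1 θ).comp
    (f := fun θ => (α, θ)) (by fun_prop)

lemma IsBody.offset_periodic (hK : IsBody K) {α : ℝ} (h0 : 0 < α) (h1 : α < 1) (θ : ℝ) :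
    offset K α (θ + 2 * Real.pi) = offset K α θ := by
  have := hK.offset_add_pi (α := 1 - α) (by linarith) (by linarith) (θ + Real.pi)
  rw [hK.offset_add_pi h0 h1, sub_sub_cancel, neg_neg] at this
  rw [← this]; ring_nf

lemma IsBody.mem_core_iff (hK : IsBody K) {α : ℝ} (h0 : 0 < α) (h1 : α < 1) {x : Plane} :
    x ∈ core K α ↔ ∀ θ, offset K α θ ≤ inner ℝ x (nor θ) := by
  refine ⟨fun h θ => h θ _ (hK.area_offset h0 h1 θ), fun h θ t ht => ?_⟩
  rw [← (hK.offset_eq_iff h0 h1).2 ht]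
  exact h θ

lemma IsBody.mem_core_iff_area (hK : IsBody K) {α : ℝ} (h0 : 0 < α) (h1 : α < 1) {x : Plane} :
    x ∈ core K α ↔ ∀ θ, α * volume.real K ≤ area K θ (inner ℝ x (nor θ)) := by
  simp_rw [hK.mem_core_iff h0 h1, hK.offset_le_iff h0 h1]

/-! ### Chords and their endpoints -/

/-- The abscissa of the first point of `K` on the line `(θ, t)`. -/
def lam (K : Set Plane) (θ t : ℝ) : ℝ := sInf {s | pt θ t s ∈ K}

lemma IsBody.isCompact_slice (hK : IsBody K) (θ t : ℝ) : IsCompact {s | pt θ t s ∈ K} := by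
  obtain ⟨M, hM, hb⟩ := hK.exists_bound
  refine Metric.isCompact_of_isClosed_isBounded ?_ ?_
  · exact hK.compact.isClosed.preimage (continuous_pt.comp
      (g := fun q : ℝ × ℝ × ℝ => pt q.1 q.2.1 q.2.2) (f := fun s => (θ, t, s)) (by fun_prop))
  · refine (Metric.isBounded_Icc (-M) M).subset fun s hs => ?_
    have := abs_inner_dir_le (pt θ t s) θ
    rw [inner_pt_dir] at this
    exact abs_le.1 (this.trans (hb _ hs).le)

lemma slice_add_pi (θ t : ℝ) : {s | pt (θ + Real.pi) (-t) s ∈ K} = -{s | pt θ t s ∈ K} := by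
  ext s; simp [pt_add_pi]

lemma sSup_slice (θ t : ℝ) : sSup {s | pt θ t s ∈ K} = -lam K (θ + Real.pi) (-t) := by
  rw [lam, slice_add_pi, Real.sInf_neg, neg_neg]

lemma heights_add_pi {θ t : ℝ} : -t ∈ heights K (θ + Real.pi) ↔ t ∈ heights K θ := by
  constructor
  · rintro ⟨s, hs⟩; exact ⟨-s, by simpa [pt_add_pi] using hs⟩
  · rintro ⟨s, hs⟩; exact ⟨-s, by simpa [pt_add_pi] using hs⟩

lemma IsBody.lam_mem (hK : IsBody K) {θ t s : ℝ} (h : pt θ t s ∈ K) :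
    pt θ t (lam K θ t) ∈ K :=
  (hK.isCompact_slice θ t).sInf_mem ⟨s, h⟩

lemma IsBody.lam_le (hK : IsBody K) {θ t s : ℝ} (h : pt θ t s ∈ K) : lam K θ t ≤ s :=
  csInf_le (hK.isCompact_slice θ t).bddBelow h

lemma IsBody.le_neg_lam (hK : IsBody K) {θ t s : ℝ} (h : pt θ t s ∈ K) :
    s ≤ -lam K (θ + Real.pi) (-t) := by
  rw [← sSup_slice]
  exact le_csSup (hK.isCompact_slice θ t).bddAbove h

lemma IsBody.neg_lam_mem (hK : IsBody K) {θ t s : ℝ} (h : pt θ t s ∈ K) :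
    pt θ t (-lam K (θ + Real.pi) (-t)) ∈ K := by
  rw [← sSup_slice]
  exact (hK.isCompact_slice θ t).sSup_mem ⟨s, h⟩

lemma continuous_pt_right (θ t : ℝ) : Continuous (pt θ t) := by
  unfold pt; fun_prop

lemma IsBody.lam_lt (hK : IsBody K) {θ t s : ℝ} (h : pt θ t s ∈ interior K) : lam K θ t < s := by
  have h1 : ∀ᶠ x in 𝓝 s, pt θ t x ∈ interior K :=
    (continuous_pt_right θ t).continuousAt.eventually (isOpen_interior.mem_nhds h)
  obtain ⟨x, hx, hxs⟩ := ((h1.filter_mono nhdsWithin_le_nhds).and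
    (self_mem_nhdsWithin : Iio s ∈ 𝓝[<] s)).exists
  exact (hK.lam_le (interior_subset hx)).trans_lt hxs

lemma IsBody.lt_neg_lam (hK : IsBody K) {θ t s : ℝ} (h : pt θ t s ∈ interior K) :
    s < -lam K (θ + Real.pi) (-t) := by
  have := hK.lam_lt (θ := θ + Real.pi) (t := -t) (s := -s) (by simpa [pt_add_pi] using h)
  linarith

lemma IsBody.lam_add_lt (hK : IsBody K) {θ t : ℝ} (h : t ∈ heights K θ) :
    lam K θ t < -lam K (θ + Real.pi) (-t) := by
  obtain ⟨s, hs⟩ := h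
  exact (hK.lam_lt hs).trans (hK.lt_neg_lam hs)

lemma IsBody.pt_mem_interior_of_lt_of_interior (hK : IsBody K) {θ t s a b : ℝ}
    (ha : pt θ t a ∈ K) (hb : pt θ t b ∈ interior K) (h1 : a < s) (h2 : s ≤ b) :
    pt θ t s ∈ interior K := by
  have hc : 0 < b - a := by linarith
  have := hK.convex.combo_self_interior_mem_interior ha hb
    (a := (b - s) / (b - a)) (b := (s - a) / (b - a))
    (div_nonneg (by linarith) hc.le) (div_pos (by linarith) hc) (by field_simp; ring)
  rw [pt_lineMap] at this
  convert this using 2 <;> field_simp <;> ring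

lemma IsBody.pt_mem_interior (hK : IsBody K) {θ t s : ℝ} (h : t ∈ heights K θ)
    (h1 : lam K θ t < s) (h2 : s < -lam K (θ + Real.pi) (-t)) : pt θ t s ∈ interior K := by
  obtain ⟨b, hb⟩ := h
  have hbK := interior_subset hb
  rcases le_or_gt s b with h | h
  · exact hK.pt_mem_interior_of_lt_of_interior (hK.lam_mem hbK) hb h1 h
  · have := hK.pt_mem_interior_of_lt_of_interior (θ := θ + Real.pi) (t := -t) (s := -s) (b := -b)
      (hK.lam_mem (s := -b) (by simpa [pt_add_pi] using hbK)) (by simpa [pt_add_pi] using hb)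
      (by linarith) (by linarith)
    simpa [pt_add_pi] using this

lemma IsBody.pt_mem (hK : IsBody K) {θ t s : ℝ} (h : t ∈ heights K θ)
    (h1 : lam K θ t ≤ s) (h2 : s ≤ -lam K (θ + Real.pi) (-t)) : pt θ t s ∈ K := by
  obtain ⟨b, hb⟩ := id h
  rcases h1.eq_or_lt with rfl | h1
  · exact hK.lam_mem (interior_subset hb)
  rcases h2.eq_or_lt with rfl | h2
  · exact hK.neg_lam_mem (interior_subset hb)
  exact interior_subset (hK.pt_mem_interior h h1 h2)

lemma IsBody.lam_not_mem_interior (hK : IsBody K) (θ t : ℝ) :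
    pt θ t (lam K θ t) ∉ interior K := fun h => (hK.lam_lt h).false

lemma IsBody.convexOn_lam (hK : IsBody K) (θ : ℝ) : ConvexOn ℝ (heights K θ) (lam K θ) := by
  refine ⟨hK.convex_heights θ, ?_⟩
  intro t₁ h₁ t₂ h₂ a b ha hb hab
  obtain ⟨s₁, h₁⟩ := h₁
  obtain ⟨s₂, h₂⟩ := h₂
  have := hK.convex (hK.lam_mem (interior_subset h₁)) (hK.lam_mem (interior_subset h₂)) ha hb hab
  rw [pt_lineMap] at this
  exact hK.lam_le this

lemma IsBody.continuousAt_lam (hK : IsBody K) {θ t : ℝ} (h : t ∈ heights K θ) :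
    ContinuousAt (fun q : ℝ × ℝ => lam K q.1 q.2) (θ, t) := by
  have hc : ∀ s, Continuous fun q : ℝ × ℝ => pt q.1 q.2 s := fun s =>
    continuous_pt.comp (g := fun q : ℝ × ℝ × ℝ => pt q.1 q.2.1 q.2.2)
      (f := fun q : ℝ × ℝ => (q.1, q.2, s)) (by fun_prop)
  rw [ContinuousAt, tendsto_order]
  constructor
  · intro u hu
    obtain ⟨b, hb⟩ := id h
    have h1 : ∀ᶠ q : ℝ × ℝ in 𝓝 (θ, t), pt q.1 q.2 b ∈ interior K :=
      (hc b).continuousAt.eventually (isOpen_interior.mem_nhds hb)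
    have h2 : ∀ᶠ q : ℝ × ℝ in 𝓝 (θ, t), pt q.1 q.2 u ∈ Kᶜ :=
      (hc u).continuousAt.eventually (hK.compact.isClosed.isOpen_compl.mem_nhds
        fun hmem => (hK.lam_le hmem).not_gt hu)
    filter_upwards [h1, h2] with q hq1 hq2
    by_contra! hle
    have hub : u < b := hu.trans (hK.lam_lt hb)
    exact hq2 (hK.pt_mem ⟨b, hq1⟩ hle (hub.le.trans (hK.le_neg_lam (interior_subset hq1))))
  · intro u hu
    obtain ⟨s, hs1, hs2⟩ := exists_between (lt_min hu (hK.lam_add_lt h))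
    have hs := hK.pt_mem_interior h hs1 (hs2.trans_le (min_le_right _ _))
    have h1 : ∀ᶠ q : ℝ × ℝ in 𝓝 (θ, t), pt q.1 q.2 s ∈ interior K :=
      (hc s).continuousAt.eventually (isOpen_interior.mem_nhds hs)
    filter_upwards [h1] with q hq
    exact (hK.lam_lt hq).trans (hs2.trans_le (min_le_left _ _))

lemma chordStart_eq (α θ : ℝ) :
    chordStart K α θ = pt θ (offset K α θ) (lam K θ (offset K α θ)) := rfl

lemma chordEnd_eq (α θ : ℝ) :
    chordEnd K α θ = pt θ (offset K α θ) (-lam K (θ + Real.pi) (-offset K α θ)) := by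
  rw [← sSup_slice]; rfl

lemma IsBody.chordEnd_eq_chordStart (hK : IsBody K) {α : ℝ} (h0 : 0 < α) (h1 : α < 1) (θ : ℝ) :
    chordEnd K α θ = chordStart K (1 - α) (θ + Real.pi) := by
  rw [chordEnd_eq, chordStart_eq, hK.offset_add_pi h0 h1, pt_add_pi, neg_neg]

lemma mid_eq (α θ : ℝ) : mid K α θ = pt θ (offset K α θ)
    ((lam K θ (offset K α θ) - lam K (θ + Real.pi) (-offset K α θ)) / 2) := by
  rw [mid, midpoint_eq_smul_add, chordEnd_eq, chordStart_eq, smul_add, pt_lineMap]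
  congr 1 <;> simp <;> ring

/-- The chord is the same, with its endpoints exchanged. -/
lemma IsBody.mid_add_pi (hK : IsBody K) {α : ℝ} (h0 : 0 < α) (h1 : α < 1) (θ : ℝ) :
    mid K (1 - α) (θ + Real.pi) = mid K α θ := by
  have h2 := hK.chordEnd_eq_chordStart (α := 1 - α) (by linarith) (by linarith) (θ + Real.pi)
  have h3 := hK.chordEnd_eq_chordStart h0 h1 θ
  have h4 : chordStart K α (θ + Real.pi + Real.pi) = chordStart K α θ := by
    rw [chordStart_eq, chordStart_eq, add_assoc, ← two_mul, hK.offset_periodic h0 h1]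
    have : ∀ t s, pt (θ + 2 * Real.pi) t s = pt θ t s := fun t s => by
      rw [two_mul, ← add_assoc, pt_add_pi, pt_add_pi, neg_neg, neg_neg]
    simp only [lam, this]
  rw [sub_sub_cancel, h4] at h2
  rw [mid, mid, h2, ← h3, midpoint_comm]

@[simp] lemma inner_mid_nor (α θ : ℝ) : inner ℝ (mid K α θ) (nor θ) = offset K α θ := by
  rw [mid_eq, inner_pt_nor]

lemma IsBody.continuousAt_mid (hK : IsBody K) {α : ℝ} (h0 : 0 < α) (h1 : α < 1) (θ : ℝ) :
    ContinuousAt (fun q : ℝ × ℝ => mid K q.1 q.2) (α, θ) := by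
  have hp := hK.continuousAt_offset h0 h1 θ
  have hmem := hK.offset_mem_heights h0 h1 θ
  have hl : Tendsto (fun q : ℝ × ℝ => lam K q.2 (offset K q.1 q.2)) (𝓝 (α, θ)) (𝓝 _) :=
    Tendsto.comp (g := fun q : ℝ × ℝ => lam K q.1 q.2)
      (f := fun q : ℝ × ℝ => (q.2, offset K q.1 q.2)) (hK.continuousAt_lam hmem)
      (Tendsto.prodMk_nhds continuousAt_snd hp)
  have hr : Tendsto (fun q : ℝ × ℝ => lam K (q.2 + Real.pi) (-offset K q.1 q.2)) (𝓝 (α, θ))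
      (𝓝 _) :=
    Tendsto.comp (g := fun q : ℝ × ℝ => lam K q.1 q.2)
      (f := fun q : ℝ × ℝ => (q.2 + Real.pi, -offset K q.1 q.2))
      (hK.continuousAt_lam (heights_add_pi.2 hmem))
      (Tendsto.prodMk_nhds (continuousAt_snd.add continuousAt_const) hp.neg)
  simp only [mid_eq]
  exact Tendsto.comp (g := fun q : ℝ × ℝ × ℝ => pt q.1 q.2.1 q.2.2)
    (f := fun q : ℝ × ℝ => (q.2, offset K q.1 q.2, (lam K q.2 (offset K q.1 q.2) -
      lam K (q.2 + Real.pi) (-offset K q.1 q.2)) / 2))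
    (continuous_pt.tendsto (θ, offset K α θ, (lam K θ (offset K α θ) -
      lam K (θ + Real.pi) (-offset K α θ)) / 2)) (Tendsto.prodMk_nhds continuousAt_snd
      (Tendsto.prodMk_nhds hp ((hl.sub hr).div_const 2)))

lemma IsBody.continuous_mid (hK : IsBody K) {α : ℝ} (h0 : 0 < α) (h1 : α < 1) :
    Continuous (mid K α) :=
  continuous_iff_continuousAt.2 fun θ => (hK.continuousAt_mid h0 h1 θ).comp
    (f := fun θ => (α, θ)) (by fun_prop)

lemma IsBody.continuous_chordStart (hK : IsBody K) {α : ℝ} (h0 : 0 < α) (h1 : α < 1) :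
    Continuous (chordStart K α) := by
  refine continuous_iff_continuousAt.2 fun θ => ?_
  have hp := (hK.continuous_offset h0 h1).continuousAt (x := θ)
  have hmem := hK.offset_mem_heights h0 h1 θ
  have hl : ContinuousAt (fun θ => lam K θ (offset K α θ)) θ :=
    (hK.continuousAt_lam hmem).comp (f := fun θ => (θ, offset K α θ)) (continuousAt_id.prodMk hp)
  have : ContinuousAt (fun θ => (θ, offset K α θ, lam K θ (offset K α θ))) θ :=
    continuousAt_id.prodMk (hp.prodMk hl)
  exact continuous_pt.continuousAt.comp (g := fun q : ℝ × ℝ × ℝ => pt q.1 q.2.1 q.2.2) this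

lemma IsBody.mid_periodic (hK : IsBody K) {α : ℝ} (h0 : 0 < α) (h1 : α < 1) (θ : ℝ) :
    mid K α (θ + 2 * Real.pi) = mid K α θ := by
  have := hK.mid_add_pi (α := 1 - α) (by linarith) (by linarith) (θ + Real.pi)
  rw [hK.mid_add_pi h0 h1, sub_sub_cancel] at this
  rw [← this]; ring_nf

/-! ### Derivative of the length of a subset of the line below a level -/

section CumulativeLength

variable {S : Set ℝ}

lemma volume_inter_Iic_sub (hS : MeasurableSet S) (hf : volume S ≠ ⊤) {a b : ℝ} (h : a ≤ b) :
    volume.real (S ∩ Iic b) - volume.real (S ∩ Iic a) = volume.real (S ∩ Ioc a b) := by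
  have hu : S ∩ Iic b = S ∩ Iic a ∪ S ∩ Ioc a b := by
    rw [← inter_union_distrib_left, Iic_union_Ioc_eq_Iic h]
  have hd : Disjoint (S ∩ Iic a) (S ∩ Ioc a b) := by
    rw [Set.disjoint_left]; rintro x ⟨_, hx⟩ ⟨_, hx', _⟩; exact absurd hx (not_le.2 hx')
  rw [hu, measureReal_union hd (hS.inter measurableSet_Ioc)
    (measure_ne_top_of_subset inter_subset_left hf)
    (measure_ne_top_of_subset inter_subset_left hf)]
  ring

lemma abs_volume_inter_Iic_sub_le (hS : MeasurableSet S) (hf : volume S ≠ ⊤) (a b : ℝ) :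
    |volume.real (S ∩ Iic b) - volume.real (S ∩ Iic a)| ≤ |b - a| := by
  wlog h : a ≤ b generalizing a b
  · rw [abs_sub_comm, abs_sub_comm b]; exact this b a (le_of_not_ge h)
  rw [volume_inter_Iic_sub hS hf h, abs_of_nonneg measureReal_nonneg,
    abs_of_nonneg (by linarith : 0 ≤ b - a)]
  refine (measureReal_mono inter_subset_right (by simp)).trans ?_
  rw [Real.volume_real_Ioc_of_le h]

lemma hasDerivAt_volume_inter_Iic_of_mem (hS : MeasurableSet S) (hf : volume S ≠ ⊤) {z : ℝ}
    (hz : S ∈ 𝓝 z) : HasDerivAt (fun z => volume.real (S ∩ Iic z)) 1 z := by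
  have h1 : (fun z => volume.real (S ∩ Iic z)) =ᶠ[𝓝 z]
      fun y => volume.real (S ∩ Iic z) + (y - z) := by
    obtain ⟨ε, hε, hb⟩ := Metric.mem_nhds_iff.1 hz
    filter_upwards [Metric.ball_mem_nhds z hε] with y hy
    have hord := (convex_ball z ε).ordConnected
    rcases le_total z y with h | h
    · have := volume_inter_Iic_sub hS hf h
      rw [inter_eq_right.2 (Ioc_subset_Icc_self.trans
        ((hord.out (Metric.mem_ball_self hε) hy).trans hb)), Real.volume_real_Ioc_of_le h] at this
      linarith
    · have := volume_inter_Iic_sub hS hf h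
      rw [inter_eq_right.2 (Ioc_subset_Icc_self.trans
        ((hord.out hy (Metric.mem_ball_self hε)).trans hb)), Real.volume_real_Ioc_of_le h] at this
      linarith
  refine HasDerivAt.congr_of_eventuallyEq ?_ h1
  simpa using ((hasDerivAt_id z).sub_const z).const_add (volume.real (S ∩ Iic z))

lemma hasDerivAt_volume_inter_Iic_of_notMem (hS : MeasurableSet S) (hf : volume S ≠ ⊤) {z : ℝ}
    (hz : Sᶜ ∈ 𝓝 z) : HasDerivAt (fun z => volume.real (S ∩ Iic z)) 0 z := by
  have h1 : (fun z => volume.real (S ∩ Iic z)) =ᶠ[𝓝 z] fun _ => volume.real (S ∩ Iic z) := by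
    obtain ⟨ε, hε, hb⟩ := Metric.mem_nhds_iff.1 hz
    filter_upwards [Metric.ball_mem_nhds z hε] with y hy
    have hord := (convex_ball z ε).ordConnected
    have key : ∀ a b, Icc a b ⊆ Metric.ball z ε → S ∩ Ioc a b = ∅ := by
      intro a b hab
      ext x
      simp only [mem_inter_iff, mem_empty_iff_false, iff_false, not_and]
      exact fun hx hx' => hb (hab (Ioc_subset_Icc_self hx')) hx
    rcases le_total z y with h | h
    · have := volume_inter_Iic_sub hS hf h
      rw [key _ _ (hord.out (Metric.mem_ball_self hε) hy)] at this
      simp at this; linarith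
    · have := volume_inter_Iic_sub hS hf h
      rw [key _ _ (hord.out hy (Metric.mem_ball_self hε))] at this
      simp at this; linarith
  exact (hasDerivAt_const z _).congr_of_eventuallyEq h1

end CumulativeLength

/-! ### First variation of the area, and derivative of the offset -/

/-- In the frame of angle `θ`, the area of the part of `K` below the line `Y = τ + k X`. -/
def areaBelow (K : Set Plane) (θ : ℝ) (q : ℝ × ℝ) : ℝ :=
  volume.real {z : ℝ × ℝ | pt θ z.2 z.1 ∈ K ∧ z.2 ≤ q.2 + q.1 * z.1}

lemma continuous_pt_prod (θ : ℝ) : Continuous fun z : ℝ × ℝ => pt θ z.2 z.1 :=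
  continuous_pt.comp (g := fun q : ℝ × ℝ × ℝ => pt q.1 q.2.1 q.2.2)
    (f := fun z : ℝ × ℝ => (θ, z.2, z.1)) (by fun_prop)

lemma IsBody.volume_real_preimage (θ : ℝ) {S : Set Plane} (hS : MeasurableSet S) :
    volume.real ((fun z : ℝ × ℝ => pt θ z.2 z.1) ⁻¹' S) = volume.real S := by
  rw [measureReal_def, measureReal_def,
    (measurePreserving_pt θ).measure_preimage hS.nullMeasurableSet]

/-- In the fixed frame, the line of angle `θ + δ` is a graph of slope `tan δ` and intercept `t / cos
δ`, which turns a rotation into an affine perturbation. -/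
lemma IsBody.area_add (hK : IsBody K) (θ t : ℝ) {δ : ℝ} (hδ : 0 < Real.cos δ) :
    area K (θ + δ) t = areaBelow K θ (Real.tan δ, t / Real.cos δ) := by
  rw [area, ← IsBody.volume_real_preimage θ (hK.compact.measurableSet.inter
    (isClosed_rightHalfPlane _ _).measurableSet), areaBelow]
  congr 1
  ext z
  simp only [mem_preimage, mem_inter_iff, mem_ofPred_eq, rightHalfPlane, inner_nor_add,
    inner_pt_nor, inner_pt_dir]
  refine and_congr_right fun _ => ?_
  rw [Real.tan_eq_sin_div_cos, div_mul_eq_mul_div, ← add_div, le_div_iff₀ hδ]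
  constructor <;> intro h <;> linarith

lemma IsBody.isCompact_column (hK : IsBody K) (θ X : ℝ) : IsCompact {Y | pt θ Y X ∈ K} := by
  obtain ⟨M, hM, hb⟩ := hK.exists_bound
  refine Metric.isCompact_of_isClosed_isBounded ?_ ?_
  · exact hK.compact.isClosed.preimage (continuous_pt.comp
      (g := fun q : ℝ × ℝ × ℝ => pt q.1 q.2.1 q.2.2) (f := fun Y => (θ, Y, X)) (by fun_prop))
  · refine (Metric.isBounded_Icc (-M) M).subset fun Y hY => ?_
    have := abs_inner_nor_le (pt θ Y X) θ
    rw [inner_pt_nor] at this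
    exact abs_le.1 (this.trans (hb _ hY).le)

lemma measurableSet_below (hK : IsBody K) (θ : ℝ) (q : ℝ × ℝ) :
    MeasurableSet {z : ℝ × ℝ | pt θ z.2 z.1 ∈ K ∧ z.2 ≤ q.2 + q.1 * z.1} :=
  ((hK.compact.isClosed.preimage (continuous_pt_prod θ)).inter
    (isClosed_le continuous_snd (by fun_prop))).measurableSet

lemma IsBody.areaBelow_eq_integral (hK : IsBody K) (θ : ℝ) (q : ℝ × ℝ) :
    areaBelow K θ q = ∫ X, volume.real ({Y | pt θ Y X ∈ K} ∩ Iic (q.2 + q.1 * X)) := by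
  have hm := measurableSet_below hK θ q
  have h1 := Measure.prod_apply (μ := (volume : Measure ℝ)) (ν := (volume : Measure ℝ)) hm
  rw [areaBelow, measureReal_def, Measure.volume_eq_prod, h1]
  rw [← integral_toReal (measurable_measure_prodMk_left hm).aemeasurable]
  · rfl
  · refine Eventually.of_forall fun X => ?_
    exact (measure_mono (fun Y hY => hY.1)).trans_lt (hK.isCompact_column θ X).measure_lt_top

lemma IsBody.measurable_column (hK : IsBody K) (θ : ℝ) (q : ℝ × ℝ) :
    Measurable fun X => volume.real ({Y | pt θ Y X ∈ K} ∩ Iic (q.2 + q.1 * X)) :=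
  (measurable_measure_prodMk_left (ν := (volume : Measure ℝ))
    (measurableSet_below hK θ q)).ennreal_toReal

/-- Differentiation under the integral over vertical columns: the length of a column below the line
varies at rate 1 where the line is inside `K` and at rate 0 where it is outside, and it is uniformly
Lipschitz. -/
lemma IsBody.hasFDerivAt_areaBelow (hK : IsBody K) {θ t : ℝ} (ht : t ∈ heights K θ) :
    HasFDerivAt (areaBelow K θ)
      (∫ X in Ioo (lam K θ t) (-lam K (θ + Real.pi) (-t)),
        (X • ContinuousLinearMap.fst ℝ ℝ ℝ + ContinuousLinearMap.snd ℝ ℝ ℝ)) (0, t) := by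
  obtain ⟨M, hM, hb⟩ := hK.exists_bound
  set l := lam K θ t
  set r := -lam K (θ + Real.pi) (-t)
  have hcol : ∀ X, MeasurableSet {Y | pt θ Y X ∈ K} := fun X =>
    (hK.isCompact_column θ X).measurableSet
  have hfin : ∀ X, volume {Y | pt θ Y X ∈ K} ≠ ⊤ := fun X =>
    (hK.isCompact_column θ X).measure_lt_top.ne
  have hempty : ∀ X, M ≤ |X| → {Y | pt θ Y X ∈ K} = ∅ := by
    intro X hX
    ext Y
    simp only [mem_ofPred_eq, mem_empty_iff_false, iff_false]
    intro h
    have := abs_inner_dir_le (pt θ Y X) θ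
    rw [inner_pt_dir] at this
    linarith [hb _ h]
  rw [funext (hK.areaBelow_eq_integral θ), ← integral_indicator measurableSet_Ioo]
  -- Columns with `|X| ≥ M` are empty, so the Lipschitz bound has compact support and is integrable.
  have hlip : ∀ X, ∀ q q' : ℝ × ℝ, |volume.real ({Y | pt θ Y X ∈ K} ∩ Iic (q.2 + q.1 * X)) -
      volume.real ({Y | pt θ Y X ∈ K} ∩ Iic (q'.2 + q'.1 * X))| ≤
      (Icc (-M) M).indicator (fun _ => 1 + M) X * ‖q - q'‖ := by
    intro X q q'
    by_cases hX : X ∈ Icc (-M) M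
    · rw [indicator_of_mem hX]
      refine (abs_volume_inter_Iic_sub_le (hcol X) (hfin X) _ _).trans ?_
      have e : q.2 + q.1 * X - (q'.2 + q'.1 * X) = (q - q').2 + (q - q').1 * X := by
        simp; ring
      rw [e]
      have h1 := norm_fst_le (q - q')
      have h2 := norm_snd_le (q - q')
      rw [Real.norm_eq_abs] at h1 h2
      have h3 : |X| ≤ M := abs_le.2 hX
      calc |(q - q').2 + (q - q').1 * X| ≤ |(q - q').2| + |(q - q').1| * |X| := by
            rw [← abs_mul]; exact abs_add_le _ _
        _ ≤ ‖q - q'‖ + ‖q - q'‖ * M := by gcongr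
        _ = _ := by ring
    · rw [indicator_of_notMem hX, hempty X]
      · simp
      · rw [mem_Icc, ← abs_le, not_le] at hX; exact hX.le
  refine (hasFDerivAt_integral_of_dominated_loc_of_lip' (s := univ)
    (bound := (Icc (-M) M).indicator fun _ => 1 + M) univ_mem
    (fun q _ => (hK.measurable_column θ q).aestronglyMeasurable) ?_ ?_
    (Eventually.of_forall fun X q _ => hlip X q _) ?_ ?_).2
  · refine Integrable.mono' (g := (Icc (-M) M).indicator fun _ => 2 * M) ?_
      (hK.measurable_column θ _).aestronglyMeasurable (Eventually.of_forall fun X => ?_)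
    · exact (integrable_indicator_iff measurableSet_Icc).2 (integrableOn_const (by simp))
    · by_cases hX : X ∈ Icc (-M) M
      · rw [indicator_of_mem hX, Real.norm_eq_abs, abs_of_nonneg measureReal_nonneg]
        have : {Y | pt θ Y X ∈ K} ∩ Iic ((0, t) : ℝ × ℝ).2 ⊆ Icc (-M) M := by
          rintro Y ⟨hY, _⟩
          have := abs_inner_nor_le (pt θ Y X) θ
          rw [inner_pt_nor] at this
          exact abs_le.1 (this.trans (hb _ hY).le)
        refine (measureReal_mono (s₂ := Icc (-M) M) ?_ (by simp)).trans ?_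
        · simpa using this
        · rw [Real.volume_real_Icc_of_le (by linarith)]; linarith
      · rw [indicator_of_notMem hX, hempty X]
        · simp
        · rw [mem_Icc, ← abs_le, not_le] at hX; exact hX.le
  · exact (Continuous.aestronglyMeasurable (by fun_prop)).indicator measurableSet_Ioo
  · exact (integrable_indicator_iff measurableSet_Icc).2 (integrableOn_const (by simp))
  -- Only at the two ends of the chord can the column length fail to be differentiable.
  · have hne : ∀ᵐ X : ℝ, X ≠ l ∧ X ≠ r := by
      have h1 : ∀ᵐ X : ℝ, X ≠ l := by simp [ae_iff]
      have h2 : ∀ᵐ X : ℝ, X ≠ r := by simp [ae_iff]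
      exact h1.and h2
    have hcY : ∀ X, Continuous fun Y => pt θ Y X := fun X =>
      (continuous_pt_prod θ).comp (f := fun Y => (X, Y)) (by fun_prop)
    filter_upwards [hne] with X ⟨hl, hr⟩
    have hinner : HasFDerivAt (fun q : ℝ × ℝ => q.2 + q.1 * X)
        (X • ContinuousLinearMap.fst ℝ ℝ ℝ + ContinuousLinearMap.snd ℝ ℝ ℝ) (0, t) := by
      have := (hasFDerivAt_snd (𝕜 := ℝ) (p := ((0 : ℝ), t))).add
        ((hasFDerivAt_fst (𝕜 := ℝ) (p := ((0 : ℝ), t))).mul_const X)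
      refine this.congr_fderiv ?_
      rw [add_comm]
    by_cases hX : X ∈ Ioo l r
    · rw [indicator_of_mem hX]
      have hint := hK.pt_mem_interior ht hX.1 hX.2
      have hd := hasDerivAt_volume_inter_Iic_of_mem (hcol X) (hfin X) (z := t)
        (mem_of_superset ((hcY X).continuousAt.preimage_mem_nhds (isOpen_interior.mem_nhds hint))
          fun Y hY => interior_subset (s := K) hY)
      have := HasDerivAt.comp_hasFDerivAt (f := fun q : ℝ × ℝ => q.2 + q.1 * X)
        ((0 : ℝ), t) (by simpa using hd) hinner
      rw [one_smul] at this
      exact this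
    · rw [indicator_of_notMem hX]
      have hout : pt θ t X ∉ K := fun hmem => hX
        ⟨lt_of_le_of_ne (hK.lam_le hmem) hl.symm, lt_of_le_of_ne (hK.le_neg_lam hmem) hr⟩
      have hd := hasDerivAt_volume_inter_Iic_of_notMem (hcol X) (hfin X) (z := t)
        ((hcY X).continuousAt.preimage_mem_nhds (hK.compact.isClosed.isOpen_compl.mem_nhds hout))
      have := HasDerivAt.comp_hasFDerivAt (f := fun q : ℝ × ℝ => q.2 + q.1 * X)
        ((0 : ℝ), t) (by simpa using hd) hinner
      rw [zero_smul] at this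
      exact this

lemma setIntegral_smul_fst_add_snd {l r : ℝ} (h : l ≤ r) (q : ℝ × ℝ) :
    (∫ X in Ioo l r, (X • ContinuousLinearMap.fst ℝ ℝ ℝ + ContinuousLinearMap.snd ℝ ℝ ℝ)) q =
      (r - l) * (q.2 + (l + r) / 2 * q.1) := by
  have hi : IntegrableOn (fun X : ℝ => X • ContinuousLinearMap.fst ℝ ℝ ℝ +
      ContinuousLinearMap.snd ℝ ℝ ℝ) (Ioo l r) :=
    (ContinuousOn.integrableOn_Icc (by fun_prop)).mono_set Ioo_subset_Icc_self
  rw [ContinuousLinearMap.integral_apply hi, ← integral_Ioc_eq_integral_Ioo,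
    ← intervalIntegral.integral_of_le h]
  simp
  ring

/-- The support function of the `α`-sections is differentiable, with derivative the opposite of
the abscissa of the midpoint of the chord. -/
lemma IsBody.hasDerivAt_offset (hK : IsBody K) {α : ℝ} (h0 : 0 < α) (h1 : α < 1) (θ : ℝ) :
    HasDerivAt (offset K α) (-inner ℝ (mid K α θ) (dir θ)) θ := by
  set t := offset K α θ with ht
  have hmem : t ∈ heights K θ := hK.offset_mem_heights h0 h1 θ
  set l := lam K θ t with hl
  set r := -lam K (θ + Real.pi) (-t) with hr
  have hlr : l < r := hK.lam_add_lt hmem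
  set μ := (l + r) / 2 with hμ
  have hmid : inner ℝ (mid K α θ) (dir θ) = μ := by
    rw [mid_eq, inner_pt_dir, hμ, hl, hr]; ring
  rw [hmid]
  have hG := hK.hasFDerivAt_areaBelow hmem
  -- The intercept of the nearby section in the frame of angle `θ`: the curve `(tan δ, τ δ)` stays
  -- on one level set of `areaBelow`.
  set τ : ℝ → ℝ := fun δ => offset K α (θ + δ) / Real.cos δ with hτ
  have hτ0 : τ 0 = t := by simp [hτ, ht]
  have hcτ : ContinuousAt τ 0 := by
    refine ContinuousAt.div ?_ Real.continuous_cos.continuousAt (by simp)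
    exact ((hK.continuous_offset h0 h1).comp (continuous_const.add continuous_id)).continuousAt
  have htan : HasDerivAt Real.tan 1 0 := by
    simpa using Real.hasDerivAt_tan (x := 0) (by simp)
  have hpair : Tendsto (fun δ => (Real.tan δ, τ δ)) (𝓝 0) (𝓝 ((0 : ℝ), t)) := by
    have := htan.continuousAt.prodMk hcτ
    rwa [ContinuousAt, hτ0, Real.tan_zero] at this
  have hcos : ∀ᶠ δ in 𝓝 (0 : ℝ), 0 < Real.cos δ :=
    Real.continuous_cos.continuousAt.eventually_const_lt (by simp)
  have hconst : ∀ δ, 0 < Real.cos δ → areaBelow K θ (Real.tan δ, τ δ) = α * volume.real K := by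
    intro δ hδ
    rw [hτ, ← hK.area_add θ _ hδ, hK.area_offset h0 h1]
  have ho := hG.isLittleO.comp_tendsto hpair
  -- Up to the factor `r - l`, this is the differential of the area applied to the increment;
  -- constancy of the area makes it negligible against the increment.
  set e : ℝ → ℝ := fun δ => τ δ - t + μ * Real.tan δ with he
  have ho2 : e =o[𝓝 0] fun δ => ((Real.tan δ, τ δ) - ((0 : ℝ), t) : ℝ × ℝ) := by
    have h3 : (fun δ => (r - l) * e δ) =o[𝓝 0]
        fun δ => ((Real.tan δ, τ δ) - ((0 : ℝ), t) : ℝ × ℝ) := by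
      refine (ho.neg_left).congr' ?_ EventuallyEq.rfl
      filter_upwards [hcos] with δ hδ
      have e0 := hconst 0 (by simp)
      rw [hτ0, Real.tan_zero] at e0
      simp only [Function.comp, hconst δ hδ, e0]
      rw [setIntegral_smul_fst_add_snd hlr.le]
      simp [he, hμ]
    exact (Asymptotics.isLittleO_const_mul_left_iff (by linarith : r - l ≠ 0)).1 h3
  -- The implicit function argument: bounding `e` by half the increment lets `|τ δ - t|` be
  -- absorbed, leaving a bound by `|tan δ|`. No differentiability of `τ` is presupposed.
  have hO : (fun δ => ((Real.tan δ, τ δ) - ((0 : ℝ), t) : ℝ × ℝ)) =O[𝓝 0] Real.tan := by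
    refine Asymptotics.IsBigO.of_bound (1 + 2 * |μ| + 1) ?_
    filter_upwards [ho2.bound (by norm_num : (0 : ℝ) < 1 / 2)] with δ hδ
    have e1 : ‖((Real.tan δ, τ δ) - ((0 : ℝ), t) : ℝ × ℝ)‖ = max |Real.tan δ| |τ δ - t| := by
      simp [Prod.norm_def]
    rw [e1] at hδ ⊢
    rw [Real.norm_eq_abs] at hδ ⊢
    have e2 : |τ δ - t| ≤ |e δ| + |μ| * |Real.tan δ| := by
      rw [← abs_mul]
      have : τ δ - t = e δ - μ * Real.tan δ := by simp [he]
      rw [this]; exact abs_sub _ _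
    have e3 := abs_nonneg (Real.tan δ)
    have e4 := mul_nonneg (abs_nonneg μ) e3
    rcases max_cases |Real.tan δ| |τ δ - t| with ⟨e5, _⟩ | ⟨e5, _⟩ <;> rw [e5] at hδ ⊢ <;>
      nlinarith
  have htO : Real.tan =O[𝓝 0] fun δ : ℝ => δ := by
    simpa using htan.isBigO_sub
  have hoe : e =o[𝓝 0] fun δ : ℝ => δ := ho2.trans_isBigO (hO.trans htO)
  have hde : HasDerivAt e 0 0 := by
    rw [hasDerivAt_iff_isLittleO_nhds_zero]
    have : e 0 = 0 := by simp [he, hτ0]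
    simpa [this] using hoe
  have hdτ : HasDerivAt τ (-μ) 0 := by
    have : τ = fun δ => e δ - μ * Real.tan δ + t := by
      funext δ; simp [he]
    rw [this]
    simpa using (hde.sub (htan.const_mul μ)).add_const t
  have hdp : HasDerivAt (fun δ => offset K α (θ + δ)) (-μ) 0 := by
    have := hdτ.mul (Real.hasDerivAt_cos 0)
    simp at this
    refine this.congr_of_eventuallyEq ?_
    filter_upwards [hcos] with δ hδ
    simp [hτ, div_mul_cancel₀ _ hδ.ne']
  have := HasDerivAt.comp_sub_const (x := θ) (a := θ) (f := fun δ => offset K α (θ + δ))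
    (by simpa using hdp)
  simpa using this

/-! ### One-sided derivatives of chord endpoints and midpoints -/

lemma lam_add_two_pi (θ t : ℝ) : lam K (θ + Real.pi + Real.pi) t = lam K θ t := by
  have : ∀ s, pt (θ + Real.pi + Real.pi) t s = pt θ t s := fun s => by
    rw [pt_add_pi, pt_add_pi, neg_neg, neg_neg]
  simp only [lam, this]

/-- Half the length of the chord cut by the `α`-section of direction `u(θ)`. -/
def halfChord (K : Set Plane) (α θ : ℝ) : ℝ :=
  (-lam K (θ + Real.pi) (-offset K α θ) - lam K θ (offset K α θ)) / 2

lemma IsBody.halfChord_pos (hK : IsBody K) {α : ℝ} (h0 : 0 < α) (h1 : α < 1) (θ : ℝ) :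
    0 < halfChord K α θ := by
  have := hK.lam_add_lt (hK.offset_mem_heights h0 h1 θ)
  unfold halfChord; linarith

lemma IsBody.halfChord_add_pi (hK : IsBody K) {α : ℝ} (h0 : 0 < α) (h1 : α < 1) (θ : ℝ) :
    halfChord K (1 - α) (θ + Real.pi) = halfChord K α θ := by
  simp only [halfChord, hK.offset_add_pi h0 h1, lam_add_two_pi, neg_neg]; ring

/-- The left slope of the left boundary of `K`, in the frame of angle `θ`. -/
def lamL (K : Set Plane) (θ t : ℝ) : ℝ := derivWithin (lam K θ) (Iio t) t

/-- The right slope of the left boundary of `K`, in the frame of angle `θ`. -/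
def lamR (K : Set Plane) (θ t : ℝ) : ℝ := derivWithin (lam K θ) (Ioi t) t

lemma lam_add_two_pi_fun (θ : ℝ) : lam K (θ + Real.pi + Real.pi) = lam K θ :=
  funext fun t => lam_add_two_pi θ t

lemma IsBody.chordStart_mem (hK : IsBody K) {α : ℝ} (h0 : 0 < α) (h1 : α < 1) (θ : ℝ) :
    chordStart K α θ ∈ K := by
  obtain ⟨s, hs⟩ := hK.offset_mem_heights h0 h1 θ
  exact hK.lam_mem (interior_subset hs)

/-- Because the first factor vanishes at the point, mere continuity of the second suffices. This
applies to the abscissa of the endpoint before its differentiability is known. -/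
lemma hasDerivAt_mul_of_eq_zero {f g : ℝ → ℝ} {f' x : ℝ} (hf : HasDerivAt f f' x) (h0 : f x = 0)
    (hg : ContinuousAt g x) : HasDerivAt (fun y => f y * g y) (f' * g x) x := by
  rw [hasDerivAt_iff_tendsto_slope] at hf ⊢
  refine (hf.mul (hg.tendsto.mono_left nhdsWithin_le_nhds)).congr fun y => ?_
  simp [slope_def_field, h0]; ring

/-- With X, Y the coordinates of the endpoint in the fixed frame and δ the angle increment, lying on
the section reads `Y cos δ - X sin δ = offset`. At δ = 0 this yields Y' = p' + X, the signed
distance from the midpoint to the initial endpoint. -/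
lemma IsBody.hasDerivAt_chordStart_nor (hK : IsBody K) {α : ℝ} (h0 : 0 < α) (h1 : α < 1) (θ : ℝ) :
    HasDerivAt (fun φ => (inner ℝ (chordStart K α φ) (nor θ) : ℝ)) (-halfChord K α θ) θ := by
  have hc := hK.continuous_chordStart h0 h1
  have hX : ContinuousAt (fun φ => (inner ℝ (chordStart K α φ) (dir θ) : ℝ)) θ :=
    (hc.inner continuous_const).continuousAt
  have hs : HasDerivAt (fun φ => Real.sin (φ - θ)) 1 θ := by
    simpa using ((hasDerivAt_id θ).sub_const θ).sin
  have hcs : HasDerivAt (fun φ => Real.cos (φ - θ)) 0 θ := by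
    simpa using ((hasDerivAt_id θ).sub_const θ).cos
  have h2 := ((hK.hasDerivAt_offset h0 h1 θ).add
    (hasDerivAt_mul_of_eq_zero hs (by simp) hX)).div hcs (by simp)
  have hev : ∀ᶠ φ in 𝓝 θ, 0 < Real.cos (φ - θ) :=
    hcs.continuousAt.eventually_const_lt (by simp)
  have h3 := h2.congr_of_eventuallyEq
    (f₁ := fun φ => (inner ℝ (chordStart K α φ) (nor θ) : ℝ)) (by
      filter_upwards [hev] with φ hφ
      have := inner_nor_add (chordStart K α φ) θ (φ - θ)
      rw [add_sub_cancel, chordStart_eq, inner_pt_nor] at this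
      show inner ℝ (chordStart K α φ) (nor θ) = (offset K α φ +
        Real.sin (φ - θ) * inner ℝ (chordStart K α φ) (dir θ)) / Real.cos (φ - θ)
      rw [eq_div_iff hφ.ne', this, chordStart_eq]
      ring)
  refine h3.congr_deriv ?_
  simp only [sub_self, Real.cos_zero, mid_eq, chordStart_eq, inner_pt_dir, halfChord]
  ring

/-- Near `θ` the endpoint remains left of an interior point at its own height. If it were strictly
right of the left boundary it would be interior to `K`, which no chord endpoint is. -/
lemma IsBody.eventually_chordStart_dir (hK : IsBody K) {α : ℝ} (h0 : 0 < α) (h1 : α < 1) (θ : ℝ) :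
    ∀ᶠ φ in 𝓝 θ, inner ℝ (chordStart K α φ) (dir θ) =
      lam K θ (inner ℝ (chordStart K α φ) (nor θ)) := by
  have hc := hK.continuous_chordStart h0 h1
  obtain ⟨s, hs⟩ := hK.offset_mem_heights h0 h1 θ
  have hX : Continuous (fun φ => (inner ℝ (chordStart K α φ) (dir θ) : ℝ)) :=
    hc.inner continuous_const
  have hY : Continuous (fun φ => (inner ℝ (chordStart K α φ) (nor θ) : ℝ)) :=
    hc.inner continuous_const
  have e1 : ∀ᶠ φ in 𝓝 θ, inner ℝ (chordStart K α φ) (dir θ) < s :=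
    hX.continuousAt.eventually_lt_const (by
      simp only [chordStart_eq, inner_pt_dir]; exact hK.lam_lt hs)
  have e2 : ∀ᶠ φ in 𝓝 θ, pt θ (inner ℝ (chordStart K α φ) (nor θ)) s ∈ interior K := by
    have : Continuous fun φ => pt θ (inner ℝ (chordStart K α φ) (nor θ)) s :=
      (continuous_pt_prod θ).comp (g := fun z : ℝ × ℝ => pt θ z.2 z.1)
        (f := fun φ => (s, inner ℝ (chordStart K α φ) (nor θ))) (by fun_prop)
    refine this.continuousAt.eventually (isOpen_interior.mem_nhds ?_)
    simpa only [chordStart_eq, inner_pt_nor] using hs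
  filter_upwards [e1, e2] with φ h1' h2'
  have hmem := hK.chordStart_mem h0 h1 φ
  have hmem' := hmem
  rw [← pt_inner θ (chordStart K α φ)] at hmem'
  refine le_antisymm ?_ (hK.lam_le hmem')
  by_contra! hlt
  have := hK.pt_mem_interior_of_lt_of_interior (hK.lam_mem hmem') h2' hlt h1'.le
  rw [pt_inner, chordStart_eq] at this
  exact hK.lam_not_mem_interior _ _ this

lemma eventually_gt_of_hasDerivAt_neg {f : ℝ → ℝ} {f' x : ℝ} (hf : HasDerivAt f f' x)
    (h : f' < 0) : (∀ᶠ y in 𝓝[>] x, f y < f x) ∧ ∀ᶠ y in 𝓝[<] x, f x < f y := by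
  have := (hasDerivAt_iff_tendsto_slope.1 hf).eventually_lt_const h
  constructor
  · filter_upwards [this.filter_mono (nhdsWithin_mono x fun y (hy : x < y) => hy.ne'),
      self_mem_nhdsWithin] with y hy (hy' : x < y)
    rw [slope_def_field, div_neg_iff] at hy
    rcases hy with hy | hy <;> linarith
  · filter_upwards [this.filter_mono (nhdsWithin_mono x fun y (hy : y < x) => hy.ne),
      self_mem_nhdsWithin] with y hy (hy' : y < x)
    rw [slope_def_field, div_neg_iff] at hy
    rcases hy with hy | hy <;> linarith

lemma IsBody.hasDerivWithinAt_lamL (hK : IsBody K) {θ t : ℝ} (ht : t ∈ heights K θ) :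
    HasDerivWithinAt (lam K θ) (lamL K θ t) (Iio t) t :=
  (hK.convexOn_lam θ).hasDerivWithinAt_leftDeriv_of_mem_interior
    (by rwa [(isOpen_heights θ).interior_eq])

lemma IsBody.hasDerivWithinAt_lamR (hK : IsBody K) {θ t : ℝ} (ht : t ∈ heights K θ) :
    HasDerivWithinAt (lam K θ) (lamR K θ t) (Ioi t) t :=
  (hK.convexOn_lam θ).hasDerivWithinAt_rightDeriv_of_mem_interior
    (by rwa [(isOpen_heights θ).interior_eq])

/-- The height of the initial endpoint decreases as the angle increases, so the motion to the right
explores the boundary from below: the right derivative sees the left slope `lamL`. -/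
lemma IsBody.hasDerivWithinAt_chordStart_Ioi (hK : IsBody K) {α : ℝ} (h0 : 0 < α) (h1 : α < 1)
    (θ : ℝ) : HasDerivWithinAt (chordStart K α)
      (-halfChord K α θ • (nor θ + lamL K θ (offset K α θ) • dir θ)) (Ioi θ) θ := by
  have hY := hK.hasDerivAt_chordStart_nor h0 h1 θ
  have hYθ : inner ℝ (chordStart K α θ) (nor θ) = offset K α θ := by
    rw [chordStart_eq, inner_pt_nor]
  have hmem := hK.offset_mem_heights h0 h1 θ
  have hneg := (eventually_gt_of_hasDerivAt_neg hY (by linarith [hK.halfChord_pos h0 h1 θ])).1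
  rw [hYθ] at hneg
  have hl := hK.hasDerivWithinAt_lamL hmem
  have hX1 : HasDerivWithinAt (fun φ => lam K θ (inner ℝ (chordStart K α φ) (nor θ)))
      (lamL K θ (offset K α θ) * -halfChord K α θ) (Ioi θ) θ := by
    have := HasDerivWithinAt.comp (h₂ := lam K θ)
      (h := fun φ => (inner ℝ (chordStart K α φ) (nor θ) : ℝ))
      (s := {φ | inner ℝ (chordStart K α φ) (nor θ) < offset K α θ})
      (s' := Iio (offset K α θ)) θ (by rwa [hYθ]) hY.hasDerivWithinAt (fun φ hφ => hφ)
    exact this.mono_of_mem_nhdsWithin hneg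
  have hX : HasDerivWithinAt (fun φ => (inner ℝ (chordStart K α φ) (dir θ) : ℝ))
      (lamL K θ (offset K α θ) * -halfChord K α θ) (Ioi θ) θ :=
    hX1.congr_of_eventuallyEq ((hK.eventually_chordStart_dir h0 h1 θ).filter_mono
      nhdsWithin_le_nhds) (hK.eventually_chordStart_dir h0 h1 θ).self_of_nhds
  have := (hY.hasDerivWithinAt (s := Ioi θ)).smul_const (nor θ) |>.add (hX.smul_const (dir θ))
  refine (this.congr_deriv ?_).congr_of_eventuallyEq (f₁ := chordStart K α)
    (Eventually.of_forall fun φ => (pt_inner θ _).symm) (pt_inner θ _).symm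
  rw [smul_add, smul_smul]; congr 2; ring

lemma IsBody.hasDerivWithinAt_chordStart_Iio (hK : IsBody K) {α : ℝ} (h0 : 0 < α) (h1 : α < 1)
    (θ : ℝ) : HasDerivWithinAt (chordStart K α)
      (-halfChord K α θ • (nor θ + lamR K θ (offset K α θ) • dir θ)) (Iio θ) θ := by
  have hY := hK.hasDerivAt_chordStart_nor h0 h1 θ
  have hYθ : inner ℝ (chordStart K α θ) (nor θ) = offset K α θ := by
    rw [chordStart_eq, inner_pt_nor]
  have hmem := hK.offset_mem_heights h0 h1 θ
  have hneg := (eventually_gt_of_hasDerivAt_neg hY (by linarith [hK.halfChord_pos h0 h1 θ])).2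
  rw [hYθ] at hneg
  have hl := hK.hasDerivWithinAt_lamR hmem
  have hX1 : HasDerivWithinAt (fun φ => lam K θ (inner ℝ (chordStart K α φ) (nor θ)))
      (lamR K θ (offset K α θ) * -halfChord K α θ) (Iio θ) θ := by
    have := HasDerivWithinAt.comp (h₂ := lam K θ)
      (h := fun φ => (inner ℝ (chordStart K α φ) (nor θ) : ℝ))
      (s := {φ | offset K α θ < inner ℝ (chordStart K α φ) (nor θ)})
      (s' := Ioi (offset K α θ)) θ (by rwa [hYθ]) hY.hasDerivWithinAt (fun φ hφ => hφ)
    exact this.mono_of_mem_nhdsWithin hneg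
  have hX : HasDerivWithinAt (fun φ => (inner ℝ (chordStart K α φ) (dir θ) : ℝ))
      (lamR K θ (offset K α θ) * -halfChord K α θ) (Iio θ) θ :=
    hX1.congr_of_eventuallyEq ((hK.eventually_chordStart_dir h0 h1 θ).filter_mono
      nhdsWithin_le_nhds) (hK.eventually_chordStart_dir h0 h1 θ).self_of_nhds
  have := (hY.hasDerivWithinAt (s := Iio θ)).smul_const (nor θ) |>.add (hX.smul_const (dir θ))
  refine (this.congr_deriv ?_).congr_of_eventuallyEq (f₁ := chordStart K α)
    (Eventually.of_forall fun φ => (pt_inner θ _).symm) (pt_inner θ _).symm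
  rw [smul_add, smul_smul]; congr 2; ring

lemma IsBody.mid_eq_chordStart (hK : IsBody K) {α : ℝ} (h0 : 0 < α) (h1 : α < 1) :
    mid K α = fun θ => (1 / 2 : ℝ) •
      (chordStart K α θ + chordStart K (1 - α) (θ + Real.pi)) := by
  funext θ
  rw [mid, midpoint_eq_smul_add, hK.chordEnd_eq_chordStart h0 h1]
  norm_num

/-- The two endpoints move by opposite amounts along the normal, at speed `halfChord`; these cancel
in the average and only the difference of slopes along `dir θ` remains. -/
lemma IsBody.hasDerivWithinAt_mid_Ioi (hK : IsBody K) {α : ℝ} (h0 : 0 < α) (h1 : α < 1)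
    (θ : ℝ) : HasDerivWithinAt (mid K α) ((halfChord K α θ / 2 *
      (lamL K (θ + Real.pi) (-offset K α θ) - lamL K θ (offset K α θ))) • dir θ) (Ioi θ) θ := by
  rw [hK.mid_eq_chordStart h0 h1]
  have e1 := hK.hasDerivWithinAt_chordStart_Ioi h0 h1 θ
  have e2 := hK.hasDerivWithinAt_chordStart_Ioi (α := 1 - α) (by linarith) (by linarith)
    (θ + Real.pi)
  have e3 : HasDerivWithinAt (fun φ => chordStart K (1 - α) (φ + Real.pi)) _ (Ioi θ) θ :=
    HasDerivWithinAt.scomp (g₁ := chordStart K (1 - α)) (h := fun φ => φ + Real.pi) θ e2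
      ((hasDerivAt_id θ).add_const Real.pi).hasDerivWithinAt
      (fun φ (hφ : θ < φ) => by simpa using hφ)
  refine ((e1.add e3).const_smul (1 / 2 : ℝ)).congr_deriv ?_
  rw [hK.halfChord_add_pi h0 h1, hK.offset_add_pi h0 h1, dir_add_pi, nor_add_pi]
  module

lemma IsBody.hasDerivWithinAt_mid_Iio (hK : IsBody K) {α : ℝ} (h0 : 0 < α) (h1 : α < 1)
    (θ : ℝ) : HasDerivWithinAt (mid K α) ((halfChord K α θ / 2 *
      (lamR K (θ + Real.pi) (-offset K α θ) - lamR K θ (offset K α θ))) • dir θ) (Iio θ) θ := by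
  rw [hK.mid_eq_chordStart h0 h1]
  have e1 := hK.hasDerivWithinAt_chordStart_Iio h0 h1 θ
  have e2 := hK.hasDerivWithinAt_chordStart_Iio (α := 1 - α) (by linarith) (by linarith)
    (θ + Real.pi)
  have e3 : HasDerivWithinAt (fun φ => chordStart K (1 - α) (φ + Real.pi)) _ (Iio θ) θ :=
    HasDerivWithinAt.scomp (g₁ := chordStart K (1 - α)) (h := fun φ => φ + Real.pi) θ e2
      ((hasDerivAt_id θ).add_const Real.pi).hasDerivWithinAt
      (fun φ (hφ : φ < θ) => by simpa using hφ)
  refine ((e1.add e3).const_smul (1 / 2 : ℝ)).congr_deriv ?_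
  rw [hK.halfChord_add_pi h0 h1, hK.offset_add_pi h0 h1, dir_add_pi, nor_add_pi]
  module

lemma IsBody.velRight_eq (hK : IsBody K) {α : ℝ} (h0 : 0 < α) (h1 : α < 1) (θ : ℝ) :
    velRight K α θ = halfChord K α θ / 2 *
      (lamL K (θ + Real.pi) (-offset K α θ) - lamL K θ (offset K α θ)) := by
  rw [velRight, (hK.hasDerivWithinAt_mid_Ioi h0 h1 θ).Ici_of_Ioi.derivWithin
    (uniqueDiffWithinAt_Ici θ), inner_smul_left]
  simp [norm_dir]

lemma IsBody.velLeft_eq (hK : IsBody K) {α : ℝ} (h0 : 0 < α) (h1 : α < 1) (θ : ℝ) :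
    velLeft K α θ = halfChord K α θ / 2 *
      (lamR K (θ + Real.pi) (-offset K α θ) - lamR K θ (offset K α θ)) := by
  rw [velLeft, (hK.hasDerivWithinAt_mid_Iio h0 h1 θ).Iic_of_Iio.derivWithin
    (uniqueDiffWithinAt_Iic θ), inner_smul_left]
  simp [norm_dir]

lemma IsBody.hasDerivWithinAt_mid_right (hK : IsBody K) {α : ℝ} (h0 : 0 < α) (h1 : α < 1)
    (θ : ℝ) : HasDerivWithinAt (mid K α) (velRight K α θ • dir θ) (Ici θ) θ := by
  rw [hK.velRight_eq h0 h1]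
  exact (hK.hasDerivWithinAt_mid_Ioi h0 h1 θ).Ici_of_Ioi

lemma IsBody.hasDerivWithinAt_mid_left (hK : IsBody K) {α : ℝ} (h0 : 0 < α) (h1 : α < 1)
    (θ : ℝ) : HasDerivWithinAt (mid K α) (velLeft K α θ • dir θ) (Iic θ) θ := by
  rw [hK.velLeft_eq h0 h1]
  exact (hK.hasDerivWithinAt_mid_Iio h0 h1 θ).Iic_of_Iio

lemma IsBody.velRight_add_pi (hK : IsBody K) {α : ℝ} (h0 : 0 < α) (h1 : α < 1) (θ : ℝ) :
    velRight K (1 - α) (θ + Real.pi) = -velRight K α θ := by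
  rw [hK.velRight_eq h0 h1, hK.velRight_eq (by linarith) (by linarith),
    hK.halfChord_add_pi h0 h1, hK.offset_add_pi h0 h1]
  simp only [lamL, lam_add_two_pi_fun, neg_neg]
  ring

/-! ### Strict convexity and critical value of the core -/

lemma exists_pos_le_of_periodic {f : ℝ → ℝ} (hc : Continuous f)
    (hp : ∀ θ, f (θ + 2 * Real.pi) = f θ) (hpos : ∀ θ, 0 < f θ) : ∃ ε > 0, ∀ θ, ε ≤ f θ := by
  obtain ⟨θ₀, _, h⟩ := isCompact_Icc.exists_isMinOn (nonempty_Icc.2 Real.two_pi_pos.le)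
    hc.continuousOn (s := Icc 0 (2 * Real.pi))
  refine ⟨f θ₀, hpos θ₀, fun θ => ?_⟩
  obtain ⟨φ, hφ, he⟩ := Function.Periodic.exists_mem_Ico₀ (f := f) hp Real.two_pi_pos θ
  rw [he]
  exact h ⟨hφ.1, hφ.2.le⟩

lemma nor_periodic (θ : ℝ) : nor (θ + 2 * Real.pi) = nor θ := by
  rw [two_mul, ← add_assoc, nor_add_pi, nor_add_pi, neg_neg]

lemma IsBody.area_periodic (θ t : ℝ) : area K (θ + 2 * Real.pi) t = area K θ t := by
  simp only [area, rightHalfPlane, nor_periodic]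

/-- A point of the core on an `α`-section is the midpoint of the chord. -/
lemma IsBody.eq_mid_of_mem_core (hK : IsBody K) {α : ℝ} (h0 : 0 < α) (h1 : α < 1) {x : Plane}
    (hx : x ∈ core K α) {θ : ℝ} (h : inner ℝ x (nor θ) = offset K α θ) : x = mid K α θ := by
  have hx' := (hK.mem_core_iff h0 h1).1 hx
  have hd : HasDerivAt (fun φ => (inner ℝ x (nor φ) : ℝ) - offset K α φ)
      (inner ℝ x (-dir θ) - -inner ℝ (mid K α θ) (dir θ)) θ := by
    refine (((hasDerivAt_const θ x).inner ℝ (hasDerivAt_nor θ)).sub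
      (hK.hasDerivAt_offset h0 h1 θ)).congr_deriv ?_
    simp
  have hmin : IsLocalMin (fun φ => (inner ℝ x (nor φ) : ℝ) - offset K α φ) θ :=
    Eventually.of_forall fun φ => by
      show _ - _ ≤ _ - _
      rw [h, sub_self]; linarith [hx' φ]
  have := hmin.hasDerivAt_eq_zero hd
  rw [inner_neg_right] at this
  refine eq_of_inner_eq θ ?_ (by linarith)
  rw [inner_mid_nor, h]

lemma IsBody.mem_interior_core (hK : IsBody K) {α : ℝ} (h0 : 0 < α) (h1 : α < 1) {z : Plane}
    (h : ∀ θ, offset K α θ < inner ℝ z (nor θ)) : z ∈ interior (core K α) := by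
  obtain ⟨ε, hε, hb⟩ := exists_pos_le_of_periodic
    (f := fun θ => (inner ℝ z (nor θ) : ℝ) - offset K α θ)
    ((continuous_const.inner continuous_nor).sub (hK.continuous_offset h0 h1))
    (fun θ => by simp only [nor_periodic, hK.offset_periodic h0 h1])
    (fun θ => sub_pos.2 (h θ))
  rw [mem_interior_iff_mem_nhds, Metric.mem_nhds_iff]
  refine ⟨ε, hε, fun x hx => (hK.mem_core_iff h0 h1).2 fun θ => ?_⟩
  have h2 := abs_inner_nor_le (x - z) θ
  rw [← dist_eq_norm] at h2
  have h3 := abs_le.1 (h2.trans (le_of_lt hx))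
  rw [inner_sub_left] at h3
  linarith [hb θ]

/-- By compactness of the circle of directions, the surplus of area over `α |K|` is bounded below by
some `ε`, so `α` can be raised by less than `ε / |K|`. -/
lemma IsBody.exists_mem_core_of_lt (hK : IsBody K) {α : ℝ} (h0 : 0 < α) (h1 : α < 1) {z : Plane}
    (h : ∀ θ, offset K α θ < inner ℝ z (nor θ)) : ∃ β, α < β ∧ β < 1 ∧ z ∈ core K β := by
  have hv := hK.volume_pos
  obtain ⟨ε, hε, hb⟩ := exists_pos_le_of_periodic
    (f := fun θ => area K θ (inner ℝ z (nor θ)) - α * volume.real K)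
    ((hK.continuous_area.comp (g := fun q : ℝ × ℝ => area K q.1 q.2)
      (f := fun θ => (θ, inner ℝ z (nor θ)))
      (continuous_id.prodMk (continuous_const.inner continuous_nor))).sub continuous_const)
    (fun θ => by simp only [nor_periodic, IsBody.area_periodic])
    (fun θ => by
      rw [sub_pos, ← not_le, ← hK.le_offset_iff h0 h1, not_le]; exact h θ)
  obtain ⟨β, hβ1, hβ2⟩ := exists_between (lt_min h1
    (show α < α + ε / volume.real K by linarith [div_pos hε hv]))
  refine ⟨β, hβ1, hβ2.trans_le (min_le_left _ _),
    (hK.mem_core_iff_area (h0.trans hβ1) (hβ2.trans_le (min_le_left _ _))).2 fun θ => ?_⟩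
  have h2 : β < α + ε / volume.real K := hβ2.trans_le (min_le_right _ _)
  have h3 : β * volume.real K < (α + ε / volume.real K) * volume.real K :=
    mul_lt_mul_of_pos_right h2 hv
  rw [add_mul, div_mul_cancel₀ _ hv.ne'] at h3
  linarith [hb θ]

/-- Equality would put both points on the section, where each would have to be the midpoint of the
chord. -/
lemma IsBody.offset_lt_of_mem_core (hK : IsBody K) {α : ℝ} (h0 : 0 < α) (h1 : α < 1)
    {x y : Plane} (hx : x ∈ core K α) (hy : y ∈ core K α) (hxy : x ≠ y) {a b : ℝ} (ha : 0 < a)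
    (hb : 0 < b) (hab : a + b = 1) (θ : ℝ) : offset K α θ < inner ℝ (a • x + b • y) (nor θ) := by
  have hx' := (hK.mem_core_iff h0 h1).1 hx θ
  have hy' := (hK.mem_core_iff h0 h1).1 hy θ
  rw [inner_add_left, inner_smul_left, inner_smul_left]
  simp only [conj_trivial]
  rcases hx'.eq_or_lt with ex | ex
  · rcases hy'.eq_or_lt with ey | ey
    · exact absurd ((hK.eq_mid_of_mem_core h0 h1 hx ex.symm).trans
        (hK.eq_mid_of_mem_core h0 h1 hy ey.symm).symm) hxy
    · have : b = 1 - a := by linarith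
      subst this; nlinarith
  · have : a = 1 - b := by linarith
    subst this; nlinarith

lemma IsBody.strictConvex_core (hK : IsBody K) {α : ℝ} (h0 : 0 < α) (h1 : α < 1) :
    StrictConvex ℝ (core K α) := fun _ hx _ hy hxy _ _ ha hb hab =>
  hK.mem_interior_core h0 h1 (hK.offset_lt_of_mem_core h0 h1 hx hy hxy ha hb hab)

lemma IsBody.core_subset_core (hK : IsBody K) {α β : ℝ} (h0 : 0 < α) (h1 : β < 1) (h : α ≤ β) :
    core K β ⊆ core K α := by
  rcases h.eq_or_lt with rfl | h
  · exact Subset.rfl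
  intro x hx
  rw [hK.mem_core_iff (h0.trans h) h1] at hx
  exact (hK.mem_core_iff h0 (h.trans h1)).2 fun θ => (hK.offset_lt_offset h0 h1 h θ).le.trans (hx θ)

lemma IsBody.le_half_of_mem_core (hK : IsBody K) {α : ℝ} (h0 : 0 < α) (h1 : α < 1) {x : Plane}
    (hx : x ∈ core K α) : α ≤ 1 / 2 := by
  have hx' := (hK.mem_core_iff_area h0 h1).1 hx
  have h2 := hx' 0
  have h3 := hx' (0 + Real.pi)
  rw [nor_add_pi, inner_neg_right, hK.area_add_pi] at h3
  nlinarith [hK.volume_pos]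

lemma IsBody.core_subset_of_bound (hK : IsBody K) {α : ℝ} (h0 : 0 < α) (h1 : α < 1) {M : ℝ}
    (hM : ∀ x ∈ K, ‖x‖ < M) : core K α ⊆ Metric.closedBall 0 M := by
  intro x hx
  rw [mem_closedBall_zero_iff]
  have hx' := (hK.mem_core_iff h0 h1).1 hx
  obtain ⟨θ, hθ⟩ := exists_eq_smul_nor x
  have h2 := hx' (θ + Real.pi)
  have h3 : inner ℝ x (nor (θ + Real.pi)) = -‖x‖ := by
    rw [nor_add_pi, inner_neg_right]
    conv_lhs => rw [hθ]
    rw [inner_smul_left, inner_nor_nor]; simp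
  obtain ⟨s, hs⟩ := hK.offset_mem_heights h0 h1 (θ + Real.pi)
  have h4 := abs_inner_nor_le (pt (θ + Real.pi) (offset K α (θ + Real.pi)) s) (θ + Real.pi)
  rw [inner_pt_nor] at h4
  have := abs_le.1 (h4.trans (hM _ (interior_subset hs)).le)
  linarith

lemma IsBody.mem_core_of_tendsto (hK : IsBody K) {α : ℝ} (h0 : 0 < α) (h1 : α < 1) {a : ℕ → ℝ}
    (ha0 : ∀ n, 0 < a n) (ha1 : ∀ n, a n < 1) (ha : Tendsto a atTop (𝓝 α)) {x : ℕ → Plane}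
    (hx : ∀ n, x n ∈ core K (a n)) {y : Plane} (hxy : Tendsto x atTop (𝓝 y)) : y ∈ core K α := by
  refine (hK.mem_core_iff_area h0 h1).2 fun θ => ?_
  have hc : Continuous fun z : Plane => area K θ (inner ℝ z (nor θ)) :=
    hK.continuous_area.comp (g := fun q : ℝ × ℝ => area K q.1 q.2)
      (f := fun z : Plane => (θ, inner ℝ z (nor θ))) (by fun_prop)
  exact le_of_tendsto_of_tendsto' (ha.mul_const _) ((hc.tendsto y).comp hxy)
    fun n => (hK.mem_core_iff_area (ha0 n) (ha1 n)).1 (hx n) θ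

lemma bddAbove_core_parameters :
    BddAbove {α | α ∈ Set.Ioo (0 : ℝ) 1 ∧ (core K α).Nonempty} :=
  ⟨1, fun _ h => h.1.2.le⟩

lemma le_alphaK {α : ℝ} (h0 : 0 < α) (h1 : α < 1) (h : (core K α).Nonempty) : α ≤ alphaK K :=
  le_csSup bddAbove_core_parameters ⟨⟨h0, h1⟩, h⟩

lemma IsBody.alphaK_le (hK : IsBody K) : alphaK K ≤ 1 / 2 :=
  Real.sSup_le (fun _ ⟨h, _, hx⟩ => hK.le_half_of_mem_core h.1 h.2 hx) (by norm_num)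

lemma IsBody.core_nonempty_of_lt (hK : IsBody K) {α : ℝ} (h0 : 0 < α) (h : α < alphaK K) :
    (core K α).Nonempty := by
  have hne : {α | α ∈ Set.Ioo (0 : ℝ) 1 ∧ (core K α).Nonempty}.Nonempty := by
    by_contra hne
    rw [not_nonempty_iff_eq_empty] at hne
    rw [alphaK, hne, Real.sSup_empty] at h
    linarith
  obtain ⟨β, ⟨hβ, x, hx⟩, hαβ⟩ := exists_lt_of_lt_csSup hne h
  exact ⟨x, hK.core_subset_core h0 hβ.2 hαβ.le hx⟩

lemma exists_seq_tendsto_of_pos {a : ℝ} (h : 0 < a) :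
    ∃ u : ℕ → ℝ, (∀ n, 0 < u n) ∧ (∀ n, u n < a) ∧ Tendsto u atTop (𝓝 a) := by
  obtain ⟨u, _, hu, hl⟩ := exists_seq_strictMono_tendsto' h
  exact ⟨u, fun n => (hu n).1, fun n => (hu n).2, hl⟩

/-- Compactness gives a point as the parameter increases to `alphaK K`. If there were two, their
midpoint would clear every section strictly and so belong to the core of a larger parameter. -/
lemma IsBody.core_alphaK (hK : IsBody K) (hpos : 0 < alphaK K) :
    ∃ T, core K (alphaK K) = {T} := by
  have h1 : alphaK K < 1 := hK.alphaK_le.trans_lt (by norm_num)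
  obtain ⟨u, hu0, hu1, hu⟩ := exists_seq_tendsto_of_pos hpos
  choose x hx using fun n => hK.core_nonempty_of_lt (hu0 n) (hu1 n)
  obtain ⟨M, hM, hb⟩ := hK.exists_bound
  obtain ⟨T, _, φ, hφ, hT⟩ := (isCompact_closedBall (0 : Plane) M).tendsto_subseq
    fun n => hK.core_subset_of_bound (hu0 n) ((hu1 n).trans h1) hb (hx n)
  have hTc : T ∈ core K (alphaK K) := hK.mem_core_of_tendsto hpos h1
    (fun n => hu0 (φ n)) (fun n => (hu1 _).trans h1) (hu.comp hφ.tendsto_atTop)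
    (fun n => hx (φ n)) hT
  refine ⟨T, Subset.antisymm (fun y hy => ?_) (singleton_subset_iff.2 hTc)⟩
  by_contra hne
  obtain ⟨β, hβ, hβ1, hz⟩ := hK.exists_mem_core_of_lt hpos h1
    (hK.offset_lt_of_mem_core hpos h1 hy hTc hne (a := 1 / 2) (b := 1 / 2)
      (by norm_num) (by norm_num) (by norm_num))
  exact hβ.not_ge (le_alphaK (hpos.trans hβ) hβ1 ⟨_, hz⟩)

lemma IsBody.isCoreCriticalValue (hK : IsBody K) (hpos : 0 < alphaK K) :
    IsCoreCriticalValue K (alphaK K) := by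
  have h1 : alphaK K < 1 := hK.alphaK_le.trans_lt (by norm_num)
  refine ⟨⟨hpos, h1⟩, fun α h0 hα => ⟨hK.strictConvex_core h0 (hα.trans h1), ?_⟩,
    hK.core_alphaK hpos, fun α hα hα1 => ?_⟩
  · obtain ⟨T, hT⟩ := hK.core_alphaK hpos
    have hTm : T ∈ core K (alphaK K) := by rw [hT]; rfl
    exact ⟨T, hK.mem_interior_core h0 (hα.trans h1) fun θ =>
      (hK.offset_lt_offset h0 h1 hα θ).trans_le ((hK.mem_core_iff hpos h1).1 hTm θ)⟩
  · rw [← not_nonempty_iff_eq_empty]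
    exact fun h => hα.not_ge (le_alphaK (hpos.trans hα) hα1 h)

/-! ### Central symmetry and the value `1 / 2` -/

/-- If all the `α`-sections pass through a common point, then `K` is symmetric about it
and `α = 1 / 2`. -/
lemma IsBody.symmetric_of_offset_eq (hK : IsBody K) {α : ℝ} (h0 : 0 < α) (h1 : α < 1)
    {T : Plane} (h : ∀ θ, offset K α θ = inner ℝ T (nor θ)) :
    α = 1 / 2 ∧ IsCentrallySymmetric K := by
  have hmid : ∀ θ, mid K α θ = T := by
    intro θ
    have hT : T ∈ core K α := (hK.mem_core_iff h0 h1).2 fun θ => (h θ).le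
    exact (hK.eq_mid_of_mem_core h0 h1 hT (h θ).symm).symm
  constructor
  · have h2 : area K (0 + Real.pi) (-offset K α 0) = α * volume.real K := by
      rw [← hK.offset_eq_iff h0 h1, h, h, nor_add_pi, inner_neg_right]
    rw [hK.area_add_pi, hK.area_offset h0 h1] at h2
    have := hK.volume_pos
    have : (1 - 2 * α) * volume.real K = 0 := by linarith
    rcases mul_eq_zero.1 this with h3 | h3 <;> linarith
  · refine ⟨T, fun x hx => ?_⟩
    obtain ⟨θ, hθ⟩ := exists_eq_smul_dir (x - T)
    have hxT : x = pt θ (inner ℝ T (nor θ)) (inner ℝ T (dir θ) + ‖x - T‖) := by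
      have : x = T + ‖x - T‖ • dir θ := by rw [← hθ]; abel
      conv_lhs => rw [this]
      nth_rewrite 1 [← pt_inner θ T]
      simp only [pt, add_smul, add_assoc]
    have hT' : Equiv.pointReflection T x =
        pt θ (inner ℝ T (nor θ)) (inner ℝ T (dir θ) - ‖x - T‖) := by
      have : Equiv.pointReflection T x = T - ‖x - T‖ • dir θ := by
        rw [Equiv.pointReflection_apply, ← hθ]; simp; abel
      rw [this]
      conv_lhs => enter [1]; rw [← pt_inner θ T]
      simp only [pt]; module
    have hmem := hK.offset_mem_heights h0 h1 θ
    rw [h θ] at hmem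
    rw [hxT] at hx
    rw [hT']
    -- Since `T` bisects the chord through `x`, the reflected abscissa stays within the chord.
    have h3 : (lam K θ (inner ℝ T (nor θ)) - lam K (θ + Real.pi) (-inner ℝ T (nor θ))) / 2 =
        inner ℝ T (dir θ) := by
      have := congrArg (fun z => (inner ℝ z (dir θ) : ℝ)) (hmid θ)
      simpa only [mid_eq, inner_pt_dir, h θ] using this
    have h4 := hK.le_neg_lam hx
    exact hK.pt_mem hmem (by linarith) (by linarith [norm_nonneg (x - T)])

lemma pt_reflection (c : Plane) (θ y s : ℝ) :
    Equiv.pointReflection c (pt θ y s) =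
      pt θ (2 * inner ℝ c (nor θ) - y) (2 * inner ℝ c (dir θ) - s) := by
  rw [Equiv.pointReflection_apply]
  conv_lhs => rw [← pt_inner θ c]
  simp [pt]; module

lemma reflection_mem_iff {c : Plane} (hc : ∀ x ∈ K, Equiv.pointReflection c x ∈ K) {x : Plane} :
    Equiv.pointReflection c x ∈ K ↔ x ∈ K :=
  ⟨fun h => by
    have := hc _ h
    rwa [Equiv.pointReflection_involutive c x] at this, hc x⟩

lemma pt_add_pi_mem_iff {c : Plane} (hc : ∀ x ∈ K, Equiv.pointReflection c x ∈ K)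
    (θ t s : ℝ) : pt (θ + Real.pi) t s ∈ K ↔
      pt θ (t + 2 * inner ℝ c (nor θ)) (s + 2 * inner ℝ c (dir θ)) ∈ K := by
  rw [← reflection_mem_iff hc, pt_add_pi, pt_reflection]
  ring_nf

lemma IsBody.lam_add_pi_of_symmetric (hK : IsBody K) {c : Plane}
    (hc : ∀ x ∈ K, Equiv.pointReflection c x ∈ K) {θ t : ℝ}
    (ht : t ∈ heights K (θ + Real.pi)) :
    lam K (θ + Real.pi) t = lam K θ (t + 2 * inner ℝ c (nor θ)) - 2 * inner ℝ c (dir θ) := by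
  obtain ⟨s, hs⟩ := ht
  have hs := interior_subset hs
  apply le_antisymm
  · apply hK.lam_le
    rw [pt_add_pi_mem_iff hc, sub_add_cancel]
    exact hK.lam_mem ((pt_add_pi_mem_iff hc _ _ _).1 hs)
  · rw [sub_le_iff_le_add]
    exact hK.lam_le ((pt_add_pi_mem_iff hc _ _ _).1 (hK.lam_mem hs))

lemma IsBody.area_of_symmetric (hK : IsBody K) {c : Plane}
    (hc : ∀ x ∈ K, Equiv.pointReflection c x ∈ K) (θ t : ℝ) :
    area K (θ + Real.pi) (t - 2 * inner ℝ c (nor θ)) = area K θ t := by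
  have hm := (hK.compact.measurableSet.inter (isClosed_rightHalfPlane θ t).measurableSet)
  have hp := Measure.measurePreserving_sub_left (volume : Measure Plane) ((2 : ℝ) • c)
  rw [area, area, measureReal_def, measureReal_def, ← hp.measure_preimage hm.nullMeasurableSet]
  congr 2
  ext x
  have hr : (2 : ℝ) • c - x = Equiv.pointReflection c x := by
    rw [Equiv.pointReflection_apply, two_smul]; simp; abel
  simp only [mem_inter_iff, mem_preimage]
  refine and_congr ?_ ?_
  · rw [hr, reflection_mem_iff hc]
  · simp only [rightHalfPlane, mem_ofPred_eq, nor_add_pi, inner_neg_right, inner_sub_left,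
      inner_smul_left, conj_trivial]
    constructor <;> intro h <;> linarith

lemma IsBody.offset_half_of_symmetric (hK : IsBody K) {c : Plane}
    (hc : ∀ x ∈ K, Equiv.pointReflection c x ∈ K) (θ : ℝ) :
    offset K (1 / 2) θ = inner ℝ c (nor θ) := by
  rw [hK.offset_eq_iff (by norm_num) (by norm_num)]
  have h1 := hK.area_of_symmetric hc θ (inner ℝ c (nor θ))
  have h2 := hK.area_add_pi θ (inner ℝ c (nor θ))
  rw [show (inner ℝ c (nor θ) : ℝ) - 2 * inner ℝ c (nor θ) = -inner ℝ c (nor θ) by ring] at h1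
  linarith

/-- At parameter `1 / 2` the sections of opposite orientation coincide as lines, so a core point
lies on both sides of each one, hence on all of them; conversely a center of symmetry bisects the
area in every direction. -/
lemma IsBody.alphaK_eq_half_iff (hK : IsBody K) (hpos : 0 < alphaK K) :
    alphaK K = 1 / 2 ↔ IsCentrallySymmetric K := by
  constructor
  · intro h
    obtain ⟨T, hT⟩ := hK.core_alphaK hpos
    rw [h] at hT
    have hTc : T ∈ core K (1 / 2) := by rw [hT]; rfl
    have hT' := (hK.mem_core_iff (by norm_num) (by norm_num)).1 hTc
    refine (hK.symmetric_of_offset_eq (α := 1 / 2) (T := T) (by norm_num) (by norm_num)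
      fun θ => le_antisymm (hT' θ) ?_).2
    have h1 := hT' (θ + Real.pi)
    have h2 := hK.offset_add_pi (α := 1 / 2) (by norm_num) (by norm_num) θ
    rw [show (1 : ℝ) - 1 / 2 = 1 / 2 by norm_num] at h2
    rw [nor_add_pi, inner_neg_right, h2] at h1
    linarith
  · rintro ⟨c, hc⟩
    refine le_antisymm hK.alphaK_le (le_alphaK (by norm_num) (by norm_num) ⟨c, ?_⟩)
    exact (hK.mem_core_iff (by norm_num) (by norm_num)).2 fun θ =>
      (hK.offset_half_of_symmetric hc θ).le

/-! ### Backward motion of the envelope and `alphaB` -/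

lemma le_of_rightDeriv_nonneg {f f' : ℝ → ℝ} {a b : ℝ} (hab : a ≤ b) (hc : Continuous f)
    (hd : ∀ x ∈ Ico a b, HasDerivWithinAt f (f' x) (Ici x) x) (h : ∀ x ∈ Ico a b, 0 ≤ f' x) :
    f a ≤ f b :=
  image_le_of_deriv_right_le_deriv_boundary (f := fun _ => f a) (f' := fun _ => 0)
    continuousOn_const (fun _ _ => hasDerivWithinAt_const _ _ _) le_rfl hc.continuousOn hd h
    (right_mem_Icc.2 hab)

lemma IsBody.hasDerivWithinAt_inner_mid (hK : IsBody K) {α : ℝ} (h0 : 0 < α) (h1 : α < 1)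
    (w : Plane) (θ : ℝ) : HasDerivWithinAt (fun s => (inner ℝ (mid K α s) w : ℝ))
      (velRight K α θ * inner ℝ (dir θ) w) (Ici θ) θ := by
  refine ((hK.hasDerivWithinAt_mid_right h0 h1 θ).inner ℝ
    (hasDerivWithinAt_const θ (Ici θ) w)).congr_deriv ?_
  simp [inner_smul_left]

lemma IsBody.hasDerivWithinAt_inner_mid_left (hK : IsBody K) {α : ℝ} (h0 : 0 < α) (h1 : α < 1)
    (w : Plane) (θ : ℝ) : HasDerivWithinAt (fun s => (inner ℝ (mid K α s) w : ℝ))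
      (velLeft K α θ * inner ℝ (dir θ) w) (Iic θ) θ := by
  refine ((hK.hasDerivWithinAt_mid_left h0 h1 θ).inner ℝ
    (hasDerivWithinAt_const θ (Iic θ) w)).congr_deriv ?_
  simp [inner_smul_left]

/-- If the envelope never moves backwards, it is contained in the core. -/
lemma IsBody.mid_mem_core (hK : IsBody K) {α : ℝ} (h0 : 0 < α) (h1 : α < 1)
    (hv : ∀ θ, 0 ≤ velRight K α θ) (θ : ℝ) : mid K α θ ∈ core K α := by
  refine (hK.mem_core_iff h0 h1).2 fun θ' => ?_
  obtain ⟨φ, hφ, he⟩ := Function.Periodic.exists_mem_Ico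
    (f := fun φ => (inner ℝ (mid K α θ) (nor φ) : ℝ) - offset K α φ)
    (fun φ => by simp only [nor_periodic, hK.offset_periodic h0 h1]) Real.two_pi_pos θ'
    (θ - Real.pi)
  rw [← sub_nonneg, he, sub_nonneg, ← inner_mid_nor]
  have hc : Continuous fun s => (inner ℝ (mid K α s) (nor φ) : ℝ) :=
    (hK.continuous_mid h0 h1).inner continuous_const
  have hd := fun s => hK.hasDerivWithinAt_inner_mid h0 h1 (nor φ) s
  -- The height of the envelope along `nor φ` has right derivative `velRight * sin (s - φ)`: it
  -- decreases weakly on the half-turn before `φ` and increases weakly on the half-turn after, so it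
  -- is least at `φ`.
  rcases le_total φ θ with h | h
  · refine le_of_rightDeriv_nonneg h hc (fun x _ => hd x) fun x hx => ?_
    rw [inner_dir_nor]
    exact mul_nonneg (hv x) (Real.sin_nonneg_of_nonneg_of_le_pi (by linarith [hx.1])
      (by linarith [hx.1, hx.2, hφ.1]))
  · rw [← neg_le_neg_iff]
    refine le_of_rightDeriv_nonneg (f := fun s => -(inner ℝ (mid K α s) (nor φ) : ℝ)) h hc.neg
      (fun x _ => (hd x).neg) fun x hx => ?_
    rw [inner_dir_nor, ← mul_neg, ← Real.sin_neg]
    exact mul_nonneg (hv x) (Real.sin_nonneg_of_nonneg_of_le_pi (by linarith [hx.2])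
      (by linarith [hx.1, hφ.2]))

/-- If the envelope lies on the left of all the `α`-sections, it never moves backwards. -/
lemma IsBody.vel_nonneg_of_le (hK : IsBody K) {α : ℝ} (h0 : 0 < α) (h1 : α < 1)
    (h : ∀ θ φ, offset K α φ ≤ inner ℝ (mid K α θ) (nor φ)) (θ : ℝ) :
    0 ≤ velRight K α θ ∧ 0 ≤ velLeft K α θ := by
  -- The hypothesis for the pairs `(θ, s)` and `(s, θ)` makes the increments of `mid` and `nor` have
  -- nonpositive inner product. Since `nor` has derivative `-dir`, the one-sided limits of this
  -- expression are the velocities.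
  have key : ∀ (s : ℝ), 0 ≤ -inner ℝ (slope (mid K α) θ s) (slope nor θ s) := by
    intro s
    have e1 := h θ s
    have e2 := h s θ
    rw [← inner_mid_nor] at e1 e2
    rw [slope_def_module, slope_def_module, inner_smul_left, inner_smul_right, conj_trivial,
      ← mul_assoc, ← mul_neg, ← inner_neg_right, inner_sub_left, inner_neg_right, inner_neg_right,
      inner_sub_right, inner_sub_right]
    exact mul_nonneg (mul_self_nonneg _) (by linarith)
  have hn := hasDerivAt_nor θ
  constructor
  · have e1 := (hasDerivWithinAt_iff_tendsto_slope' self_notMem_Ioi).1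
      ((hK.hasDerivWithinAt_mid_right h0 h1 θ).mono Ioi_subset_Ici_self)
    have e2 := (hasDerivWithinAt_iff_tendsto_slope' self_notMem_Ioi).1
      (hn.hasDerivWithinAt (s := Ioi θ))
    have := ge_of_tendsto' (e1.inner (𝕜 := ℝ) e2).neg key
    simpa [inner_smul_left, norm_dir] using this
  · have e1 := (hasDerivWithinAt_iff_tendsto_slope' self_notMem_Iio).1
      ((hK.hasDerivWithinAt_mid_left h0 h1 θ).mono Iio_subset_Iic_self)
    have e2 := (hasDerivWithinAt_iff_tendsto_slope' self_notMem_Iio).1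
      (hn.hasDerivWithinAt (s := Iio θ))
    have := ge_of_tendsto' (e1.inner (𝕜 := ℝ) e2).neg key
    simpa [inner_smul_left, norm_dir] using this

lemma IsBody.mid_eq_of_velRight_eq_zero (hK : IsBody K) {α : ℝ} (h0 : 0 < α) (h1 : α < 1)
    {a b : ℝ} (h : ∀ θ ∈ Ico a b, velRight K α θ = 0) : ∀ θ ∈ Icc a b, mid K α θ = mid K α a :=
  constant_of_has_deriv_right_zero (hK.continuous_mid h0 h1).continuousOn fun θ hθ => by
    have := hK.hasDerivWithinAt_mid_right h0 h1 θ
    rwa [h θ hθ, zero_smul] at this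

lemma IsBody.mid_eq_zero_of_velRight (hK : IsBody K) {α : ℝ} (h0 : 0 < α) (h1 : α < 1)
    (h : ∀ θ, velRight K α θ = 0) (θ : ℝ) : mid K α θ = mid K α 0 := by
  rcases le_total 0 θ with hθ | hθ
  · exact hK.mid_eq_of_velRight_eq_zero h0 h1 (fun φ _ => h φ) θ ⟨hθ, le_rfl⟩
  · exact (hK.mid_eq_of_velRight_eq_zero h0 h1 (fun φ _ => h φ) 0 ⟨hθ, le_rfl⟩).symm

lemma velRight_nonneg_of_backwardsSet {α : ℝ} (h : ¬ (backwardsSet K α).Nonempty) (θ : ℝ) :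
    0 ≤ velRight K α θ := by
  by_contra! hlt
  exact h ⟨θ, _, right_mem_uIcc, hlt⟩

lemma bddBelow_alphaB : BddBelow {α | α ∈ Set.Ioo (0 : ℝ) 1 ∧ (backwardsSet K α).Nonempty} :=
  ⟨0, fun _ h => h.1.1.le⟩

/-- Otherwise the envelopes of all parameters below `alphaK K` lie in their cores, and in the limit
the envelope at `alphaK K` reduces to the unique core point, a common point of all sections. -/
lemma IsBody.alphaB_lt_alphaK (hK : IsBody K) (hpos : 0 < alphaK K)
    (hs : ¬ IsCentrallySymmetric K) : alphaB K < alphaK K := by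
  by_contra! hle
  have h1 : alphaK K < 1 := hK.alphaK_le.trans_lt (by norm_num)
  obtain ⟨T, hT⟩ := hK.core_alphaK hpos
  obtain ⟨u, hu0, hu1, hu⟩ := exists_seq_tendsto_of_pos hpos
  have hmid : ∀ θ, mid K (alphaK K) θ = T := by
    intro θ
    have hc : Tendsto (fun n => mid K (u n) θ) atTop (𝓝 (mid K (alphaK K) θ)) :=
      Tendsto.comp (g := fun q : ℝ × ℝ => mid K q.1 q.2) (f := fun n => (u n, θ))
        (hK.continuousAt_mid hpos h1 θ) (Tendsto.prodMk_nhds hu tendsto_const_nhds)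
    have := hK.mem_core_of_tendsto hpos h1 hu0 (fun n => (hu1 n).trans h1) hu (fun n =>
      hK.mid_mem_core (hu0 n) ((hu1 n).trans h1) (velRight_nonneg_of_backwardsSet fun hne =>
        ((hu1 n).trans_le hle).not_ge
          (csInf_le bddBelow_alphaB ⟨⟨hu0 n, (hu1 n).trans h1⟩, hne⟩)) θ) hc
    rwa [hT] at this
  exact hs (hK.symmetric_of_offset_eq hpos h1 (T := T) fun θ => by
    rw [← hmid θ, inner_mid_nor]).2

lemma IsBody.lamL_le_lamL (hK : IsBody K) {θ t t' : ℝ} (ht : t ∈ heights K θ)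
    (ht' : t' ∈ heights K θ) (h : t ≤ t') : lamL K θ t ≤ lamL K θ t' :=
  (hK.convexOn_lam θ).monotoneOn_leftDeriv (by rwa [(isOpen_heights θ).interior_eq])
    (by rwa [(isOpen_heights θ).interior_eq]) h

lemma IsBody.lamR_le_lamR (hK : IsBody K) {θ t t' : ℝ} (ht : t ∈ heights K θ)
    (ht' : t' ∈ heights K θ) (h : t ≤ t') : lamR K θ t ≤ lamR K θ t' :=
  (hK.convexOn_lam θ).monotoneOn_rightDeriv (by rwa [(isOpen_heights θ).interior_eq])
    (by rwa [(isOpen_heights θ).interior_eq]) h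

lemma IsBody.lamL_le_lamR (hK : IsBody K) {θ t : ℝ} (ht : t ∈ heights K θ) :
    lamL K θ t ≤ lamR K θ t :=
  (hK.convexOn_lam θ).leftDeriv_le_rightDeriv_of_mem_interior
    (by rwa [(isOpen_heights θ).interior_eq])

lemma heights_of_symmetric {c : Plane} (hc : ∀ x ∈ K, Equiv.pointReflection c x ∈ K) {θ t : ℝ}
    (ht : t ∈ heights K θ) : 2 * inner ℝ c (nor θ) - t ∈ heights K θ := by
  obtain ⟨s, hs⟩ := ht
  refine ⟨2 * inner ℝ c (dir θ) - s, ?_⟩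
  have himg : (fun x => (2 : ℝ) • c - x) ⁻¹' K = K := by
    ext x
    have hr : (2 : ℝ) • c - x = Equiv.pointReflection c x := by
      rw [Equiv.pointReflection_apply, two_smul]; simp; abel
    rw [mem_preimage, hr, reflection_mem_iff hc]
  have h2 := preimage_interior_subset_interior_preimage
    (f := fun x : Plane => (2 : ℝ) • c - x) (by fun_prop) (t := K)
  rw [himg] at h2
  apply h2
  rw [mem_preimage, ← pt_reflection]
  have hr : ∀ x, (2 : ℝ) • c - Equiv.pointReflection c x = x := fun x => by
    rw [Equiv.pointReflection_apply, two_smul]; simp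
  rwa [hr]

/-- Reflection identifies the right boundary at height `t` with the left boundary at height `2 * τ -
t`, so the velocity compares slopes of a single convex function at these two heights. For `α < 1 /
2` the section is below the center, so `t < 2 * τ - t`. -/
lemma IsBody.vel_nonneg_of_symmetric (hK : IsBody K) (hs : IsCentrallySymmetric K) {α : ℝ}
    (h0 : 0 < α) (h1 : α < 1 / 2) (θ : ℝ) : 0 ≤ velRight K α θ ∧ 0 ≤ velLeft K α θ := by
  obtain ⟨c, hc⟩ := hs
  have hα : α < 1 := by linarith
  have hmem := hK.offset_mem_heights h0 hα θ
  set t := offset K α θ with ht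
  set τ : ℝ := inner ℝ c (nor θ) with hτ
  have htτ : t < τ := by
    rw [hτ, ← hK.offset_half_of_symmetric hc]
    exact hK.offset_lt_offset h0 (by norm_num) h1 θ
  have hmem' : 2 * τ - t ∈ heights K θ := heights_of_symmetric hc hmem
  have hpos := hK.halfChord_pos h0 hα θ
  have hev : ∀ᶠ y in 𝓝 (-t), lam K (θ + Real.pi) y =
      lam K θ (y + 2 * τ) - 2 * inner ℝ c (dir θ) := by
    filter_upwards [(isOpen_heights (θ + Real.pi)).mem_nhds (heights_add_pi.2 hmem)] with y hy
    exact hK.lam_add_pi_of_symmetric hc hy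
  have e : -t + 2 * τ = 2 * τ - t := by ring
  have hL : lamL K (θ + Real.pi) (-t) = lamL K θ (2 * τ - t) := by
    have h2 := hK.hasDerivWithinAt_lamL hmem'
    rw [← e] at h2
    have h3 := (HasDerivWithinAt.scomp (h := fun y => y + 2 * τ) (-t) h2
      ((hasDerivAt_id (-t)).add_const (2 * τ)).hasDerivWithinAt
      (s := Iio (-t)) (fun y (hy : y < -t) => by
        show y + 2 * τ < -t + 2 * τ
        linarith)).sub_const
        (2 * inner ℝ c (dir θ))
    have h4 := (h3.congr_of_eventuallyEq (hev.filter_mono nhdsWithin_le_nhds)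
      hev.self_of_nhds).derivWithin (uniqueDiffWithinAt_Iio _)
    rw [lamL, h4, one_smul, e]
  have hR : lamR K (θ + Real.pi) (-t) = lamR K θ (2 * τ - t) := by
    have h2 := hK.hasDerivWithinAt_lamR hmem'
    rw [← e] at h2
    have h3 := (HasDerivWithinAt.scomp (h := fun y => y + 2 * τ) (-t) h2
      ((hasDerivAt_id (-t)).add_const (2 * τ)).hasDerivWithinAt
      (s := Ioi (-t)) (fun y (hy : -t < y) => by
        show -t + 2 * τ < y + 2 * τ
        linarith)).sub_const
        (2 * inner ℝ c (dir θ))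
    have h4 := (h3.congr_of_eventuallyEq (hev.filter_mono nhdsWithin_le_nhds)
      hev.self_of_nhds).derivWithin (uniqueDiffWithinAt_Ioi _)
    rw [lamR, h4, one_smul, e]
  rw [hK.velRight_eq h0 hα, hK.velLeft_eq h0 hα, ← ht, hL, hR]
  have m1 := hK.lamL_le_lamL hmem hmem' (by linarith)
  have m2 := hK.lamR_le_lamR hmem hmem' (by linarith)
  exact ⟨mul_nonneg (by linarith) (by linarith), mul_nonneg (by linarith) (by linarith)⟩

lemma IsBody.alphaB_eq_half (hK : IsBody K) (hs : IsCentrallySymmetric K) :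
    alphaB K = 1 / 2 := by
  have hmem : ∀ α, 1 / 2 < α → α < 1 →
      α ∈ {α | α ∈ Set.Ioo (0 : ℝ) 1 ∧ (backwardsSet K α).Nonempty} := by
    intro α h h1
    refine ⟨⟨by linarith, h1⟩, ?_⟩
    by_contra hne
    have hv := velRight_nonneg_of_backwardsSet hne
    -- Nonnegative by symmetry since `1 - α < 1 / 2`, nonpositive as the opposite of a velocity at
    -- `α`. The envelope is then a point, which only the parameter `1 / 2` allows.
    have hz : ∀ θ, velRight K (1 - α) θ = 0 := by
      intro θ
      have e1 := hK.velRight_add_pi (α := α) (by linarith) h1 (θ - Real.pi)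
      rw [sub_add_cancel] at e1
      have e2 := (hK.vel_nonneg_of_symmetric hs (α := 1 - α) (by linarith) (by linarith) θ).1
      linarith [hv (θ - Real.pi)]
    have hm := hK.mid_eq_zero_of_velRight (α := 1 - α) (by linarith) (by linarith) hz
    have := (hK.symmetric_of_offset_eq (α := 1 - α) (by linarith) (by linarith)
      (T := mid K (1 - α) 0) fun θ => by rw [← hm θ, inner_mid_nor]).1
    linarith
  apply le_antisymm
  · refine le_of_forall_gt_imp_ge_of_dense fun α hα => ?_
    obtain ⟨β, hβ1, hβ2⟩ := exists_between (lt_min hα (show (1 / 2 : ℝ) < 1 by norm_num))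
    exact (csInf_le bddBelow_alphaB (hmem β hβ1 (hβ2.trans_le (min_le_right _ _)))).trans
      (hβ2.trans_le (min_le_left _ _)).le
  · refine le_csInf ⟨3 / 4, hmem _ (by norm_num) (by norm_num)⟩ ?_
    rintro α ⟨h, θ, v, hv, hneg⟩
    by_contra! hlt
    have := hK.vel_nonneg_of_symmetric hs h.1 hlt θ
    have h2 : 0 ≤ v := (le_min this.2 this.1).trans hv.1
    exact absurd hneg (not_lt.2 h2)

/-! ### Zero velocities and the rigidity they force -/

lemma deriv_right_nonneg_of_isLocalMin {f : ℝ → ℝ} {f' x : ℝ} (h : IsLocalMin f x)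
    (hd : HasDerivWithinAt f f' (Ici x) x) : 0 ≤ f' := by
  have hd := (hasDerivWithinAt_iff_tendsto_slope' self_notMem_Ioi).1 (hd.mono Ioi_subset_Ici_self)
  refine ge_of_tendsto hd ?_
  filter_upwards [h.filter_mono nhdsWithin_le_nhds, self_mem_nhdsWithin] with y hy (hy' : x < y)
  rw [slope_def_field]
  exact div_nonneg (sub_nonneg.2 hy) (sub_nonneg.2 hy'.le)

lemma deriv_left_nonpos_of_isLocalMin {f : ℝ → ℝ} {f' x : ℝ} (h : IsLocalMin f x)
    (hd : HasDerivWithinAt f f' (Iic x) x) : f' ≤ 0 := by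
  have hd := (hasDerivWithinAt_iff_tendsto_slope' self_notMem_Iio).1 (hd.mono Iio_subset_Iic_self)
  refine le_of_tendsto hd ?_
  filter_upwards [h.filter_mono nhdsWithin_le_nhds, self_mem_nhdsWithin] with y hy (hy' : y < x)
  rw [slope_def_field]
  exact div_nonpos_of_nonneg_of_nonpos (sub_nonneg.2 hy) (sub_nonpos.2 hy'.le)

/-- At parameter `1 / 2` the midpoint has period π, so its component along `dir 0` takes equal
values at `±π / 2` and has an extremum in between, where the cosine is positive and the one-sided
velocities have weakly opposite signs. In particular `alphaZ` is the infimum of a nonempty set. -/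
lemma IsBody.zeroSet_half_nonempty (hK : IsBody K) : (zeroSet K (1 / 2)).Nonempty := by
  have h0 : (0 : ℝ) < 1 / 2 := by norm_num
  have h1 : (1 / 2 : ℝ) < 1 := by norm_num
  have hc : Continuous fun s => (inner ℝ (mid K (1 / 2) s) (dir 0) : ℝ) :=
    (hK.continuous_mid h0 h1).inner continuous_const
  have hends : inner ℝ (mid K (1 / 2) (-(Real.pi / 2))) (dir 0) =
      inner ℝ (mid K (1 / 2) (Real.pi / 2)) (dir 0) := by
    have := hK.mid_add_pi h0 h1 (-(Real.pi / 2))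
    rw [show (1 : ℝ) - 1 / 2 = 1 / 2 by norm_num,
      show -(Real.pi / 2) + Real.pi = Real.pi / 2 by ring] at this
    rw [this]
  obtain ⟨c, hcI, hext⟩ := exists_isLocalExtr_Ioo (by linarith [Real.pi_pos]) hc.continuousOn hends
  have hcos : 0 < Real.cos (c - 0) := by
    rw [sub_zero]; exact Real.cos_pos_of_mem_Ioo hcI
  have hr := hK.hasDerivWithinAt_inner_mid h0 h1 (dir 0) c
  have hl := hK.hasDerivWithinAt_inner_mid_left h0 h1 (dir 0) c
  rw [inner_dir_dir] at hr hl
  refine ⟨c, ?_⟩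
  rcases hext with hmin | hmax
  · have e1 := deriv_right_nonneg_of_isLocalMin hmin hr
    have e2 := deriv_left_nonpos_of_isLocalMin hmin hl
    exact Icc_subset_uIcc ⟨nonpos_of_mul_nonpos_left e2 hcos, nonneg_of_mul_nonneg_left e1 hcos⟩
  · have e1 := deriv_right_nonneg_of_isLocalMin hmax.neg hr.neg
    have e2 := deriv_left_nonpos_of_isLocalMin hmax.neg hl.neg
    rw [← neg_mul] at e1 e2
    have e3 := nonneg_of_mul_nonneg_left e1 hcos
    have e4 := nonpos_of_mul_nonpos_left e2 hcos
    exact Icc_subset_uIcc' ⟨by linarith, by linarith⟩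

lemma alphaZ_nonneg : 0 ≤ alphaZ K := Real.sInf_nonneg fun _ h => h.1.1.le

lemma IsBody.exists_zeroSet_of_alphaZ_lt (hK : IsBody K) {α : ℝ} (h : alphaZ K < α) :
    ∃ β, 0 < β ∧ β < 1 ∧ β < α ∧ (zeroSet K β).Nonempty := by
  have hne : {α | α ∈ Set.Ioo (0 : ℝ) 1 ∧ (zeroSet K α).Nonempty}.Nonempty :=
    ⟨1 / 2, ⟨by norm_num, by norm_num⟩, hK.zeroSet_half_nonempty⟩
  obtain ⟨β, ⟨hβ, hz⟩, hβα⟩ := exists_lt_of_csInf_lt hne h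
  exact ⟨β, hβ.1, hβ.2, hβα, hz⟩

lemma IsBody.lam_ge_lamR (hK : IsBody K) {θ t y : ℝ} (ht : t ∈ heights K θ)
    (hy : y ∈ heights K θ) : lam K θ t + lamR K θ t * (y - t) ≤ lam K θ y := by
  have hti : t ∈ interior (heights K θ) := by rwa [(isOpen_heights θ).interior_eq]
  rcases lt_trichotomy t y with h | rfl | h
  · have := (hK.convexOn_lam θ).rightDeriv_le_slope_of_mem_interior hti hy h
    rw [slope_def_field, le_div_iff₀ (by linarith)] at this
    rw [lamR]; linarith
  · simp
  · have := (hK.convexOn_lam θ).slope_le_leftDeriv_of_mem_interior hy hti h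
    rw [slope_def_field, div_le_iff₀ (by linarith)] at this
    have h2 := hK.lamL_le_lamR ht
    rw [← lamL] at this
    nlinarith

lemma IsBody.lamR_mul_le (hK : IsBody K) {θ t t' : ℝ} (ht : t ∈ heights K θ)
    (ht' : t' ∈ heights K θ) :
    lamR K θ t * (t' - t) ≤ lam K θ t' - lam K θ t := by
  have := hK.lam_ge_lamR ht ht'
  linarith

lemma IsBody.le_lamL_mul (hK : IsBody K) {θ t t' : ℝ} (ht : t ∈ heights K θ)
    (ht' : t' ∈ heights K θ) (h : t < t') :
    lam K θ t' - lam K θ t ≤ lamL K θ t' * (t' - t) := by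
  have hti : t' ∈ interior (heights K θ) := by rwa [(isOpen_heights θ).interior_eq]
  have := (hK.convexOn_lam θ).slope_le_leftDeriv_of_mem_interior ht hti h
  rw [slope_def_field, div_le_iff₀ (by linarith)] at this
  exact this

lemma IsBody.lamR_le_lamL (hK : IsBody K) {θ t t' : ℝ} (ht : t ∈ heights K θ)
    (ht' : t' ∈ heights K θ) (h : t < t') : lamR K θ t ≤ lamL K θ t' :=
  le_of_mul_le_mul_right ((hK.lamR_mul_le ht ht').trans (hK.le_lamL_mul ht ht' h))
    (sub_pos.2 h)

/-- If the envelope for `α` never moves backwards while some smaller section of the same direction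
has zero velocity, the chords between them have parallel opposite sides, with slope `σ`. -/
lemma IsBody.exists_parallel (hK : IsBody K) {α β θ : ℝ} (h0 : 0 < β) (hβα : β < α) (h1 : α < 1)
    (hv : 0 ≤ velRight K α θ ∧ 0 ≤ velLeft K α θ) (hz : θ ∈ zeroSet K β) :
    ∃ σ, (∀ y ∈ Icc (offset K β θ) (offset K α θ),
        lam K θ y ≤ lam K θ (offset K α θ) + σ * (y - offset K α θ)) ∧
      ∀ y, -y ∈ heights K (θ + Real.pi) →
        -lam K (θ + Real.pi) (-y) ≤
          -lam K (θ + Real.pi) (-offset K α θ) + σ * (y - offset K α θ) := by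
  have hα0 := h0.trans hβα
  have hβ1 := hβα.trans h1
  have hm := hK.offset_mem_heights hα0 h1 θ
  have hm' := hK.offset_mem_heights h0 hβ1 θ
  have hlt := hK.offset_lt_offset h0 h1 hβα θ
  have hh := hK.halfChord_pos hα0 h1 θ
  have hh' := hK.halfChord_pos h0 hβ1 θ
  rw [zeroSet, mem_ofPred_eq, velSegment, mem_uIcc] at hz
  rw [hK.velRight_eq hα0 h1, hK.velLeft_eq hα0 h1] at hv
  rw [hK.velRight_eq h0 hβ1, hK.velLeft_eq h0 hβ1] at hz
  set t := offset K α θ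
  set t' := offset K β θ
  have hmπ : -t ∈ heights K (θ + Real.pi) := heights_add_pi.2 hm
  have hmπ' : -t' ∈ heights K (θ + Real.pi) := heights_add_pi.2 hm'
  -- The inequalities `a1` to `a5` form a closed cycle, from `lamR K θ t` back to itself,
  -- alternating velocity signs and monotonicity of slopes. All these slopes are therefore equal.
  have a1 : lamR K θ t ≤ lamR K (θ + Real.pi) (-t) := by
    have := nonneg_of_mul_nonneg_right hv.2 (by linarith); linarith
  have a2 : lamR K (θ + Real.pi) (-t) ≤ lamL K (θ + Real.pi) (-t') :=
    hK.lamR_le_lamL hmπ hmπ' (by linarith)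
  have a3 : lamL K (θ + Real.pi) (-t') ≤ lamR K θ t' := by
    have b1 := hK.lamL_le_lamR hm'
    have b2 := hK.lamL_le_lamR hmπ'
    rcases hz with ⟨hz, _⟩ | ⟨hz, _⟩
    · have := nonpos_of_mul_nonpos_right hz (by linarith); linarith
    · have := nonpos_of_mul_nonpos_right hz (by linarith); linarith
  have a4 : lamR K θ t' ≤ lamL K θ t := hK.lamR_le_lamL hm' hm hlt
  have a5 := hK.lamL_le_lamR hm
  refine ⟨lamR K (θ + Real.pi) (-t), fun y hy => ?_, fun y hy => ?_⟩
  · have hym : y ∈ heights K θ := (hK.convex_heights θ).ordConnected.out hm' hm hy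
    rcases hy.2.eq_or_lt with rfl | hyt
    · simp
    have := hK.lamR_mul_le hym hm
    have b := hK.lamR_le_lamR hm' hym hy.1
    nlinarith
  · have := hK.lam_ge_lamR hmπ hy
    linarith

/-- For angles slightly larger than `θ`, both ends of the chord stay weakly behind two parallel
lines of slope `σ`, so the midpoint cannot advance across that direction; nonnegative velocity says
it cannot recede either. Its transverse component is constant and the velocity vanishes. -/
lemma IsBody.velRight_eq_zero_of_zeroSet (hK : IsBody K) {α β θ : ℝ} (h0 : 0 < β)
    (hβα : β < α) (h1 : α < 1) (hv : ∀ θ, 0 ≤ velRight K α θ ∧ 0 ≤ velLeft K α θ)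
    (hz : θ ∈ zeroSet K β) : ∃ ε > 0, ∀ φ ∈ Ico θ (θ + ε), velRight K α φ = 0 := by
  have hα0 := h0.trans hβα
  obtain ⟨σ, hσ1, hσ2⟩ := hK.exists_parallel h0 hβα h1 (hv θ) hz
  have hlt := hK.offset_lt_offset h0 h1 hβα θ
  have hmem := hK.offset_mem_heights hα0 h1 θ
  set t := offset K α θ
  set t' := offset K β θ
  have hYd := hK.hasDerivAt_chordStart_nor hα0 h1 θ
  have hY0 : inner ℝ (chordStart K α θ) (nor θ) = t := by rw [chordStart_eq, inner_pt_nor]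
  have hneg := (eventually_gt_of_hasDerivAt_neg hYd (by linarith [hK.halfChord_pos hα0 h1 θ])).1
  rw [hY0] at hneg
  have e2 : ∀ᶠ φ in 𝓝 θ, t' < inner ℝ (chordStart K α φ) (nor θ) :=
    hYd.continuousAt.eventually_const_lt (hlt.trans_eq hY0.symm)
  have e3 := hK.eventually_chordStart_dir hα0 h1 θ
  have hcEnd : Continuous (chordEnd K α) := by
    rw [funext (hK.chordEnd_eq_chordStart hα0 h1)]
    exact (hK.continuous_chordStart (by linarith) (by linarith)).comp
      (continuous_id.add continuous_const)
  have e4 : ∀ᶠ φ in 𝓝 θ, -inner ℝ (chordEnd K α φ) (nor θ) ∈ heights K (θ + Real.pi) := by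
    refine (hcEnd.inner continuous_const).neg.continuousAt.eventually
      ((isOpen_heights _).mem_nhds ?_)
    show -inner ℝ (chordEnd K α θ) (nor θ) ∈ _
    rw [chordEnd_eq, inner_pt_nor]
    exact heights_add_pi.2 hmem
  have e5 : ∀ᶠ φ in 𝓝 θ, 0 < Real.cos (φ - θ) - σ * Real.sin (φ - θ) :=
    (by fun_prop : Continuous fun φ => Real.cos (φ - θ) - σ * Real.sin (φ - θ)).continuousAt
      |>.eventually_const_lt (by simp)
  have hall := (hneg.and ((e2.and (e3.and (e4.and e5))).filter_mono nhdsWithin_le_nhds))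
  -- Here `ε` is the right end of an interval starting at `θ`; the length is `ε - θ`.
  obtain ⟨ε, hε, hall⟩ := (nhdsGT_basis θ).eventually_iff.1 hall
  -- A vector normal to both parallel sides.
  set w : Plane := dir θ - σ • nor θ with hw
  have hinw : ∀ x : Plane, inner ℝ x w = inner ℝ x (dir θ) - σ * inner ℝ x (nor θ) := fun x => by
    rw [hw, inner_sub_right, inner_smul_right]
  have hd := fun φ => hK.hasDerivWithinAt_inner_mid hα0 h1 w φ
  have hdw : ∀ φ, inner ℝ (dir φ) w = Real.cos (φ - θ) - σ * Real.sin (φ - θ) := fun φ => by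
    rw [hinw, inner_dir_dir, inner_dir_nor]
  have hwpos : ∀ φ ∈ Ico θ ε, 0 < inner ℝ (dir φ) w := by
    intro φ hφ
    rw [hdw]
    rcases hφ.1.eq_or_lt with rfl | h
    · simp
    · exact (hall ⟨h, hφ.2⟩).2.2.2.2
  have hc : Continuous fun s => (inner ℝ (mid K α s) w : ℝ) :=
    (hK.continuous_mid hα0 h1).inner continuous_const
  have hconst : ∀ φ ∈ Ico θ ε, inner ℝ (mid K α φ) w = inner ℝ (mid K α θ) w := by
    intro φ hφ
    refine le_antisymm ?_ (le_of_rightDeriv_nonneg hφ.1 hc (fun x _ => hd x) fun x hx =>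
      mul_nonneg (hv x).1 (hwpos x ⟨hx.1, hx.2.trans hφ.2⟩).le)
    rcases hφ.1.eq_or_lt with rfl | h
    · exact le_rfl
    obtain ⟨q1, q2, q3, q4, _⟩ := hall ⟨h, hφ.2⟩
    have r1 := hσ1 _ ⟨q2.le, le_of_lt q1⟩
    rw [← q3] at r1
    have hE : pt θ (inner ℝ (chordEnd K α φ) (nor θ)) (inner ℝ (chordEnd K α φ) (dir θ)) ∈ K := by
      rw [pt_inner, hK.chordEnd_eq_chordStart hα0 h1]
      exact hK.chordStart_mem (by linarith) (by linarith) _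
    have r2 := (hK.le_neg_lam hE).trans (hσ2 _ q4)
    have hm1 : mid K α φ = (1 / 2 : ℝ) • (chordStart K α φ + chordEnd K α φ) := by
      rw [mid, midpoint_eq_smul_add]; norm_num
    rw [hinw, hinw, inner_mid_nor, hm1, mid_eq, inner_pt_dir]
    simp only [inner_smul_left, inner_add_left, conj_trivial]
    linarith
  refine ⟨ε - θ, sub_pos.2 hε, fun φ hφ => ?_⟩
  rw [add_sub_cancel] at hφ
  have h3 : HasDerivWithinAt (fun s => (inner ℝ (mid K α s) w : ℝ)) 0 (Ici φ) φ := by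
    refine (hasDerivWithinAt_const φ (Ici φ) (inner ℝ (mid K α θ) w)).congr_of_eventuallyEq ?_
      (hconst φ hφ)
    have : Iio ε ∈ 𝓝 φ := Iio_mem_nhds hφ.2
    filter_upwards [nhdsWithin_le_nhds this, self_mem_nhdsWithin] with s hs hs'
    exact hconst s ⟨hφ.1.trans hs', hs⟩
  have h4 := (uniqueDiffWithinAt_Ici φ).eq_deriv _ (hd φ) h3
  rcases mul_eq_zero.1 h4 with h5 | h5
  · exact h5
  · exact absurd h5 (hwpos φ hφ).ne'

/-! ### Envelopes that are `C¹` curves -/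

/-- `S` coincides on the open set `U` with the graph of `f` in the frame of angle `φ`. -/
def IsChart (S : Set Plane) (φ : ℝ) (f : ℝ → ℝ) (U : Set Plane) : Prop :=
  S ∩ U = {x | inner ℝ x (nor φ) = f (inner ℝ x (dir φ))} ∩ U

lemma IsChart.eq_of_mem {S U : Set Plane} {φ : ℝ} {f : ℝ → ℝ} (h : IsChart S φ f U) {x : Plane}
    (hx : x ∈ S) (hU : x ∈ U) : inner ℝ x (nor φ) = f (inner ℝ x (dir φ)) :=
  (h.subset ⟨hx, hU⟩).1

lemma IsChart.eventually_mem {S U : Set Plane} {φ : ℝ} {f : ℝ → ℝ} (h : IsChart S φ f U)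
    (hf : Continuous f) (hU : IsOpen U) {p : Plane} (hp : p ∈ S) (hpU : p ∈ U) :
    ∀ᶠ X in 𝓝 (inner ℝ p (dir φ)), pt φ (f X) X ∈ S := by
  have hc : Continuous fun X => pt φ (f X) X :=
    (continuous_pt_prod φ).comp (g := fun z : ℝ × ℝ => pt φ z.2 z.1) (f := fun X => (X, f X))
      (by fun_prop)
  have hpe : pt φ (f (inner ℝ p (dir φ))) (inner ℝ p (dir φ)) = p := by
    rw [← h.eq_of_mem hp hpU, pt_inner]
  filter_upwards [hc.continuousAt.preimage_mem_nhds (hU.mem_nhds (by rwa [hpe]))] with X hX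
  exact (h.superset ⟨by simp, hX⟩).1

lemma not_isC1Curve_singleton (p : Plane) : ¬ IsC1Curve {p} := by
  intro h
  obtain ⟨φ, f, U, hf, hU, hpU, hch⟩ := h p rfl
  have hev := IsChart.eventually_mem hch hf.continuous hU rfl hpU
  have := (hev.filter_mono (nhdsWithin_le_nhds (s := {inner ℝ p (dir φ)}ᶜ))).and
    self_mem_nhdsWithin
  obtain ⟨X, hX, hne⟩ := this.exists
  apply hne
  have := congrArg (fun z => (inner ℝ z (dir φ) : ℝ)) (mem_singleton_iff.1 hX)
  simpa using this

section Tangent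

variable {α φ : ℝ} {f : ℝ → ℝ} {U : Set Plane}

/-- Differentiate the graph equation along `mid`: its right derivative is a multiple of `dir θ`, and
a nonzero velocity can be cancelled. What remains says that `dir θ` is tangent to the graph. -/
lemma IsBody.tangent_of_velRight_ne_zero (hK : IsBody K) (h0 : 0 < α) (h1 : α < 1)
    (hf : ContDiff ℝ 1 f) (hU : IsOpen U) (hch : IsChart (envelope K α) φ f U) {θ : ℝ}
    (hθ : mid K α θ ∈ U) (hv : velRight K α θ ≠ 0) :
    Real.sin (θ - φ) = deriv f (inner ℝ (mid K α θ) (dir φ)) * Real.cos (θ - φ) := by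
  have hc := hK.continuous_mid h0 h1
  have hev : ∀ᶠ s in 𝓝 θ, inner ℝ (mid K α s) (nor φ) = f (inner ℝ (mid K α s) (dir φ)) := by
    filter_upwards [hc.continuousAt.preimage_mem_nhds (hU.mem_nhds hθ)] with s hs
    exact hch.eq_of_mem ⟨s, rfl⟩ hs
  have d1 := hK.hasDerivWithinAt_inner_mid h0 h1 (nor φ) θ
  have d2 := hK.hasDerivWithinAt_inner_mid h0 h1 (dir φ) θ
  have hfd := (hf.differentiable (by norm_num) (inner ℝ (mid K α θ) (dir φ))).hasDerivAt
  have d3 := (hfd.comp_hasDerivWithinAt (h := fun s => (inner ℝ (mid K α s) (dir φ) : ℝ)) θ d2)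
  have d4 := d3.congr_of_eventuallyEq (hev.filter_mono nhdsWithin_le_nhds) hev.self_of_nhds
  have := (uniqueDiffWithinAt_Ici θ).eq_deriv _ d1 d4
  rw [inner_dir_nor, inner_dir_dir] at this
  refine mul_left_cancel₀ hv ?_
  linarith

lemma IsBody.tangent_of_mem_closure (hK : IsBody K) (h0 : 0 < α) (h1 : α < 1)
    (hf : ContDiff ℝ 1 f) (hU : IsOpen U) (hch : IsChart (envelope K α) φ f U) {θ : ℝ}
    (hθ : mid K α θ ∈ U) (hv : θ ∈ closure {θ | velRight K α θ ≠ 0}) :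
    Real.sin (θ - φ) = deriv f (inner ℝ (mid K α θ) (dir φ)) * Real.cos (θ - φ) := by
  have hc := hK.continuous_mid h0 h1
  have hcd : Continuous (deriv f) := hf.continuous_deriv (by norm_num)
  have hclosed : IsClosed {θ | Real.sin (θ - φ) =
      deriv f (inner ℝ (mid K α θ) (dir φ)) * Real.cos (θ - φ)} :=
    isClosed_eq (by fun_prop) (by fun_prop)
  have hmem : θ ∈ closure ({θ | velRight K α θ ≠ 0} ∩ mid K α ⁻¹' U) := by
    have := ((hU.preimage hc).inter_closure (s := mid K α ⁻¹' U)
      (t := {θ | velRight K α θ ≠ 0})) ⟨hθ, hv⟩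
    rwa [inter_comm] at this
  exact closure_minimal (fun s hs => hK.tangent_of_velRight_ne_zero h0 h1 hf hU hch hs.2 hs.1)
    hclosed hmem

end Tangent

/-- A graph has one tangent line at each point, so the directions `dir θ` and `dir θ'` are parallel.
-/
lemma IsBody.sin_sub_eq_zero_of_mid_eq (hK : IsBody K) {α : ℝ} (h0 : 0 < α) (h1 : α < 1)
    (hS : IsC1Curve (envelope K α)) {θ θ' : ℝ} (h : mid K α θ = mid K α θ')
    (hv : θ ∈ closure {θ | velRight K α θ ≠ 0}) (hv' : θ' ∈ closure {θ | velRight K α θ ≠ 0}) :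
    Real.sin (θ - θ') = 0 := by
  obtain ⟨φ, f, U, hf, hU, hpU, hch⟩ := hS (mid K α θ) ⟨θ, rfl⟩
  have e1 := hK.tangent_of_mem_closure h0 h1 hf hU hch hpU hv
  have e2 := hK.tangent_of_mem_closure h0 h1 hf hU hch (h ▸ hpU) hv'
  rw [← h] at e2
  have : θ - θ' = (θ - φ) - (θ' - φ) := by ring
  rw [this, Real.sin_sub, e1, e2]
  ring

lemma envelope_eq_singleton {α : ℝ} {p : Plane}
    (h : ∀ θ, mid K α θ = p) : envelope K α = {p} := by
  ext x
  constructor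
  · rintro ⟨θ, rfl⟩; exact h θ
  · rintro rfl; exact ⟨0, h 0⟩

lemma IsBody.velRight_periodic (hK : IsBody K) {α : ℝ} (h0 : 0 < α) (h1 : α < 1) :
    Function.Periodic (velRight K α) (2 * Real.pi) := fun θ => by
  have := hK.velRight_add_pi (α := 1 - α) (by linarith) (by linarith) (θ + Real.pi)
  rw [hK.velRight_add_pi h0 h1, sub_sub_cancel, neg_neg] at this
  rw [← this]; ring_nf

/-- If the envelope is a `C¹` curve, its parametrization is not constant on any interval. -/
lemma IsBody.dense_velRight_ne_zero (hK : IsBody K) {α : ℝ} (h0 : 0 < α) (h1 : α < 1)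
    (hS : IsC1Curve (envelope K α)) : Dense {θ | velRight K α θ ≠ 0} := by
  set N := {θ | velRight K α θ ≠ 0} with hN
  intro θ₀
  by_contra hθ₀
  have hex : ∃ θ, velRight K α θ ≠ 0 := by
    by_contra! hall
    have := envelope_eq_singleton (hK.mid_eq_zero_of_velRight h0 h1 hall)
    rw [this] at hS
    exact not_isC1Curve_singleton _ hS
  obtain ⟨θ, hθ⟩ := hex
  have hper := hK.velRight_periodic h0 h1
  obtain ⟨u, hu, hue⟩ := hper.exists_mem_Ico Real.two_pi_pos θ θ₀
  obtain ⟨d, hd, hde⟩ := hper.exists_mem_Ico Real.two_pi_pos θ (θ₀ - 2 * Real.pi)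
  rw [sub_add_cancel] at hd
  have hune : (N ∩ Ici θ₀).Nonempty := ⟨u, by rwa [hN, mem_ofPred_eq, ← hue], hu.1⟩
  have hdne : (N ∩ Iic θ₀).Nonempty := ⟨d, by rwa [hN, mem_ofPred_eq, ← hde], hd.2.le⟩
  have hub : BddBelow (N ∩ Ici θ₀) := ⟨θ₀, fun _ h => h.2⟩
  have hdb : BddAbove (N ∩ Iic θ₀) := ⟨θ₀, fun _ h => h.2⟩
  -- `θ₁` and `θ₂` bound the interval of zero velocity around `θ₀`; both are limits of parameters
  -- with nonzero velocity, so the tangent there is known.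
  set θ₂ := sInf (N ∩ Ici θ₀) with hθ₂
  set θ₁ := sSup (N ∩ Iic θ₀) with hθ₁
  have c2 : θ₂ ∈ closure N := closure_mono inter_subset_left (csInf_mem_closure hune hub)
  have c1 : θ₁ ∈ closure N := closure_mono inter_subset_left (csSup_mem_closure hdne hdb)
  have l2 : θ₀ ≤ θ₂ := le_csInf hune fun _ h => h.2
  have l1 : θ₁ ≤ θ₀ := csSup_le hdne fun _ h => h.2
  have l1' : θ₁ < θ₀ := lt_of_le_of_ne l1 fun h => hθ₀ (h ▸ c1)
  have hz : ∀ θ, θ₁ < θ → θ < θ₂ → velRight K α θ = 0 := by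
    intro θ h h'
    by_contra hne
    rcases le_total θ₀ θ with hc | hc
    · exact h'.not_ge (csInf_le hub ⟨hne, hc⟩)
    · exact h.not_ge (le_csSup hdb ⟨hne, hc⟩)
  have hconst : ∀ θ ∈ Ioc θ₁ θ₂, mid K α θ = mid K α θ₂ := fun θ hθ =>
    (hK.mid_eq_of_velRight_eq_zero h0 h1
      (fun s hs => hz s (hθ.1.trans_le hs.1) hs.2) θ₂ ⟨hθ.2, le_rfl⟩).symm
  have hcm := hK.continuous_mid h0 h1
  have hm1 : mid K α θ₁ = mid K α θ₂ := by
    have t1 : Tendsto (mid K α) (𝓝[>] θ₁) (𝓝 (mid K α θ₁)) :=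
      hcm.continuousAt.tendsto.mono_left nhdsWithin_le_nhds
    have t2 : Tendsto (mid K α) (𝓝[>] θ₁) (𝓝 (mid K α θ₂)) := by
      refine tendsto_const_nhds.congr' ?_
      filter_upwards [Ioc_mem_nhdsGT (l1'.trans_le l2)] with θ hθ
      exact (hconst θ hθ).symm
    exact tendsto_nhds_unique t1 t2
  have hconst' : ∀ θ ∈ Icc θ₁ θ₂, mid K α θ = mid K α θ₂ := by
    intro θ hθ
    rcases hθ.1.eq_or_lt with rfl | h
    · exact hm1
    · exact hconst θ ⟨h, hθ.2⟩
  have hsin := hK.sin_sub_eq_zero_of_mid_eq h0 h1 hS hm1.symm c2 c1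
  have hpi : Real.pi ≤ θ₂ - θ₁ := by
    by_contra! hlt
    exact (Real.sin_pos_of_pos_of_lt_pi (by linarith) hlt).ne' hsin
  -- The midpoint is constant over at least a half-turn, so two sections of opposite orientation are
  -- the same line. Then `mid` has period π, and the whole envelope is one point.
  have hhalf : α = 1 / 2 := by
    have e1 : offset K α (θ₁ + Real.pi) = -offset K α θ₁ := by
      rw [← inner_mid_nor, hconst' _ ⟨by linarith [Real.pi_pos], by linarith⟩, nor_add_pi,
        inner_neg_right, ← hm1, inner_mid_nor]
    rw [hK.offset_eq_iff h0 h1, hK.area_add_pi, hK.area_offset h0 h1] at e1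
    have hv := hK.volume_pos
    have : (1 - 2 * α) * volume.real K = 0 := by linarith
    rcases mul_eq_zero.1 this with h3 | h3 <;> linarith
  have hpp : Function.Periodic (mid K α) Real.pi := fun θ => by
    have := hK.mid_add_pi h0 h1 θ
    rwa [show 1 - α = α by rw [hhalf]; norm_num] at this
  have hsing := envelope_eq_singleton (p := mid K α θ₂) fun θ => by
    obtain ⟨y, hy, hye⟩ := hpp.exists_mem_Ico Real.pi_pos θ θ₁
    rw [hye]
    exact hconst' _ ⟨hy.1, by linarith [hy.2]⟩
  rw [hsing] at hS
  exact not_isC1Curve_singleton _ hS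

/-- The envelope fills a full neighbourhood in the graph, so a highest point along `nor θ` is a
critical point of the height on the graph: its tangent, parallel to `dir θ'`, is orthogonal to `nor
θ`. -/
lemma IsBody.sin_sub_eq_zero_of_isMax (hK : IsBody K) {α : ℝ} (h0 : 0 < α) (h1 : α < 1)
    (hS : IsC1Curve (envelope K α)) {θ θ' : ℝ}
    (hmax : ∀ s, inner ℝ (mid K α s) (nor θ) ≤ inner ℝ (mid K α θ') (nor θ)) :
    Real.sin (θ' - θ) = 0 := by
  obtain ⟨φ, f, U, hf, hU, hpU, hch⟩ := hS (mid K α θ') ⟨θ', rfl⟩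
  have ht := hK.tangent_of_mem_closure h0 h1 hf hU hch hpU (hK.dense_velRight_ne_zero h0 h1 hS θ')
  set x₀ : ℝ := inner ℝ (mid K α θ') (dir φ) with hx₀
  have hfd := (hf.differentiable (by norm_num) x₀).hasDerivAt
  have hpx : ∀ X, inner ℝ (pt φ (f X) X) (nor θ) =
      f X * Real.cos (φ - θ) + X * Real.sin (φ - θ) := fun X => by
    rw [pt, inner_add_left, inner_smul_left, inner_smul_left, inner_nor_nor, inner_dir_nor]; rfl
  have hloc : IsLocalMax (fun X => f X * Real.cos (φ - θ) + X * Real.sin (φ - θ)) x₀ := by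
    filter_upwards [IsChart.eventually_mem hch hf.continuous hU ⟨θ', rfl⟩ hpU] with X ⟨s, hs⟩
    rw [← hpx, ← hpx, ← hs]
    have : pt φ (f x₀) x₀ = mid K α θ' := by
      rw [hx₀, ← IsChart.eq_of_mem hch ⟨θ', rfl⟩ hpU, pt_inner]
    rw [this]
    exact hmax s
  have hz := hloc.hasDerivAt_eq_zero
    ((hfd.mul_const (Real.cos (φ - θ))).add ((hasDerivAt_id x₀).mul_const (Real.sin (φ - θ))))
  have e : θ' - θ = (θ' - φ) + (φ - θ) := by ring
  rw [e, Real.sin_add, ht]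
  linear_combination Real.cos (θ' - φ) * hz

lemma exists_isMax_of_periodic {f : ℝ → ℝ} (hc : Continuous f)
    (hp : ∀ θ, f (θ + 2 * Real.pi) = f θ) : ∃ θ₀, ∀ θ, f θ ≤ f θ₀ := by
  obtain ⟨θ₀, _, h⟩ := isCompact_Icc.exists_isMaxOn (nonempty_Icc.2 Real.two_pi_pos.le)
    hc.continuousOn (s := Icc 0 (2 * Real.pi))
  refine ⟨θ₀, fun θ => ?_⟩
  obtain ⟨φ, hφ, he⟩ := Function.Periodic.exists_mem_Ico₀ (f := f) hp Real.two_pi_pos θ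
  rw [he]
  exact h ⟨hφ.1, hφ.2.le⟩

lemma IsBody.mid_int_mul_pi (hK : IsBody K) {α : ℝ} (h0 : 0 < α) (h1 : α < 1) (θ : ℝ) (n : ℤ) :
    mid K α (θ + n * Real.pi) = mid K α θ ∨
      mid K α (θ + n * Real.pi) = mid K α (θ + Real.pi) := by
  have hper : Function.Periodic (mid K α) (2 * Real.pi) := hK.mid_periodic h0 h1
  rcases Int.even_or_odd' n with ⟨k, rfl | rfl⟩
  · left
    have := hper.int_mul k θ
    rw [← this]; push_cast; ring_nf
  · right
    have := hper.int_mul k (θ + Real.pi)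
    rw [← this]; push_cast; ring_nf

lemma IsBody.inner_mid_le_or (hK : IsBody K) {α : ℝ} (h0 : 0 < α) (h1 : α < 1)
    (hS : IsC1Curve (envelope K α)) (θ : ℝ) :
    (∀ s, inner ℝ (mid K α s) (nor θ) ≤ inner ℝ (mid K α θ) (nor θ)) ∨
      ∀ s, inner ℝ (mid K α s) (nor θ) ≤ inner ℝ (mid K α (θ + Real.pi)) (nor θ) := by
  obtain ⟨θ', hmax⟩ := exists_isMax_of_periodic
    (f := fun s => (inner ℝ (mid K α s) (nor θ) : ℝ))
    ((hK.continuous_mid h0 h1).inner continuous_const)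
    (fun s => by rw [hK.mid_periodic h0 h1])
  obtain ⟨n, hn⟩ := Real.sin_eq_zero_iff.1 (hK.sin_sub_eq_zero_of_isMax h0 h1 hS hmax)
  have : θ' = θ + n * Real.pi := by linarith
  rw [this] at hmax
  rcases hK.mid_int_mul_pi h0 h1 θ n with h | h <;> rw [h] at hmax
  · exact Or.inl hmax
  · exact Or.inr hmax

lemma IsBody.le_inner_mid_or (hK : IsBody K) {α : ℝ} (h0 : 0 < α) (h1 : α < 1)
    (hS : IsC1Curve (envelope K α)) (θ : ℝ) :
    (∀ s, inner ℝ (mid K α θ) (nor θ) ≤ inner ℝ (mid K α s) (nor θ)) ∨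
      ∀ s, inner ℝ (mid K α (θ + Real.pi)) (nor θ) ≤ inner ℝ (mid K α s) (nor θ) := by
  have h2 := hK.inner_mid_le_or h0 h1 hS (θ + Real.pi)
  have e : mid K α (θ + Real.pi + Real.pi) = mid K α θ := by
    rw [add_assoc, ← two_mul, hK.mid_periodic h0 h1]
  simp only [nor_add_pi, inner_neg_right, neg_le_neg_iff, e] at h2
  exact h2.symm

/-- The extremal heights along `nor θ` are attained at the parameters `θ` and `θ + π`. If the two
heights agreed for some `θ`, the height would be constant, contradicting density of nonzero
velocities. So their difference never vanishes, keeps its sign, and decides once and for all which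
parameter gives the minimum. -/
lemma IsBody.envelope_one_sided (hK : IsBody K) {α : ℝ} (h0 : 0 < α) (h1 : α < 1)
    (hS : IsC1Curve (envelope K α)) :
    (∀ θ s, inner ℝ (mid K α θ) (nor θ) ≤ inner ℝ (mid K α s) (nor θ)) ∨
      ∀ θ s, inner ℝ (mid K α s) (nor θ) ≤ inner ℝ (mid K α θ) (nor θ) := by
  have hcm := hK.continuous_mid h0 h1
  set F : ℝ → ℝ := fun θ => inner ℝ (mid K α θ) (nor θ) - inner ℝ (mid K α (θ + Real.pi)) (nor θ)
    with hF
  have hcF : Continuous F :=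
    (hcm.inner continuous_nor).sub
      ((hcm.comp (continuous_id.add continuous_const)).inner continuous_nor)
  have hne : ∀ θ, F θ ≠ 0 := by
    intro θ hθ
    have he : inner ℝ (mid K α θ) (nor θ) = inner ℝ (mid K α (θ + Real.pi)) (nor θ) :=
      sub_eq_zero.1 hθ
    have hmax : ∀ s, inner ℝ (mid K α s) (nor θ) ≤ inner ℝ (mid K α θ) (nor θ) := by
      rcases hK.inner_mid_le_or h0 h1 hS θ with h | h
      · exact h
      · exact fun s => (h s).trans_eq he.symm
    have hmin : ∀ s, inner ℝ (mid K α θ) (nor θ) ≤ inner ℝ (mid K α s) (nor θ) := by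
      rcases hK.le_inner_mid_or h0 h1 hS θ with h | h
      · exact h
      · exact fun s => he.trans_le (h s)
    have hconst : ∀ s, inner ℝ (mid K α s) (nor θ) = inner ℝ (mid K α θ) (nor θ) :=
      fun s => le_antisymm (hmax s) (hmin s)
    obtain ⟨s, hs, hsI⟩ := (hK.dense_velRight_ne_zero h0 h1 hS).exists_mem_open
      (isOpen_Ioo (a := θ) (b := θ + Real.pi)) (nonempty_Ioo.2 (by linarith [Real.pi_pos]))
    have d1 := hK.hasDerivWithinAt_inner_mid h0 h1 (nor θ) s
    rw [funext hconst] at d1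
    have := (uniqueDiffWithinAt_Ici s).eq_deriv _ d1 (hasDerivWithinAt_const s _ _)
    rw [inner_dir_nor] at this
    rcases mul_eq_zero.1 this with h | h
    · exact hs h
    · exact (Real.sin_pos_of_pos_of_lt_pi (by linarith [hsI.1]) (by linarith [hsI.2])).ne' h
  have hsign : (∀ θ, F θ < 0) ∨ ∀ θ, 0 < F θ := by
    by_contra! hcon
    obtain ⟨⟨a, ha⟩, ⟨b, hb⟩⟩ := hcon
    obtain ⟨c, hc⟩ := mem_range_of_exists_le_of_exists_ge hcF ⟨b, hb⟩ ⟨a, ha⟩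
    exact hne c hc
  rcases hsign with h | h
  · left
    intro θ
    rcases hK.le_inner_mid_or h0 h1 hS θ with h' | h'
    · exact h'
    · exact absurd (h' θ) (not_le.2 (sub_neg.1 (h θ)))
  · right
    intro θ
    rcases hK.inner_mid_le_or h0 h1 hS θ with h' | h'
    · exact h'
    · exact absurd (h' θ) (not_le.2 (sub_pos.1 (h θ)))

/-- One-sidedness gives nonnegative velocities for `α` or for `1 - α`. Both exceed `alphaZ K`, so in
either case a smaller parameter has a zero velocity, and rigidity contradicts density. -/
lemma IsBody.not_isC1Curve (hK : IsBody K) {α : ℝ} (hα : alphaZ K < α) (hα' : α < 1 - alphaZ K) :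
    ¬ IsC1Curve (envelope K α) := by
  intro hS
  have h0 : 0 < α := alphaZ_nonneg.trans_lt hα
  have h1 : α < 1 := by linarith [alphaZ_nonneg (K := K)]
  have hd := hK.dense_velRight_ne_zero h0 h1 hS
  rcases hK.envelope_one_sided h0 h1 hS with h | h
  · have hv := hK.vel_nonneg_of_le h0 h1 fun θ φ => by rw [← inner_mid_nor]; exact h φ θ
    obtain ⟨β, hβ0, _, hβα, θ, hθ⟩ := hK.exists_zeroSet_of_alphaZ_lt hα
    obtain ⟨ε, hε, hz⟩ := hK.velRight_eq_zero_of_zeroSet hβ0 hβα h1 hv hθ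
    obtain ⟨s, hs, hsI⟩ := hd.exists_mem_open (isOpen_Ioo (a := θ) (b := θ + ε))
      (nonempty_Ioo.2 (by linarith))
    exact hs (hz s ⟨hsI.1.le, hsI.2⟩)
  · have h0' : 0 < 1 - α := by linarith
    have h1' : 1 - α < 1 := by linarith
    have hm : ∀ θ, mid K (1 - α) θ = mid K α (θ - Real.pi) := fun θ => by
      rw [← hK.mid_add_pi h0 h1, sub_add_cancel]
    have hn : ∀ θ, nor θ = -nor (θ - Real.pi) := fun θ => by
      rw [← nor_add_pi, sub_add_cancel]
    have hv := hK.vel_nonneg_of_le h0' h1' fun θ φ => by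
      rw [← inner_mid_nor, hm, hm, hn φ, inner_neg_right, inner_neg_right, neg_le_neg_iff]
      exact h _ _
    obtain ⟨β, hβ0, _, hβα, θ, hθ⟩ := hK.exists_zeroSet_of_alphaZ_lt
      (show alphaZ K < 1 - α by linarith)
    obtain ⟨ε, hε, hz⟩ := hK.velRight_eq_zero_of_zeroSet hβ0 hβα h1' hv hθ
    obtain ⟨s, hs, hsI⟩ := hd.exists_mem_open
      (isOpen_Ioo (a := θ - Real.pi) (b := θ - Real.pi + ε)) (nonempty_Ioo.2 (by linarith))
    apply hs
    have := hK.velRight_add_pi h0 h1 s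
    rw [hz (s + Real.pi) ⟨by linarith [hsI.1], by linarith [hsI.2]⟩] at this
    linarith

/-! ### Winternitz's inequality on the line -/

section Winternitz

variable {J : Set ℝ} {h : ℝ → ℝ}

/-- This is the extremal density, that of a triangle with vertex at height `-d`: its barycenter is 0
and its negative half carries `(1 / 2) / (9 / 8) = 4 / 9` of the mass. -/
lemma integral_Ioc_linear (k d : ℝ) (hd : 0 < d) :
    (∫ y, (Ioc (-d) (d / 2)).indicator (fun y => k * (y + d)) y) = 9 / 8 * (k * d ^ 2) ∧
    (∫ y, y * (Ioc (-d) (d / 2)).indicator (fun y => k * (y + d)) y) = 0 ∧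
    (∫ y in Iio 0, (Ioc (-d) (d / 2)).indicator (fun y => k * (y + d)) y) = k * d ^ 2 / 2 := by
  refine ⟨?_, ?_, ?_⟩
  · rw [integral_indicator measurableSet_Ioc, ← intervalIntegral.integral_of_le (by linarith)]
    simp [integral_id]
    ring
  · have : (fun y => y * (Ioc (-d) (d / 2)).indicator (fun y => k * (y + d)) y) =
        (Ioc (-d) (d / 2)).indicator fun y => k * y ^ 2 + k * d * y := by
      funext y
      by_cases hy : y ∈ Ioc (-d) (d / 2)
      · rw [indicator_of_mem hy, indicator_of_mem hy]; ring
      · rw [indicator_of_notMem hy, indicator_of_notMem hy]; ring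
    rw [this, integral_indicator measurableSet_Ioc,
      ← intervalIntegral.integral_of_le (by linarith),
      intervalIntegral.integral_add (Continuous.intervalIntegrable (by fun_prop) _ _)
        (Continuous.intervalIntegrable (by fun_prop) _ _),
      intervalIntegral.integral_const_mul, intervalIntegral.integral_const_mul, integral_pow,
      integral_id]
    ring
  · have hset : Iio (0 : ℝ) ∩ Ioc (-d) (d / 2) = Ioo (-d) 0 := by
      ext y; simp only [mem_inter_iff, mem_Iio, mem_Ioc, mem_Ioo]
      constructor
      · rintro ⟨h1, h2, _⟩; exact ⟨h2, h1⟩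
      · rintro ⟨h1, h2⟩; exact ⟨h2, h1, by linarith⟩
    rw [setIntegral_indicator measurableSet_Ioc, hset, ← integral_Ioc_eq_integral_Ioo,
      ← intervalIntegral.integral_of_le (by linarith)]
    simp [integral_id]
    ring

lemma integrable_Ioc_linear (k d : ℝ) :
    Integrable ((Ioc (-d) (d / 2)).indicator fun y => k * (y + d)) := by
  rw [integrable_indicator_iff measurableSet_Ioc]
  exact (ContinuousOn.integrableOn_Icc (by fun_prop)).mono_set Ioc_subset_Icc_self

lemma integrable_mul_Ioc_linear (k d : ℝ) :
    Integrable fun y => y * (Ioc (-d) (d / 2)).indicator (fun y => k * (y + d)) y := by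
  have : (fun y => y * (Ioc (-d) (d / 2)).indicator (fun y => k * (y + d)) y) =
      (Ioc (-d) (d / 2)).indicator fun y => y * (k * (y + d)) := by
    funext y
    by_cases hy : y ∈ Ioc (-d) (d / 2)
    · rw [indicator_of_mem hy, indicator_of_mem hy]
    · rw [indicator_of_notMem hy, indicator_of_notMem hy, mul_zero]
  rw [this, integrable_indicator_iff measurableSet_Ioc]
  exact (ContinuousOn.integrableOn_Icc (by fun_prop)).mono_set Ioc_subset_Icc_self

lemma setIntegral_pos_of_pos_on_open {f : ℝ → ℝ} {U s : Set ℝ} (hs : MeasurableSet s)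
    (hf : IntegrableOn f s) (hnn : ∀ x ∈ s, 0 ≤ f x) (hU : IsOpen U) (hne : U.Nonempty)
    (hUs : U ⊆ s) (hpos : ∀ x ∈ U, 0 < f x) : 0 < ∫ x in s, f x := by
  rw [setIntegral_pos_iff_support_of_nonneg_ae ((ae_restrict_iff' hs).2 (Eventually.of_forall hnn))
    hf]
  exact (hU.measure_pos volume hne).trans_le
    (measure_mono fun x hx => ⟨(hpos x hx).ne', hUs hx⟩)

lemma zero_mem_of_integral_mul_eq_zero (hJo : IsOpen J) (hJc : Convex ℝ J) (hJne : J.Nonempty)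
    (hpos : ∀ y ∈ J, 0 < h y) (hzero : ∀ y ∉ J, h y = 0) (hint : Integrable fun y => y * h y)
    (hmom : ∫ y, y * h y = 0) : (0 : ℝ) ∈ J := by
  by_contra h0
  have hnn : ∀ y, 0 ≤ h y := fun y => by
    by_cases hy : y ∈ J
    · exact (hpos y hy).le
    · exact (hzero y hy).ge
  have hne : ∀ y ∈ J, y ≠ 0 := fun y hy h => h0 (h ▸ hy)
  obtain ⟨a, ha⟩ := hJne
  have hord := hJc.ordConnected
  rcases (hne a ha).lt_or_gt with hlt | hgt
  · have hneg : ∀ y ∈ J, y < 0 := fun y hy => by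
      by_contra! hc
      exact h0 (hord.out ha hy ⟨hlt.le, hc⟩)
    have := setIntegral_pos_of_pos_on_open (f := fun y => -(y * h y)) (s := univ) (U := J)
      MeasurableSet.univ hint.neg.integrableOn (fun y _ => by
        by_cases hy : y ∈ J
        · nlinarith [hneg y hy, hpos y hy]
        · simp [hzero y hy]) hJo ⟨a, ha⟩ (subset_univ _)
      (fun y hy => by nlinarith [hneg y hy, hpos y hy])
    rw [setIntegral_univ, integral_neg, hmom] at this
    simp at this
  · have hposy : ∀ y ∈ J, 0 < y := fun y hy => by
      by_contra! hc
      exact h0 (hord.out hy ha ⟨hc, hgt.le⟩)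
    have := setIntegral_pos_of_pos_on_open (f := fun y => y * h y) (s := univ) (U := J)
      MeasurableSet.univ hint.integrableOn (fun y _ => by
        by_cases hy : y ∈ J
        · exact (mul_pos (hposy y hy) (hpos y hy)).le
        · simp [hzero y hy]) hJo ⟨a, ha⟩ (subset_univ _)
      (fun y hy => mul_pos (hposy y hy) (hpos y hy))
    rw [setIntegral_univ, hmom] at this
    exact this.false

/-- The one-dimensional form of Winternitz's inequality: a concave density with barycenter `0` has
at least `4 / 9` of its mass on the negative half-line, and equality forces it to be linear and to
vanish at its left end. -/
theorem winternitz (hJo : IsOpen J) (hJb : BddBelow J) (hJne : J.Nonempty)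
    (hc : ConcaveOn ℝ J h) (hpos : ∀ y ∈ J, 0 < h y) (hzero : ∀ y ∉ J, h y = 0)
    (hi : Integrable h) (hint : Integrable fun y => y * h y) (hmom : ∫ y, y * h y = 0) :
    4 / 9 * ∫ y, h y ≤ ∫ y in Iio 0, h y ∧
    (4 / 9 * ∫ y, h y = ∫ y in Iio 0, h y → ∃ k d : ℝ, 0 < k ∧ 0 < d ∧ J = Ioo (-d) (d / 2) ∧
      ∀ y ∈ J, h y = k * (y + d)) := by
  have h0J := zero_mem_of_integral_mul_eq_zero hJo hc.1 hJne hpos hzero hint hmom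
  have hnn : ∀ y, 0 ≤ h y := fun y => by
    by_cases hy : y ∈ J
    · exact (hpos y hy).le
    · exact (hzero y hy).ge
  obtain ⟨e, he, heJ⟩ := Metric.isOpen_iff.1 hJo 0 h0J
  have hneg : (-(e / 2)) ∈ J := heJ (by
    rw [Metric.mem_ball, Real.dist_eq, sub_zero, abs_neg, abs_of_pos (by linarith)]; linarith)
  set M := ∫ y in Iio 0, h y with hM
  have hMpos : 0 < M := setIntegral_pos_of_pos_on_open measurableSet_Iio hi.integrableOn
    (fun y _ => hnn y) (hJo.inter isOpen_Iio) ⟨_, hneg, by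
      show -(e / 2) < 0
      linarith⟩ inter_subset_right
    (fun y hy => hpos y hy.1)
  have hh0 := hpos 0 h0J
  -- `d` and `k` are chosen so that the linear density takes the value `h 0` at 0 and has the same
  -- mass `M` as `h` on the negative half-line.
  set d := 2 * M / h 0 with hd
  have hdpos : 0 < d := by positivity
  set k := h 0 / d with hk
  have hkpos : 0 < k := by positivity
  have hkd : k * d = h 0 := by rw [hk]; field_simp
  have hkM : k * d ^ 2 / 2 = M := by
    rw [pow_two, ← mul_assoc, hkd, hd]; field_simp
  set ℓ : ℝ → ℝ := fun y => k * (y + d) with hℓ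
  set E : ℝ → ℝ := (Ioc (-d) (d / 2)).indicator ℓ with hE
  obtain ⟨I1, I2, I3⟩ := integral_Ioc_linear k d hdpos
  have hEi : Integrable E := integrable_Ioc_linear k d
  have hyEi : Integrable fun y => y * E y := integrable_mul_Ioc_linear k d
  have hEnn : ∀ y, 0 ≤ E y := fun y => indicator_nonneg (fun z hz =>
    mul_nonneg hkpos.le (by linarith [hz.1])) y
  set ψ : ℝ → ℝ := fun y => h y - E y with hψ
  have hψi : Integrable ψ := hi.sub hEi
  have hψ0 : ∫ y in Iio 0, ψ y = 0 := by
    rw [hψ, integral_sub hi.integrableOn hEi.integrableOn, ← hM]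
    rw [show (∫ y in Iio 0, E y) = k * d ^ 2 / 2 from I3, hkM, sub_self]
  have hℓ0 : ℓ 0 = h 0 := by simp [hℓ, hkd]
  have hcψ : ConcaveOn ℝ J fun y => h y - ℓ y := by
    refine hc.sub ⟨hc.1, fun x _ y _ a b _ _ hab => le_of_eq ?_⟩
    simp only [hℓ, smul_eq_mul]
    have : b = 1 - a := by linarith
    subst this; ring
  have hlow : ∀ y, y < 0 → (y ∈ J → h y < ℓ y) → ψ y ≤ 0 := by
    intro y hy hlt
    by_cases hyJ : y ∈ J
    · have h1 := hlt hyJ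
      have h2 : -d < y := by
        by_contra! hc'
        have : ℓ y ≤ 0 := mul_nonpos_of_nonneg_of_nonpos hkpos.le (by linarith)
        linarith [hpos y hyJ]
      have : E y = ℓ y := indicator_of_mem (show y ∈ Ioc (-d) (d / 2) from ⟨h2, by linarith⟩) _
      simp only [hψ, this]; linarith
    · simp only [hψ, hzero y hyJ]; linarith [hEnn y]
  -- the crossing point
  set A : Set ℝ := {y | y ∈ J ∧ y ≤ 0 ∧ ℓ y ≤ h y} with hA
  have hA0 : (0 : ℝ) ∈ A := ⟨h0J, le_rfl, hℓ0.le⟩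
  have hAb : BddBelow A := hJb.mono fun y hy => hy.1
  set z := sInf A with hz
  have hz0 : z ≤ 0 := csInf_le hAb hA0
  have hψlow : ∀ y, y < z → ψ y ≤ 0 := fun y hy => hlow y (hy.trans_le hz0) fun hyJ => by
    by_contra! hc'
    exact hy.not_ge (csInf_le hAb ⟨hyJ, (hy.trans_le hz0).le, hc'⟩)
  have hψhigh : ∀ y, z < y → y < 0 → 0 ≤ ψ y := by
    intro y hy hy0
    obtain ⟨y₁, hy₁, hlt⟩ := exists_lt_of_csInf_lt (show A.Nonempty from ⟨0, hA0⟩) hy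
    have hseg : y ∈ segment ℝ y₁ 0 := by
      rw [segment_eq_Icc hy₁.2.1]; exact ⟨hlt.le, hy0.le⟩
    have := hcψ.ge_on_segment hy₁.1 h0J hseg
    have h2 : 0 ≤ h y - ℓ y := le_trans (le_min (by linarith [hy₁.2.2]) (by linarith)) this
    by_cases hyd : y ∈ Ioc (-d) (d / 2)
    · have : E y = ℓ y := indicator_of_mem hyd _
      simp only [hψ, this]; exact h2
    · have : E y = 0 := indicator_of_notMem hyd _
      simp only [hψ, this]; linarith [hnn y]
  -- Otherwise `ψ` would be nonpositive on the negative half-line and negative on an open part of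
  -- it, against its zero integral there.
  obtain ⟨y₁, hy₁J, hy₁0, hy₁⟩ : ∃ y ∈ J, y < 0 ∧ ℓ y ≤ h y := by
    by_contra! hcon
    have := setIntegral_pos_of_pos_on_open (f := fun y => -ψ y) (s := Iio 0) (U := J ∩ Iio 0)
      measurableSet_Iio hψi.neg.integrableOn
      (fun y hy => by linarith [hlow y hy fun hyJ => hcon y hyJ hy])
      (hJo.inter isOpen_Iio) ⟨_, hneg, by
        show -(e / 2) < 0
        linarith⟩ inter_subset_right
      (fun y hy => by
        have h1 := hcon y hy.1 hy.2
        have h2 : -d < y := by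
          by_contra! hc'
          have : ℓ y ≤ 0 := mul_nonpos_of_nonneg_of_nonpos hkpos.le (by linarith)
          linarith [hpos y hy.1]
        have hy2 : y < 0 := hy.2
        have : E y = ℓ y := indicator_of_mem (show y ∈ Ioc (-d) (d / 2) from ⟨h2, by linarith⟩) _
        simp only [hψ, this]; linarith)
    rw [integral_neg, hψ0] at this
    simp at this
  -- The concave function `h - ℓ` is nonnegative at `y₁` and zero at 0, so it cannot become positive
  -- further right.
  have hup : ∀ y ∈ J, 0 < y → h y ≤ ℓ y := by
    intro y hyJ hy
    by_contra! hlt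
    have h1 : 0 < y - y₁ := by linarith
    have hcψ2 := hcψ.2
    have := @hcψ2 _ hy₁J _ hyJ (y / (y - y₁)) (-y₁ / (y - y₁))
      (by positivity) (div_nonneg (by linarith) h1.le) (by field_simp; ring)
    simp only [smul_eq_mul] at this
    rw [show y / (y - y₁) * y₁ + -y₁ / (y - y₁) * y = 0 by ring, hℓ0, sub_self] at this
    have p1 : 0 ≤ y / (y - y₁) * (h y₁ - ℓ y₁) := mul_nonneg (by positivity) (by linarith)
    have p2 : 0 < -y₁ / (y - y₁) * (h y - ℓ y) :=
      mul_pos (div_pos (by linarith) h1) (by linarith)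
    linarith
  have hψpos : ∀ y, 0 < y → (d / 2 - y) * ψ y ≤ 0 := by
    intro y hy
    by_cases hyd : y ≤ d / 2
    · refine mul_nonpos_of_nonneg_of_nonpos (by linarith) ?_
      have hEy : E y = ℓ y := indicator_of_mem
        (show y ∈ Ioc (-d) (d / 2) from ⟨by linarith, hyd⟩) _
      by_cases hyJ : y ∈ J
      · simp only [hψ, hEy]; linarith [hup y hyJ hy]
      · simp only [hψ, hzero y hyJ]; linarith [hEnn y]
    · have hEy : E y = 0 := indicator_of_notMem (fun h' => hyd h'.2) _
      refine mul_nonpos_of_nonpos_of_nonneg (by linarith) ?_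
      simp only [hψ, hEy]; linarith [hnn y]
  -- The subtracted term integrates to 0 and moves the sign change of the weight on the negative
  -- half-line to the crossing point `z`. The weight then has sign opposite to `ψ` on both sides,
  -- while the moment condition evaluates the integral of `Φ`.
  set Φ : ℝ → ℝ := fun y => (d / 2 - y) * ψ y - (Iio 0).indicator (fun y => (d / 2 - z) * ψ y) y
    with hΦ
  have hΦneg : ∀ y, y < 0 → Φ y = (z - y) * ψ y := fun y hy => by
    simp only [hΦ, indicator_of_mem (show y ∈ Iio 0 from hy)]; ring
  have hΦpos : ∀ y, 0 < y → Φ y = (d / 2 - y) * ψ y := fun y hy => by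
    simp only [hΦ, indicator_of_notMem (show y ∉ Iio 0 from not_lt.2 hy.le), sub_zero]
  have hΦle : ∀ y, y ≠ 0 → Φ y ≤ 0 := by
    intro y hy
    rcases hy.lt_or_gt with hy | hy
    · rw [hΦneg y hy]
      rcases lt_or_ge y z with h' | h'
      · exact mul_nonpos_of_nonneg_of_nonpos (by linarith) (hψlow y h')
      · rcases h'.eq_or_lt with h' | h'
        · rw [← h', sub_self, zero_mul]
        · exact mul_nonpos_of_nonpos_of_nonneg (by linarith) (hψhigh y h' hy)
    · rw [hΦpos y hy]; exact hψpos y hy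
  have hne0 : ∀ᵐ y : ℝ, y ≠ 0 := by simp [ae_iff]
  have hyψ : Integrable fun y => y * ψ y := by
    have : (fun y => y * ψ y) = fun y => y * h y - y * E y := by
      funext y; simp only [hψ]; ring
    rw [this]; exact hint.sub hyEi
  have hΦ1 : Integrable fun y => (d / 2 - y) * ψ y := by
    have : (fun y => (d / 2 - y) * ψ y) = fun y => d / 2 * ψ y - y * ψ y := by
      funext y; ring
    rw [this]; exact (hψi.const_mul _).sub hyψ
  have hΦ2 : Integrable ((Iio 0).indicator fun y => (d / 2 - z) * ψ y) :=
    (hψi.const_mul _).indicator measurableSet_Iio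
  have hΦi : Integrable Φ := hΦ1.sub hΦ2
  have hΦint : ∫ y, Φ y = d / 2 * ((∫ y, h y) - 9 / 4 * M) := by
    have e1 : ∫ y, (d / 2 - y) * ψ y = d / 2 * ((∫ y, h y) - 9 / 4 * M) := by
      have : (fun y => (d / 2 - y) * ψ y) = fun y => d / 2 * ψ y - (y * h y - y * E y) := by
        funext y; simp only [hψ]; ring
      rw [this, integral_sub (f := fun y => d / 2 * ψ y) (g := fun y => y * h y - y * E y)
        (hψi.const_mul _) (hint.sub hyEi), integral_const_mul,
        integral_sub hint hyEi, hmom, hψ, integral_sub hi hEi,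
        show (∫ y, E y) = 9 / 8 * (k * d ^ 2) from I1, show (∫ y, y * E y) = 0 from I2, ← hkM]
      ring
    have e2 : ∫ y, (Iio 0).indicator (fun y => (d / 2 - z) * ψ y) y = 0 := by
      rw [integral_indicator measurableSet_Iio, integral_const_mul, hψ0, mul_zero]
    rw [hΦ, integral_sub hΦ1 hΦ2, e1, e2, sub_zero]
  have hΦle' : ∀ᵐ y, Φ y ≤ 0 := hne0.mono hΦle
  constructor
  · have := integral_nonpos_of_ae (μ := volume) hΦle'
    rw [hΦint] at this
    have := nonpos_of_mul_nonpos_right this (by positivity)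
    linarith
  · intro heq
    have hzeroInt : ∫ y, -Φ y = 0 := by
      rw [integral_neg, hΦint, ← heq]; ring
    have hae : ∀ᵐ y, -Φ y = 0 :=
      (integral_eq_zero_iff_of_nonneg_ae (hΦle'.mono fun y hy => by simpa using hy)
        hΦi.neg).1 hzeroInt
    have hned : ∀ᵐ y : ℝ, y ≠ d / 2 := by simp [ae_iff]
    have hnez : ∀ᵐ y : ℝ, y ≠ z := by simp [ae_iff]
    have hψae : ∀ᵐ y, h y = E y := by
      filter_upwards [hae, hne0, hned, hnez] with y hy hy0 hyd hyz
      rw [neg_eq_zero] at hy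
      rw [← sub_eq_zero]
      rcases hy0.lt_or_gt with h' | h'
      · rw [hΦneg y h'] at hy
        exact (mul_eq_zero.1 hy).resolve_left (sub_ne_zero.2 hyz.symm)
      · rw [hΦpos y h'] at hy
        exact (mul_eq_zero.1 hy).resolve_left (sub_ne_zero.2 hyd.symm)
    -- Almost everywhere equality is tested on open sets to identify `J` exactly; continuity of the
    -- concave `h` on the open `J` then gives equality at every point.
    have hopen : ∀ U : Set ℝ, IsOpen U → U.Nonempty → ∃ y ∈ U, h y = E y := by
      intro U hU hne
      by_contra! hcon
      have : volume U = 0 := measure_mono_null (fun y hy => hcon y hy) (ae_iff.1 hψae)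
      exact (hU.measure_pos volume hne).ne' this
    have hJsub : J ⊆ Ioo (-d) (d / 2) := by
      have h1 : J ⊆ Icc (-d) (d / 2) := by
        intro y hy
        by_contra hny
        obtain ⟨x, ⟨hxJ, hx⟩, hxe⟩ := hopen (J ∩ (Icc (-d) (d / 2))ᶜ)
          (hJo.inter isClosed_Icc.isOpen_compl) ⟨y, hy, hny⟩
        rw [show E x = 0 from indicator_of_notMem (fun h' => hx (Ioc_subset_Icc_self h')) _] at hxe
        exact (hpos x hxJ).ne' hxe
      have := interior_mono h1
      rwa [hJo.interior_eq, interior_Icc] at this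
    have hJsup : Ioo (-d) (d / 2) ⊆ J := by
      have hpt : ∀ a b, -d ≤ a → a < b → b ≤ d / 2 → ∃ y ∈ Ioo a b, y ∈ J := by
        intro a b ha hab hb
        obtain ⟨y, hy, hye⟩ := hopen (Ioo a b) isOpen_Ioo (nonempty_Ioo.2 hab)
        refine ⟨y, hy, ?_⟩
        by_contra hyJ
        rw [hzero y hyJ, show E y = ℓ y from
          indicator_of_mem
            (show y ∈ Ioc (-d) (d / 2) from ⟨by linarith [hy.1], by linarith [hy.2]⟩) _] at hye
        have : 0 < ℓ y := mul_pos hkpos (by linarith [hy.1])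
        linarith
      intro y hy
      obtain ⟨a, ha, haJ⟩ := hpt (-d) y le_rfl hy.1 hy.2.le
      obtain ⟨b, hb, hbJ⟩ := hpt y (d / 2) hy.1.le hy.2 le_rfl
      exact hc.1.ordConnected.out haJ hbJ ⟨ha.2.le, hb.1.le⟩
    have hJeq := Subset.antisymm hJsub hJsup
    refine ⟨k, d, hkpos, hdpos, hJeq, ?_⟩
    have hEJ : ∀ y ∈ J, E y = ℓ y := fun y hy => indicator_of_mem
      (Ioo_subset_Ioc_self (hJsub hy)) _
    have := Measure.eqOn_open_of_ae_eq (μ := (volume : Measure ℝ)) (f := h) (g := ℓ) (U := J) ?_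
      hJo (hc.continuousOn hJo) (by fun_prop)
    · exact this
    · filter_upwards [ae_restrict_of_ae hψae, ae_restrict_mem hJo.measurableSet] with y hy hyJ
      rw [hy, hEJ y hyJ]

end Winternitz

/-! ### Chord lengths, centroid and Winternitz's theorem in the plane -/

/-- The length of the chord cut in the interior of `K` by the line `(θ, y)`. -/
def chordLen (K : Set Plane) (θ : ℝ) : ℝ → ℝ :=
  (heights K θ).indicator fun y => -lam K (θ + Real.pi) (-y) - lam K θ y

lemma IsBody.chordLen_pos (hK : IsBody K) {θ y : ℝ} (hy : y ∈ heights K θ) :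
    0 < chordLen K θ y := by
  rw [chordLen, indicator_of_mem hy]
  linarith [hK.lam_add_lt hy]

lemma chordLen_eq_zero {θ y : ℝ} (hy : y ∉ heights K θ) : chordLen K θ y = 0 :=
  indicator_of_notMem hy _

lemma IsBody.chordLen_nonneg (hK : IsBody K) (θ y : ℝ) : 0 ≤ chordLen K θ y := by
  by_cases hy : y ∈ heights K θ
  · exact (hK.chordLen_pos hy).le
  · exact (chordLen_eq_zero hy).ge

lemma IsBody.volume_slice_interior (hK : IsBody K) (θ y : ℝ) :
    volume {s | pt θ y s ∈ interior K} = ENNReal.ofReal (chordLen K θ y) := by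
  by_cases hy : y ∈ heights K θ
  · have : {s | pt θ y s ∈ interior K} = Ioo (lam K θ y) (-lam K (θ + Real.pi) (-y)) := by
      ext s
      exact ⟨fun hs => ⟨hK.lam_lt hs, hK.lt_neg_lam hs⟩, fun hs => hK.pt_mem_interior hy hs.1 hs.2⟩
    rw [this, Real.volume_Ioo, chordLen, indicator_of_mem hy]
  · have : {s | pt θ y s ∈ interior K} = ∅ := by
      ext s
      simp only [mem_ofPred_eq, mem_empty_iff_false, iff_false]
      exact fun hs => hy ⟨s, hs⟩
    rw [this, chordLen_eq_zero hy]; simp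

lemma measurable_chordLen (hK : IsBody K) (θ : ℝ) : Measurable (chordLen K θ) := by
  have hm : MeasurableSet ((fun z : ℝ × ℝ => pt θ z.2 z.1) ⁻¹' interior K) :=
    (isOpen_interior.preimage (continuous_pt_prod θ)).measurableSet
  have := (measurable_measure_prodMk_right (μ := (volume : Measure ℝ)) hm).ennreal_toReal
  convert this using 1
  funext y
  have h2 := hK.volume_slice_interior θ y
  show _ = (volume {s | pt θ y s ∈ interior K}).toReal
  rw [h2, ENNReal.toReal_ofReal (hK.chordLen_nonneg θ y)]

lemma IsBody.volume_inter_preimage (hK : IsBody K) (θ : ℝ) {B : Set ℝ} (hB : MeasurableSet B) :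
    volume (K ∩ {x | inner ℝ x (nor θ) ∈ B}) = ∫⁻ y in B, ENNReal.ofReal (chordLen K θ y) := by
  have hcn : Continuous fun x : Plane => (inner ℝ x (nor θ) : ℝ) := by fun_prop
  have hBm : MeasurableSet {x : Plane | inner ℝ x (nor θ) ∈ B} := hcn.measurable hB
  have h1 : volume (K ∩ {x | inner ℝ x (nor θ) ∈ B}) =
      volume (interior K ∩ {x | inner ℝ x (nor θ) ∈ B}) :=
    measure_congr ((interior_ae_eq_of_null_frontier
      (hK.convex.addHaar_frontier volume)).symm.inter (ae_eq_refl _))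
  have hm : MeasurableSet (interior K ∩ {x : Plane | inner ℝ x (nor θ) ∈ B}) :=
    isOpen_interior.measurableSet.inter hBm
  have hm' := (continuous_pt_prod θ).measurable hm
  rw [h1, ← (measurePreserving_pt θ).measure_preimage hm.nullMeasurableSet,
    Measure.volume_eq_prod, Measure.prod_apply_symm hm', ← lintegral_indicator hB]
  refine lintegral_congr fun y => ?_
  by_cases hy : y ∈ B
  · rw [indicator_of_mem hy, ← hK.volume_slice_interior]
    congr 1
    ext s
    simp [hy]
  · rw [indicator_of_notMem hy]
    convert measure_empty (μ := (volume : Measure ℝ))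
    ext s
    simp [hy]

/-- By Fubini, the height of a point of `K` is distributed with density the chord length, so areas
and moments become one-dimensional integrals. -/
lemma IsBody.map_inner_nor (hK : IsBody K) (θ : ℝ) :
    (volume.restrict K).map (fun x => (inner ℝ x (nor θ) : ℝ)) =
      volume.withDensity fun y => ENNReal.ofReal (chordLen K θ y) := by
  have hcn : Continuous fun x : Plane => (inner ℝ x (nor θ) : ℝ) := by fun_prop
  ext B hB
  rw [Measure.map_apply hcn.measurable hB, withDensity_apply _ hB,
    Measure.restrict_apply (hcn.measurable hB), ← hK.volume_inter_preimage θ hB, inter_comm]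
  rfl

lemma IsBody.setIntegral_inner_nor (hK : IsBody K) (θ : ℝ) {φ : ℝ → ℝ} (hφ : Measurable φ) :
    ∫ x in K, φ (inner ℝ x (nor θ)) = ∫ y, φ y * chordLen K θ y := by
  have hcn : Continuous fun x : Plane => (inner ℝ x (nor θ) : ℝ) := by fun_prop
  rw [← integral_map (φ := fun x : Plane => (inner ℝ x (nor θ) : ℝ))
    hcn.measurable.aemeasurable hφ.aestronglyMeasurable, hK.map_inner_nor,
    integral_withDensity_eq_integral_toReal_smul
      (measurable_chordLen hK θ).ennreal_ofReal (by simp)]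
  refine integral_congr_ae (Eventually.of_forall fun y => ?_)
  simp only [ENNReal.toReal_ofReal (hK.chordLen_nonneg θ y), smul_eq_mul, mul_comm]

lemma IsBody.integrable_chordLen (hK : IsBody K) (θ : ℝ) : Integrable (chordLen K θ) := by
  refine ⟨(measurable_chordLen hK θ).aestronglyMeasurable, ?_⟩
  rw [hasFiniteIntegral_iff_ofReal (Eventually.of_forall (hK.chordLen_nonneg θ)),
    ← setLIntegral_univ, ← hK.volume_inter_preimage θ MeasurableSet.univ]
  exact (measure_mono inter_subset_left).trans_lt hK.compact.measure_lt_top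

lemma IsBody.integral_chordLen (hK : IsBody K) (θ : ℝ) :
    ∫ y, chordLen K θ y = volume.real K := by
  have := hK.setIntegral_inner_nor θ (φ := fun _ => 1) measurable_const
  simpa using this.symm

lemma IsBody.area_eq_setIntegral (hK : IsBody K) (θ t : ℝ) :
    area K θ t = ∫ y in Iio t, chordLen K θ y := by
  rw [← integral_Iic_eq_integral_Iio, integral_eq_lintegral_of_nonneg_ae
    (Eventually.of_forall (hK.chordLen_nonneg θ))
    (measurable_chordLen hK θ).aestronglyMeasurable, ← hK.volume_inter_preimage θ measurableSet_Iic]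
  rfl

lemma IsBody.heights_subset_Icc (hK : IsBody K) : ∃ M, ∀ θ, heights K θ ⊆ Icc (-M) M := by
  obtain ⟨M, hM, hb⟩ := hK.exists_bound
  refine ⟨M, fun θ y ⟨s, hs⟩ => ?_⟩
  have := abs_inner_nor_le (pt θ y s) θ
  rw [inner_pt_nor] at this
  exact abs_le.1 (this.trans (hb _ (interior_subset hs)).le)

lemma IsBody.concaveOn_chordLen (hK : IsBody K) (θ : ℝ) :
    ConcaveOn ℝ (heights K θ) (chordLen K θ) := by
  refine ⟨hK.convex_heights θ, fun x hx y hy a b ha hb hab => ?_⟩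
  have h1 := (hK.convexOn_lam θ).2 hx hy ha hb hab
  have h2 := (hK.convexOn_lam (θ + Real.pi)).2 (heights_add_pi.2 hx) (heights_add_pi.2 hy) ha hb hab
  rw [chordLen, indicator_of_mem hx, indicator_of_mem hy,
    indicator_of_mem (hK.convex_heights θ hx hy ha hb hab)]
  simp only [smul_eq_mul] at *
  rw [show a * -x + b * -y = -(a * x + b * y) by ring] at h2
  linarith

/-- The center of mass of `K`. -/
def centroid (K : Set Plane) : Plane := (volume.real K)⁻¹ • ∫ x in K, x

lemma IsBody.integrableOn_id (hK : IsBody K) : IntegrableOn (fun x : Plane => x) K :=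
  continuousOn_id.integrableOn_compact hK.compact

lemma IsBody.setIntegral_inner (hK : IsBody K) (w : Plane) :
    ∫ x in K, (inner ℝ x w : ℝ) = volume.real K * inner ℝ (centroid K) w := by
  rw [centroid, inner_smul_left, conj_trivial, ← mul_assoc, mul_inv_cancel₀ hK.volume_pos.ne',
    one_mul, real_inner_comm, ← integral_inner hK.integrableOn_id w]
  simp only [real_inner_comm]

/-- Winternitz's theorem: a half-plane whose boundary contains the center of mass of `K` contains
at least `4 / 9` of its area. -/
lemma IsBody.winternitz_centroid (hK : IsBody K) (θ : ℝ) :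
    4 / 9 * volume.real K ≤ area K θ (inner ℝ (centroid K) (nor θ)) ∧
    (4 / 9 * volume.real K = area K θ (inner ℝ (centroid K) (nor θ)) →
      ∃ k y₀ y₁ : ℝ, 0 < k ∧ y₀ < y₁ ∧ heights K θ = Ioo y₀ y₁ ∧
        ∀ y ∈ Ioo y₀ y₁, chordLen K θ y = k * (y - y₀)) := by
  set g : ℝ := inner ℝ (centroid K) (nor θ) with hg
  obtain ⟨M, hM⟩ := hK.heights_subset_Icc
  obtain ⟨x₀, hx₀⟩ := hK.nonempty_interior
  have hmem : ∀ y, y ∈ (fun z => g + z) ⁻¹' heights K θ ↔ y + g ∈ heights K θ := fun y => by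
    rw [mem_preimage, add_comm]
  have hi := hK.integrable_chordLen θ
  have hyi : Integrable fun y => y * chordLen K θ y := by
    refine (hi.const_mul M).mono' ((measurable_id.mul
      (measurable_chordLen hK θ)).aestronglyMeasurable) (Eventually.of_forall fun y => ?_)
    by_cases hy : y ∈ heights K θ
    · rw [norm_mul, Real.norm_of_nonneg (hK.chordLen_nonneg θ y)]
      exact mul_le_mul_of_nonneg_right (abs_le.2 (hM θ hy)) (hK.chordLen_nonneg θ y)
    · simp [chordLen_eq_zero hy]
  have hgi : Integrable fun y => (y - g) * chordLen K θ y := by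
    simp only [sub_mul]; exact hyi.sub (hi.const_mul g)
  have hmom : ∫ y, (y - g) * chordLen K θ y = 0 := by
    rw [← hK.setIntegral_inner_nor θ (φ := fun y => y - g) (by fun_prop), integral_sub,
      hK.setIntegral_inner, ← hg]
    · simp
    · exact ContinuousOn.integrableOn_compact hK.compact (by fun_prop)
    · exact integrableOn_const hK.volume_ne_top
  have hmom' : ∫ y, y * chordLen K θ (y + g) = 0 := by
    rw [← hmom, ← integral_add_right_eq_self (fun y => (y - g) * chordLen K θ y) g]
    simp
  have hyi' : Integrable fun y => y * chordLen K θ (y + g) := by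
    have := hgi.comp_add_right g
    simpa using this
  have hhalf : ∫ y in Iio 0, chordLen K θ (y + g) = area K θ g := by
    rw [hK.area_eq_setIntegral, ← integral_indicator measurableSet_Iio,
      ← integral_indicator measurableSet_Iio,
      ← integral_add_right_eq_self ((Iio g).indicator (chordLen K θ)) g]
    congr 1; funext y
    by_cases hy : y < 0
    · rw [indicator_of_mem (show y ∈ Iio 0 from hy),
        indicator_of_mem (show y + g ∈ Iio g from by simpa using hy)]
    · rw [indicator_of_notMem (show y ∉ Iio 0 from hy),
        indicator_of_notMem (show y + g ∉ Iio g from by simpa using hy)]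
  have hW := winternitz (J := (fun z => g + z) ⁻¹' heights K θ)
    (h := fun y => chordLen K θ (y + g))
    ((isOpen_heights θ).preimage (by fun_prop))
    ⟨-M - g, fun y hy => by
      have := (hM θ hy).1
      simp only at this; linarith⟩
    ⟨inner ℝ x₀ (nor θ) - g, by
      rw [mem_preimage, add_sub_cancel]; exact mem_heights hx₀⟩
    ((hK.concaveOn_chordLen θ).translate_left g)
    (fun y hy => hK.chordLen_pos ((hmem y).1 hy))
    (fun y hy => chordLen_eq_zero fun h => hy ((hmem y).2 h))
    (hi.comp_add_right g) hyi' hmom'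
  rw [integral_add_right_eq_self (chordLen K θ) g, hK.integral_chordLen, hhalf] at hW
  refine ⟨hW.1, fun heq => ?_⟩
  obtain ⟨k, d, hk, hd, hJ, hh⟩ := hW.2 heq
  have hheights : heights K θ = Ioo (g - d) (g + d / 2) := by
    ext y
    have h1 : y ∈ heights K θ ↔ y - g ∈ (fun z => g + z) ⁻¹' heights K θ := by
      rw [hmem, sub_add_cancel]
    rw [h1, hJ]
    constructor
    · rintro ⟨a, b⟩; constructor <;> linarith
    · rintro ⟨a, b⟩; constructor <;> linarith
  refine ⟨k, g - d, g + d / 2, hk, by linarith, hheights, fun y hy => ?_⟩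
  rw [← hheights] at hy
  have := hh (y - g) ((hmem _).2 (by rwa [sub_add_cancel]))
  rw [sub_add_cancel] at this
  rw [this]; ring

/-! ### The equality case and triangles -/

lemma isTriangle_of_interior_nonempty (p : Fin 3 → Plane)
    (h : (interior (convexHull ℝ (range p))).Nonempty) :
    IsTriangle (convexHull ℝ (range p)) := by
  have htop : affineSpan ℝ (range p) = ⊤ := interior_convexHull_nonempty_iff_affineSpan_eq_top.1 h
  have hind : AffineIndependent ℝ p := by
    rw [affineIndependent_iff_finrank_vectorSpan_eq ℝ p (n := 2) (by simp),
      ← direction_affineSpan, htop, AffineSubspace.direction_top, finrank_top]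
    simp
  exact ⟨⟨p, hind⟩, rfl⟩

/-- A convex body whose chords of direction `u(θ)` have a length which is affine and vanishes at
one end is a triangle. -/
lemma IsBody.isTriangle_of_chordLen (hK : IsBody K) {θ k y₀ y₁ : ℝ} (hk : 0 < k) (hy : y₀ < y₁)
    (hJ : heights K θ = Ioo y₀ y₁)
    (hlen : ∀ y ∈ Ioo y₀ y₁, chordLen K θ y = k * (y - y₀)) : IsTriangle K := by
  set t := (y₀ + y₁) / 2 with ht
  have htJ : t ∈ heights K θ := by rw [hJ]; constructor <;> linarith
  have htJ' : -t ∈ heights K (θ + Real.pi) := heights_add_pi.2 htJ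
  set q := lamR K θ t with hq
  set q' := lamR K (θ + Real.pi) (-t) with hq'
  have hsum : ∀ y ∈ Ioo y₀ y₁, -lam K (θ + Real.pi) (-y) - lam K θ y = k * (y - y₀) := by
    intro y hy'
    rw [← hlen y hy', chordLen, indicator_of_mem (by rwa [hJ])]
  have hX : ∀ y ∈ Ioo y₀ y₁, lam K θ t + q * (y - t) ≤ lam K θ y := fun y hy' =>
    hK.lam_ge_lamR htJ (by rwa [hJ])
  have hY : ∀ y ∈ Ioo y₀ y₁, lam K (θ + Real.pi) (-t) + q' * (t - y) ≤
      lam K (θ + Real.pi) (-y) := fun y hy' => by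
    have := hK.lam_ge_lamR htJ' (y := -y) (heights_add_pi.2 (by rwa [hJ]))
    rw [show -y - -t = t - y by ring] at this
    exact this
  have htI : t ∈ Ioo y₀ y₁ := by rwa [← hJ]
  have hst := hsum t htI
  -- Supporting lines at height `t` bound the chord length above by an affine function equal to it
  -- at `t`. As the length is itself affine, the bound is an equality, and both boundary functions
  -- are affine.
  have hle : ∀ y ∈ Ioo y₀ y₁, 0 ≤ (q' - q - k) * (y - t) := fun y hy' => by
    have := hX y hy'; have := hY y hy'; have := hsum y hy'
    linarith
  have hslope : q' - q = k := by
    have h1 := hle ((t + y₁) / 2) ⟨by linarith, by linarith⟩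
    have h2 := hle ((y₀ + t) / 2) ⟨by linarith, by linarith⟩
    rw [show (t + y₁) / 2 - t = (y₁ - y₀) / 4 by rw [ht]; ring] at h1
    rw [show (y₀ + t) / 2 - t = -((y₁ - y₀) / 4) by rw [ht]; ring] at h2
    have h3 : (q' - q - k) * ((y₁ - y₀) / 4) = 0 := by linarith
    rcases mul_eq_zero.1 h3 with h | h <;> linarith
  -- the two sides
  set l : ℝ → ℝ := fun y => lam K θ t + q * (y - t) with hl
  set r : ℝ → ℝ := fun y => l y + k * (y - y₀) with hr
  have hlam : ∀ y ∈ Ioo y₀ y₁, lam K θ y = l y := fun y hy' => by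
    have h1 := hX y hy'; have h2 := hY y hy'; have h3 := hsum y hy'
    have h4 : q' = q + k := by linarith
    rw [h4] at h2
    simp only [hl]
    linarith
  have hlamr : ∀ y ∈ Ioo y₀ y₁, -lam K (θ + Real.pi) (-y) = r y := fun y hy' => by
    have h3 := hsum y hy'
    rw [hlam y hy'] at h3
    simp only [hr]; linarith
  have hclosed : ∀ f : ℝ → ℝ, Continuous f → (∀ y ∈ Ioo y₀ y₁, pt θ y (f y) ∈ K) →
      ∀ y ∈ Icc y₀ y₁, pt θ y (f y) ∈ K := by
    intro f hf hfK y hy'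
    have hcl : IsClosed {y | pt θ y (f y) ∈ K} :=
      hK.compact.isClosed.preimage ((continuous_pt_prod θ).comp
        (g := fun z : ℝ × ℝ => pt θ z.2 z.1) (f := fun y => (f y, y)) (by fun_prop))
    rw [← closure_Ioo hy.ne] at hy'
    exact closure_minimal hfK hcl hy'
  have hlK : ∀ y ∈ Icc y₀ y₁, pt θ y (l y) ∈ K := hclosed l (by fun_prop) fun y hy' => by
    rw [← hlam y hy']
    obtain ⟨s, hs⟩ : y ∈ heights K θ := by rwa [hJ]
    exact hK.lam_mem (interior_subset hs)
  have hrK : ∀ y ∈ Icc y₀ y₁, pt θ y (r y) ∈ K := hclosed r (by fun_prop) fun y hy' => by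
    rw [← hlamr y hy']
    obtain ⟨s, hs⟩ : y ∈ heights K θ := by rwa [hJ]
    exact hK.neg_lam_mem (interior_subset hs)
  set p : Fin 3 → Plane := ![pt θ y₀ (l y₀), pt θ y₁ (l y₁), pt θ y₁ (r y₁)] with hp
  have hpK : range p ⊆ K := by
    rintro _ ⟨i, rfl⟩
    fin_cases i
    · exact hlK y₀ ⟨le_rfl, hy.le⟩
    · exact hlK y₁ ⟨hy.le, le_rfl⟩
    · exact hrK y₁ ⟨hy.le, le_rfl⟩
  have hint : interior K ⊆ convexHull ℝ (range p) := by
    intro x hx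
    set y : ℝ := inner ℝ x (nor θ) with hyx
    set s : ℝ := inner ℝ x (dir θ) with hsx
    have hxe : pt θ y s = x := pt_inner θ x
    have hyJ : y ∈ Ioo y₀ y₁ := by rw [← hJ]; exact mem_heights hx
    have h1 : l y < s := by rw [← hlam y hyJ]; exact hK.lam_lt (by rwa [hxe])
    have h2 : s < r y := by rw [← hlamr y hyJ]; exact hK.lt_neg_lam (by rwa [hxe])
    have hD : 0 < y₁ - y₀ := by linarith
    have hyy : 0 < y - y₀ := by linarith [hyJ.1]
    -- `w` is the weight of the apex and `c` the relative position of `x` on its chord: `x` lies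
    -- between the apex and the point at ratio `c` of the base.
    set w := (y₁ - y) / (y₁ - y₀) with hw
    set c := (s - l y) / (k * (y - y₀)) with hc
    have hw0 : 0 ≤ w := div_nonneg (by linarith [hyJ.2]) hD.le
    have hw1 : 1 - w = (y - y₀) / (y₁ - y₀) := by rw [hw]; field_simp; ring
    have hw1' : 0 ≤ 1 - w := by rw [hw1]; positivity
    have hc0 : 0 ≤ c := div_nonneg (by linarith) (by positivity)
    have hc1 : c ≤ 1 := by
      rw [hc, div_le_one (by positivity)]
      simp only [hr] at h2; linarith
    have hwy : w * (y₁ - y₀) = y₁ - y := by rw [hw]; field_simp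
    have hcy : c * (k * (y - y₀)) = s - l y := by rw [hc]; field_simp
    have hconv := convex_convexHull ℝ (range p)
    have hv : ∀ i, p i ∈ convexHull ℝ (range p) := fun i => subset_convexHull ℝ _ ⟨i, rfl⟩
    have hbase : pt θ y₁ (l y₁ + c * (k * (y₁ - y₀))) ∈ convexHull ℝ (range p) := by
      have := hconv (hv 1) (hv 2) (sub_nonneg.2 hc1) hc0 (by ring)
      have e : (1 - c) • p 1 + c • p 2 = pt θ y₁ (l y₁ + c * (k * (y₁ - y₀))) := by
        show (1 - c) • pt θ y₁ (l y₁) + c • pt θ y₁ (r y₁) = _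
        rw [pt_lineMap]
        congr 1
        · ring
        · simp only [hr]; ring
      rwa [e] at this
    have hfin := hconv (hv 0) hbase hw0 hw1' (by ring)
    have e : w • p 0 + (1 - w) • pt θ y₁ (l y₁ + c * (k * (y₁ - y₀))) = x := by
      rw [← hxe]
      show w • pt θ y₀ (l y₀) + _ = _
      rw [pt_lineMap]
      have hye : w * y₀ + (1 - w) * y₁ = y := by linarith
      congr 1
      have hle : w * l y₀ + (1 - w) * l y₁ = l y := by
        simp only [hl]
        linear_combination q * hye
      have h6 : (1 - w) * (y₁ - y₀) = y - y₀ := by linarith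
      linear_combination hle + hcy + c * k * h6
    rwa [e] at hfin
  have hcl : IsClosed (convexHull ℝ (range p)) :=
    ((finite_range p).isCompact_convexHull ℝ).isClosed
  have heq : K = convexHull ℝ (range p) := by
    apply Subset.antisymm
    · have h1 := hK.convex.closure_interior_eq_closure_of_nonempty_interior hK.nonempty_interior
      have h2 : K ⊆ closure (interior K) := by rw [h1]; exact subset_closure
      exact h2.trans (closure_minimal hint hcl)
    · exact convexHull_min hpK hK.convex
  rw [heq]
  refine isTriangle_of_interior_nonempty p ?_
  rw [← heq]; exact hK.nonempty_interior

lemma IsBody.centroid_mem_core (hK : IsBody K) : centroid K ∈ core K (4 / 9) :=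
  (hK.mem_core_iff_area (by norm_num) (by norm_num)).2 fun θ => (hK.winternitz_centroid θ).1

lemma IsBody.four_ninths_le_alphaK (hK : IsBody K) : 4 / 9 ≤ alphaK K :=
  le_alphaK (by norm_num) (by norm_num) ⟨_, hK.centroid_mem_core⟩

/-- If Winternitz's inequality were strict in every direction, the centroid would belong to the core
of some parameter larger than `4 / 9`. So equality holds in some direction. -/
lemma IsBody.isTriangle_of_alphaK (hK : IsBody K) (h : alphaK K = 4 / 9) : IsTriangle K := by
  have hex : ∃ θ, 4 / 9 * volume.real K = area K θ (inner ℝ (centroid K) (nor θ)) := by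
    by_contra! hne
    obtain ⟨β, hβ, hβ1, hz⟩ := hK.exists_mem_core_of_lt (α := 4 / 9) (z := centroid K)
      (by norm_num) (by norm_num) fun θ => by
        rw [← not_le, hK.le_offset_iff (by norm_num) (by norm_num), not_le]
        exact lt_of_le_of_ne (hK.winternitz_centroid θ).1 (hne θ)
    have := le_alphaK (by linarith) hβ1 ⟨_, hz⟩
    linarith
  obtain ⟨θ, hθ⟩ := hex
  obtain ⟨k, y₀, y₁, hk, hy, hJ, hlen⟩ := (hK.winternitz_centroid θ).2 hθ
  exact hK.isTriangle_of_chordLen hk hy hJ hlen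

/-- A point has some barycentric coordinate at least `1 / 3`. The parallel through it to the
opposite side cuts off, at the corresponding vertex, a part contained in the homothetic copy of
ratio `2 / 3`. -/
lemma IsBody.alphaK_le_of_isTriangle (hK : IsBody K) (h : IsTriangle K) : alphaK K ≤ 4 / 9 := by
  obtain ⟨T, hT⟩ := h
  have htop : affineSpan ℝ (range T.points) = ⊤ :=
    T.independent.affineSpan_eq_top_iff_card_eq_finrank_add_one.2 (by simp)
  let b : AffineBasis (Fin 3) ℝ Plane := ⟨T.points, T.independent, htop⟩
  have hKb : K = {x | ∀ i, 0 ≤ b.coord i x} := hT.trans b.convexHull_eq_nonneg_coord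
  refine Real.sSup_le ?_ (by norm_num)
  rintro α ⟨⟨h0, h1⟩, x, hx⟩
  obtain ⟨i, hi⟩ : ∃ i, 1 / 3 ≤ b.coord i x := by
    by_contra! hlt
    have hs := b.sum_coord_apply_eq_one x
    rw [Fin.sum_univ_three] at hs
    linarith [hlt 0, hlt 1, hlt 2]
  set L : Plane →L[ℝ] ℝ := (b.coord i).linear.toContinuousLinearMap with hL
  set w : Plane := (InnerProductSpace.toDual ℝ Plane).symm L with hw
  have hcoord : ∀ y z, b.coord i y - b.coord i z = inner ℝ (y - z) w := by
    intro y z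
    rw [real_inner_comm, hw, InnerProductSpace.toDual_symm_apply, hL]
    simpa using ((b.coord i).linearMap_vsub y z).symm
  -- `w` is the gradient of the chosen coordinate; the sign makes that coordinate at least its value
  -- at `x` on the right half-plane.
  obtain ⟨θ, hθ⟩ := exists_eq_smul_nor (-w)
  have hw' : w = -(‖w‖ • nor θ) := by rw [← norm_neg w, ← hθ, neg_neg]
  have hsub : K ∩ rightHalfPlane θ (inner ℝ x (nor θ)) ⊆
      AffineMap.homothety (b i) (2 / 3 : ℝ) '' K := by
    rintro y ⟨hy, hyx⟩
    have hyx' : (inner ℝ y (nor θ) : ℝ) ≤ inner ℝ x (nor θ) := hyx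
    have hyi : 1 / 3 ≤ b.coord i y := by
      have h2 := hcoord y x
      rw [hw', inner_neg_right, inner_smul_right, inner_sub_left] at h2
      nlinarith [norm_nonneg w]
    refine ⟨AffineMap.homothety (b i) (3 / 2 : ℝ) y, ?_, ?_⟩
    · rw [hKb] at hy ⊢
      intro j
      have e : b.coord j (AffineMap.homothety (b i) (3 / 2 : ℝ) y) =
          3 / 2 * (b.coord j y - b.coord j (b i)) + b.coord j (b i) := by
        rw [AffineMap.homothety_eq_lineMap, AffineMap.apply_lineMap, AffineMap.lineMap_apply]
        simp
      rw [e]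
      rcases eq_or_ne j i with rfl | hji
      · rw [b.coord_apply_eq]; linarith
      · rw [b.coord_apply_ne hji]; linarith [hy j]
    · simp only [AffineMap.homothety_apply, vsub_eq_sub, vadd_eq_add, add_sub_cancel_right,
        smul_smul]
      norm_num
  have hx' := (hK.mem_core_iff_area h0 h1).1 hx θ
  have hvol : volume.real (AffineMap.homothety (b i) (2 / 3 : ℝ) '' K) = 4 / 9 * volume.real K := by
    rw [measureReal_def, Measure.addHaar_image_homothety, ENNReal.toReal_mul, measureReal_def,
      ENNReal.toReal_ofReal (abs_nonneg _)]
    norm_num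
  have hle : area K θ (inner ℝ x (nor θ)) ≤ 4 / 9 * volume.real K := by
    rw [← hvol]
    refine measureReal_mono hsub ?_
    rw [Measure.addHaar_image_homothety]
    exact ENNReal.mul_ne_top ENNReal.ofReal_ne_top hK.volume_ne_top
  exact le_of_mul_le_mul_right (hx'.trans hle) hK.volume_pos

end AlphaCore

end

theorem propositiont3 (K : Set AlphaCore.Plane) (hconv : Convex ℝ K) (hcomp : IsCompact K)
    (hint : (interior K).Nonempty) :
    (∀ α : ℝ, AlphaCore.alphaZ K < α → α < 1 - AlphaCore.alphaZ K →
      ¬ AlphaCore.IsC1Curve (AlphaCore.envelope K α)) ∧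
    (AlphaCore.IsCoreCriticalValue K (AlphaCore.alphaK K) ∧
      4 / 9 ≤ AlphaCore.alphaK K ∧ AlphaCore.alphaK K ≤ 1 / 2 ∧
      (AlphaCore.alphaK K = 4 / 9 ↔ AlphaCore.IsTriangle K) ∧
      (AlphaCore.alphaK K = 1 / 2 ↔ AlphaCore.IsCentrallySymmetric K)) ∧
    (¬ AlphaCore.IsCentrallySymmetric K → AlphaCore.alphaB K < AlphaCore.alphaK K) ∧
    (AlphaCore.IsCentrallySymmetric K →
      AlphaCore.alphaB K = 1 / 2 ∧ AlphaCore.alphaK K = 1 / 2) := by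
  have hK : AlphaCore.IsBody K := ⟨hconv, hcomp, hint⟩
  have h49 := hK.four_ninths_le_alphaK
  have hpos : 0 < AlphaCore.alphaK K := by linarith
  exact ⟨fun α h1 h2 => hK.not_isC1Curve h1 h2,
    ⟨hK.isCoreCriticalValue hpos, h49, hK.alphaK_le,
      ⟨hK.isTriangle_of_alphaK, fun h => le_antisymm (hK.alphaK_le_of_isTriangle h) h49⟩,
      hK.alphaK_eq_half_iff hpos⟩,
    hK.alphaB_lt_alphaK hpos,
    fun h => ⟨hK.alphaB_eq_half h, (hK.alphaK_eq_half_iff hpos).2 h⟩⟩
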